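/- Let $d\ge 1$, $\mathbb T^d=\mathbb R^d/\mathbb Z^d$, $1<p\le 2\le q<\infty$, $p'=p/(p-1)$, $a>d/2$, $0<s<\frac{a}{q-1}$, $L>0$. For $s_0\in\mathbb R$, $p_0\in(1,\infty)$, $q_0\in[1,\infty]$ let $B^{s_0}_{p_0,q_0}=B^{s_0}_{p_0,q_0}(\mathbb T^d)$ be the Besov space of real periodic distributions with norm $$\|u\|_{B^{s_0}_{p_0,q_0}}=\Big[\sum_{j\ge 0}2^{js_0q_0}\Big\|\sum_{z\in I_j}\hat u(z)e^{2\pi i z\cdot x}\Big\|_{L^{p_0}(\mathbb T^d)}^{q_0}\Big]^{1/q_0}$$ (supremum over $j$ if $q_0=\infty$), where $I_0=\{z\in\mathbb Z^d:|2\pi z|_\infty\le 1\}$ and $I_j=\{z\in\mathbb Z^d:2^{j-1}<|2\pi z|_\infty\le 2^j\}$ for $j\ge1$. Let $(\phi_{j,l})_{j\in\mathbb N_0,\,l\in I'_j}$, with countable index sets $I'_j$, be a wavelet system of regularity $\sigma\in\mathbb N$, $\sigma>a$: an orthonormal system in $L^2(\mathbb T^d)$ of real $C^\sigma$ functions such that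 for all $p_0\in(1,\infty)$, $q_0\in[1,\infty]$, $|s_0|<\sigma$, a distribution $u\in (C^\sigma(\mathbb T^d))'$ lies in $B^{s_0}_{p_0,q_0}$ iff $$\|u\|_{\mathcal W,B^{s_0}_{p_0,q_0}}=\Big[\sum_j 2^{js_0q_0}2^{jd(\frac12-\frac1{p_0})q_0}\Big(\sum_{l\in I'_j}|\langle u,\phi_{j,l}\rangle|^{p_0}\Big)^{q_0/p_0}\Big]^{1/q_0}$$ (supremum over $j$ if $q_0=\infty$) is finite, and the two norms are equivalent. Put $r=\max\{2,p,q\}$ and $\mathcal R(f)=\frac1r\|f\|_{\mathcal W,B^0_{p,q}}^r$. Let $\mathcal D\subset B^0_{p,q}$ be closed and convex, and let $F:\mathcal D\to L^2(\mathbb T^d)$ take values in $B^{d/2}_{p,1}$ and satisfy, for all $f_1,f_2\in\mathcal D$, $$\|F(f_1)-F(f_2)\|_{B^a_{p,q}}\le L\|f_1-f_2\|_{B^0_{p,q}},\qquad \tfrac1L\|f_1-f_2\|_{B^{-a}_{2,2}}\le\|F(f_1)-F(f_2)\|_{L^2}\le L\|f_1-f_2\|_{B^{-a}_{2,2}}.$$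 Let $f^\dagger\in\mathcal D$ with $\|f^\dagger\|_{B^s_{p,\infty}}\le\varrho$, $\varrho>0$. For $\varepsilon>0$ the data are $g^{\rm obs}=F(f^\dagger)+\varepsilon Z$, where $Z$ is a random distribution on $\mathbb T^d$ with $Z\in B^{-d/2}_{p',\infty}$ almost surely and $$\mathbb P\big[\|Z\|_{B^{-d/2}_{p',\infty}}>M_Z+t\big]\le\exp(-C_Zt^\mu)\qquad\text{for all }t>0,$$ with constants $C_Z,M_Z,\mu>0$. Then there is a constant $K>0$ such that for $$\alpha=K\,\varrho^{-\frac{qa+(q-2)d/2}{a+s+d/2}}\,\varepsilon^{\frac{2(a+s)-qs}{a+s+d/2}}$$ the following holds. Almost surely the Tikhonov functional $$f\mapsto\tfrac12\|F(f)\|_{L^2}^2-\langle g^{\rm obs},F(f)\rangle+\alpha\mathcal R(f)$$ has a global minimizer over $\mathcal D$, and there is $c>0$ such that, whenever $\hat f_\alpha$ is almost surely such a minimizer, for all $t>0$ $$\mathbb P\Big[\|\hat f_\alpha-f^\dagger\|_{B^0_{p,q}}>(c+t)\,\varrho^{\frac{a+d/2}{a+s+d/2}}\varepsilon^{\frac{s}{a+s+d/2}}\Big]\le\exp\Big(-C_Z\,t^{\mu\left(\frac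 q2+\frac{(q-2)d}{4a}\right)}\Big).$$ Moreover, for every $m\ge1$ there is $C_m>0$ with $$\Big(\mathbb E\,\|\hat f_\alpha-f^\dagger\|_{B^0_{p,q}}^m\Big)^{1/m}\le C_m\,\varrho^{\frac{a+d/2}{a+s+d/2}}\varepsilon^{\frac{s}{a+s+d/2}}.$$ The constant $K$ depends only on $d,p,q,a,s,L$ and the wavelet system; $c$ depends in addition only on $C_Z,M_Z,\mu$, and $C_m$ also on $m$. In particular they do not depend on $f^\dagger$, $\hat f_\alpha$, $\varepsilon$, $\varrho$. -/

import Mathlib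

open MeasureTheory Set Filter Topology
open scoped ENNReal NNReal

noncomputable section

namespace TorusBesov

/-! ### The torus, test functions and distributions -/

/-- The normalised Haar (Lebesgue) measure on the torus `ℝᵈ / ℤᵈ`. -/
def torusMeasure (d : ℕ) : Measure (UnitAddTorus (Fin d)) :=
  Measure.pi fun _ => AddCircle.haarAddCircle

instance (d : ℕ) : IsProbabilityMeasure (torusMeasure d) := by
  unfold torusMeasure; infer_instance

/-- The covering map `ℝᵈ → ℝᵈ / ℤᵈ`. -/
def toTorus {d : ℕ} (x : Fin d → ℝ) : UnitAddTorus (Fin d) := fun i => (x i : UnitAddCircle)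

/-- The real vector space `Cⁿ(𝕋ᵈ)`, `n ∈ ℕ ∪ {∞}`: real continuous functions on the torus whose
periodic lift to `ℝᵈ` is of class `Cⁿ`. -/
def CkFun (n : ℕ∞) (d : ℕ) : Submodule ℝ C(UnitAddTorus (Fin d), ℝ) where
  carrier := {φ | ContDiff ℝ n fun x : Fin d → ℝ => φ (toTorus x)}
  zero_mem' := by simpa using contDiff_const
  add_mem' := fun {φ ψ} ha hb => by
    simp only [mem_ofPred_eq] at ha hb ⊢
    exact ha.add hb
  smul_mem' := fun c φ h => by
    simp only [mem_ofPred_eq] at h ⊢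
    exact h.const_smul c

/-- The function `φ` and its derivatives up to order `k` are bounded by `B`
(that is, `‖φ‖_{C^k} ≤ B`). -/
def CkBound {n : ℕ∞} {d : ℕ} (k : ℕ) (φ : CkFun n d) (B : ℝ) : Prop :=
  ∀ j ≤ k, ∀ x : Fin d → ℝ,
    ‖iteratedFDeriv ℝ j (fun y : Fin d → ℝ => φ.1 (toTorus y)) x‖ ≤ B

theorem CkBound.nonneg {n : ℕ∞} {d k : ℕ} {φ : CkFun n d} {B : ℝ} (h : CkBound k φ B) : 0 ≤ B :=
  (norm_nonneg _).trans (h 0 (Nat.zero_le _) 0)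

theorem CkBound.mono {n : ℕ∞} {d k l : ℕ} {φ : CkFun n d} {B : ℝ} (h : CkBound k φ B)
    (hl : l ≤ k) : CkBound l φ B := fun j hj x => h j (hj.trans hl) x

/-- The topological dual `(Cⁿ(𝕋ᵈ))'`. For `n = ⊤` these are the (real) distributions `𝒟'(𝕋ᵈ)`,
for finite `n` the distributions which act on `Cⁿ(𝕋ᵈ)`. -/
def Distr (n : ℕ∞) (d : ℕ) : Submodule ℝ (CkFun n d →ₗ[ℝ] ℝ) where
  carrier := {u | ∃ k : ℕ, (k : ℕ∞) ≤ n ∧ ∃ C : ℝ, 0 ≤ C ∧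
    ∀ (φ : CkFun n d) (B : ℝ), CkBound k φ B → |u φ| ≤ C * B}
  zero_mem' := ⟨0, by simp, 0, le_rfl, by simp⟩
  add_mem' := by
    rintro u v ⟨k, hk, C, hC, hu⟩ ⟨l, hl, E, hE, hv⟩
    refine ⟨max k l, by
      rcases max_choice k l with h | h <;> rw [h] <;> assumption, C + E, add_nonneg hC hE, fun φ B hB => ?_⟩
    calc |u φ + v φ| ≤ |u φ| + |v φ| := abs_add_le _ _
      _ ≤ C * B + E * B := add_le_add (hu φ B (hB.mono (le_max_left _ _)))
          (hv φ B (hB.mono (le_max_right _ _)))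
      _ = (C + E) * B := by ring
  smul_mem' := by
    rintro c u ⟨k, hk, C, hC, hu⟩
    refine ⟨k, hk, |c| * C, mul_nonneg (abs_nonneg _) hC, fun φ B hB => ?_⟩
    calc |c * u φ| = |c| * |u φ| := abs_mul _ _
      _ ≤ |c| * (C * B) := mul_le_mul_of_nonneg_left (hu φ B hB) (abs_nonneg _)
      _ = |c| * C * B := by ring

/-- The real Hilbert space `L²(𝕋ᵈ)`. -/
abbrev L2 (d : ℕ) := Lp ℝ 2 (torusMeasure d)

theorem toTorus_surjective {d : ℕ} : Function.Surjective (toTorus (d := d)) := fun y => by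
  choose x hx using fun i => QuotientAddGroup.mk_surjective (y i)
  exact ⟨x, funext hx⟩

theorem L2.integrable_mul {d : ℕ} (g : L2 d) (φ : C(UnitAddTorus (Fin d), ℝ)) :
    Integrable (fun x => g x * φ x) (torusMeasure d) := by
  have hg : Integrable g (torusMeasure d) := (Lp.memLp g).integrable (by norm_num)
  exact hg.mul_bdd (c := ‖φ‖) φ.continuous.aestronglyMeasurable
    (Eventually.of_forall fun x => φ.norm_coe_le_norm x)

/-- The distribution `φ ↦ ∫ g φ` given by a square integrable function `g`. -/
def ofL2 (n : ℕ∞) {d : ℕ} (g : L2 d) : Distr n d where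
  val :=
    { toFun := fun φ => ∫ x, g x * φ.1 x ∂torusMeasure d
      map_add' := fun φ ψ => by
        rw [← integral_add (L2.integrable_mul g φ.1) (L2.integrable_mul g ψ.1)]
        simp [mul_add]
      map_smul' := fun c φ => by
        simp only [RingHom.id_apply, smul_eq_mul, ← integral_const_mul]
        congr 1; ext x; simp; ring }
  property := by
    refine ⟨0, by simp, ∫ x, ‖g x‖ ∂torusMeasure d, integral_nonneg fun _ => norm_nonneg _,
      fun φ B hB => ?_⟩
    have hg : Integrable g (torusMeasure d) := (Lp.memLp g).integrable (by norm_num)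
    rw [← integral_mul_const, ← Real.norm_eq_abs]
    refine norm_integral_le_of_norm_le (hg.norm.mul_const B) (Eventually.of_forall fun x => ?_)
    obtain ⟨y, rfl⟩ := toTorus_surjective x
    have := hB 0 le_rfl y
    rw [norm_iteratedFDeriv_zero] at this
    rw [norm_mul]
    exact mul_le_mul_of_nonneg_left this (norm_nonneg _)

/-! ### Fourier coefficients -/

theorem contDiff_mFourier (n : ℕ∞) {d : ℕ} (z : Fin d → ℤ) :
    ContDiff ℝ n fun x : Fin d → ℝ => UnitAddTorus.mFourier z (toTorus x) := by
  simp only [UnitAddTorus.mFourier, toTorus, ContinuousMap.coe_mk, fourier_coe_apply]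
  refine contDiff_prod fun i _ => ?_
  refine ContDiff.cexp (ContDiff.div_const (ContDiff.mul contDiff_const ?_) _)
  exact Complex.ofRealCLM.contDiff.comp (contDiff_apply ℝ ℝ i)

/-- `x ↦ cos (2 π z·x)`, the real part of `e_z(x) = exp (2 π i z·x)`. -/
def cosFun (n : ℕ∞) {d : ℕ} (z : Fin d → ℤ) : CkFun n d where
  val := ⟨fun x => (UnitAddTorus.mFourier z x).re, by fun_prop⟩
  property := Complex.reCLM.contDiff.comp (contDiff_mFourier n z)

/-- `x ↦ sin (2 π z·x)`, the imaginary part of `e_z(x) = exp (2 π i z·x)`. -/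
def sinFun (n : ℕ∞) {d : ℕ} (z : Fin d → ℤ) : CkFun n d where
  val := ⟨fun x => (UnitAddTorus.mFourier z x).im, by fun_prop⟩
  property := Complex.imCLM.contDiff.comp (contDiff_mFourier n z)

/-- The Fourier coefficient `û(z) = ⟨u, exp (-2 π i z·x)⟩`. -/
def coeff {n : ℕ∞} {d : ℕ} (u : Distr n d) (z : Fin d → ℤ) : ℂ :=
  (u.1 (cosFun n z) : ℂ) - Complex.I * (u.1 (sinFun n z) : ℂ)

/-! ### Besov norms -/

/-- The frequencies of the `j`-th dyadic block: `|2πz|_∞ ≤ 1` for `j = 0`, and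
`2^{j-1} < |2πz|_∞ ≤ 2^j` for `j ≥ 1`. -/
def dyadicSet (d : ℕ) : ℕ → Set (Fin d → ℤ)
  | 0 => {z | ∀ i, 2 * Real.pi * |(z i : ℝ)| ≤ 1}
  | j + 1 => {z | (∀ i, 2 * Real.pi * |(z i : ℝ)| ≤ 2 ^ (j + 1)) ∧
      ¬ ∀ i, 2 * Real.pi * |(z i : ℝ)| ≤ 2 ^ j}

theorem dyadicSet_bound {d j : ℕ} {z : Fin d → ℤ} (h : z ∈ dyadicSet d j) (i : Fin d) :
    2 * Real.pi * |(z i : ℝ)| ≤ 2 ^ j := by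
  cases j with
  | zero => simpa using h i
  | succ j => exact h.1 i

theorem dyadicSet_finite (d j : ℕ) : (dyadicSet d j).Finite := by
  refine (Set.finite_Icc (fun _ => -(2 ^ j : ℤ) : Fin d → ℤ) fun _ => (2 ^ j : ℤ)).subset ?_
  intro z hz
  have key : ∀ i, |z i| ≤ (2 ^ j : ℤ) := fun i => by
    have h1 := dyadicSet_bound hz i
    have h2 : |(z i : ℝ)| ≤ 2 ^ j := by
      nlinarith [Real.pi_gt_three, abs_nonneg (z i : ℝ)]
    exact_mod_cast h2
  exact ⟨fun i => (abs_le.1 (key i)).1, fun i => (abs_le.1 (key i)).2⟩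

/-- The finite set of frequencies of the `j`-th dyadic block. -/
def dyadicBlock (d j : ℕ) : Finset (Fin d → ℤ) := (dyadicSet_finite d j).toFinset

/-- The `j`-th Littlewood-Paley block `∑_{z ∈ I_j} û(z) e_z`. -/
def lpBlock {n : ℕ∞} {d : ℕ} (u : Distr n d) (j : ℕ) (x : UnitAddTorus (Fin d)) : ℂ :=
  ∑ z ∈ dyadicBlock d j, coeff u z * UnitAddTorus.mFourier z x

/-- The `ℓ^q` norm of a nonnegative family, `q ∈ [1,∞]`. -/
def lqNorm {κ : Type*} (q : ℝ≥0∞) (w : κ → ℝ≥0∞) : ℝ≥0∞ :=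
  if q = ∞ then ⨆ k, w k else (∑' k, w k ^ q.toReal) ^ (q.toReal)⁻¹

/-- The norm of the Besov space `B^s_{p,q}(𝕋ᵈ)`, `p ∈ (1,∞)`, `q ∈ [1,∞]`, defined by the dyadic
decomposition of the Fourier series; it is `∞` outside of `B^s_{p,q}(𝕋ᵈ)`. -/
def besovNorm {n : ℕ∞} {d : ℕ} (s : ℝ) (p q : ℝ≥0∞) (u : Distr n d) : ℝ≥0∞ :=
  lqNorm q fun j : ℕ => (2 : ℝ≥0∞) ^ ((j : ℝ) * s) * eLpNorm (lpBlock u j) p (torusMeasure d)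

/-- The duality pairing of distributions, `⟨u, v⟩ = ∑_j ∑_{z ∈ I_j} û(z) \overline{v̂(z)}`.
For `u ∈ B^{-s}_{p',∞}` and `v ∈ B^s_{p,1}` the series over the blocks converges absolutely;
for `u, v ∈ L²` this is the inner product of `L²`. -/
def pairing {n m : ℕ∞} {d : ℕ} (u : Distr n d) (v : Distr m d) : ℝ :=
  ∑' j : ℕ, ∑ z ∈ dyadicBlock d j, (coeff u z * (starRingEnd ℂ) (coeff v z)).re

/-! ### Wavelet systems -/

/-- The wavelet Besov norm of `u ∈ (C^σ)'` with respect to `(φ_{j,l})`, where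
`λ_{j,l} = ⟨u, φ_{j,l}⟩`:
`(∑_j 2^{jsq} 2^{jd(1/2-1/p)q} (∑_l |λ_{j,l}|^p)^{q/p})^{1/q}`. -/
def waveletNorm {n : ℕ∞} {d : ℕ} {ι : ℕ → Type*} (φ : ∀ j, ι j → CkFun n d)
    (s : ℝ) (p q : ℝ≥0∞) (u : Distr n d) : ℝ≥0∞ :=
  lqNorm q fun j : ℕ => (2 : ℝ≥0∞) ^ ((j : ℝ) * s) *
    (2 : ℝ≥0∞) ^ ((j : ℝ) * d * (1 / 2 - (p.toReal)⁻¹)) *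
    lqNorm p fun l : ι j => ‖u.1 (φ j l)‖ₑ

/-- An orthonormal system `(φ_{j,l})` of `C^σ` functions in `L²(𝕋ᵈ)` is a wavelet system of
regularity `σ` if it generates the Besov spaces: for all `|s| < σ`, membership in `B^s_{p,q}` is
equivalent to finiteness of the wavelet norm, and the two norms are equivalent. -/
structure IsWaveletSystem {σ d : ℕ} {ι : ℕ → Type*} (φ : ∀ j, ι j → CkFun σ d) : Prop where
  orthonormal_self : ∀ (j : ℕ) (l : ι j), ∫ x, (φ j l).1 x * (φ j l).1 x ∂torusMeasure d = 1
  orthonormal_ne : ∀ a b : Σ j, ι j, a ≠ b →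
    ∫ x, (φ a.1 a.2).1 x * (φ b.1 b.2).1 x ∂torusMeasure d = 0
  norm_equiv : ∀ p q : ℝ≥0∞, 1 < p → p < ∞ → 1 ≤ q → ∀ s : ℝ, |s| < σ →
    ∃ A : ℝ≥0, 0 < A ∧ ∀ u : Distr σ d,
      besovNorm s p q u ≤ A * waveletNorm φ s p q u ∧
      waveletNorm φ s p q u ≤ A * besovNorm s p q u

/-! ### Forward operator, Tikhonov functional and noise -/

/-- `D` is a closed (with respect to the norm of `B^0_{p,q}`) and convex subset of `B^0_{p,q}`. -/
structure IsClosedConvexIn {n : ℕ∞} {d : ℕ} (p q : ℝ) (D : Set (Distr n d)) : Prop where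
  finite : ∀ f ∈ D, besovNorm 0 (.ofReal p) (.ofReal q) f < ∞
  convex : Convex ℝ D
  closed : ∀ (f : ℕ → Distr n d) (g : Distr n d), (∀ k, f k ∈ D) →
    Tendsto (fun k => besovNorm 0 (.ofReal p) (.ofReal q) (f k - g)) atTop (𝓝 0) → g ∈ D

/-- The operator `F : D ⊂ B^0_{p,q} → L²` is `a`-times smoothing with constant `L`. The first
field makes the pairing of `F f` with data in `B^{-d/2}_{p',∞}` well-defined. -/
structure IsSmoothing {n : ℕ∞} {d : ℕ} (p q a L : ℝ) (D : Set (Distr n d))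
    (F : Distr n d → L2 d) : Prop where
  range_subset : ∀ f ∈ D, besovNorm ((d : ℝ) / 2) (.ofReal p) 1 (ofL2 n (F f)) < ∞
  lipschitz_besov : ∀ f₁ ∈ D, ∀ f₂ ∈ D,
    besovNorm a (.ofReal p) (.ofReal q) (ofL2 n (F f₁ - F f₂)) ≤
      .ofReal L * besovNorm 0 (.ofReal p) (.ofReal q) (f₁ - f₂)
  lipschitz_L2 : ∀ f₁ ∈ D, ∀ f₂ ∈ D,
    ‖F f₁ - F f₂‖ₑ ≤ .ofReal L * besovNorm (-a) 2 2 (f₁ - f₂)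
  inverse_lipschitz : ∀ f₁ ∈ D, ∀ f₂ ∈ D,
    besovNorm (-a) 2 2 (f₁ - f₂) ≤ .ofReal L * ‖F f₁ - F f₂‖ₑ

/-- The penalty `(1/r) ‖f‖^r`, `r = max {2, p, q}`, with the wavelet norm of `B^0_{p,q}`. -/
def penalty {n : ℕ∞} {d : ℕ} {ι : ℕ → Type*} (φ : ∀ j, ι j → CkFun n d) (p q : ℝ)
    (f : Distr n d) : ℝ :=
  1 / max 2 (max p q) *
    (waveletNorm φ 0 (.ofReal p) (.ofReal q) f).toReal ^ max 2 (max p q)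

/-- The Tikhonov functional `½ ‖F f‖² - ⟨g_obs, F f⟩ + α R(f)`. -/
def tikhonov {n : ℕ∞} {d : ℕ} {ι : ℕ → Type*} (φ : ∀ j, ι j → CkFun n d) (p q : ℝ)
    (F : Distr n d → L2 d) (gobs : Distr ⊤ d) (α : ℝ) (f : Distr n d) : ℝ :=
  1 / 2 * ‖F f‖ ^ 2 - pairing gobs (ofL2 ⊤ (F f)) + α * penalty φ p q f

/-- `f` is a global minimizer over `D` of the Tikhonov functional. -/
def IsTikhonovMinimizer {n : ℕ∞} {d : ℕ} {ι : ℕ → Type*} (φ : ∀ j, ι j → CkFun n d) (p q : ℝ)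
    (D : Set (Distr n d)) (F : Distr n d → L2 d) (gobs : Distr ⊤ d) (α : ℝ)
    (f : Distr n d) : Prop :=
  f ∈ D ∧ ∀ h ∈ D, tikhonov φ p q F gobs α f ≤ tikhonov φ p q F gobs α h

/-- The random distribution `Z` lies in `B^{-d/2}_{p,∞}` almost surely and satisfies the deviation
inequality `P(‖Z‖ > M + t) ≤ exp(-C t^μ)`, `t > 0`, in this space. -/
structure DeviationInequality {Ω : Type*} [MeasurableSpace Ω] (P : Measure Ω) {d : ℕ}
    (Z : Ω → Distr ⊤ d) (p C M μ : ℝ) : Prop where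
  measurable : ∀ φ : CkFun ⊤ d, Measurable fun ω => (Z ω).1 φ
  ae_finite : ∀ᵐ ω ∂P, besovNorm (-((d : ℝ) / 2)) (.ofReal p) ∞ (Z ω) < ∞
  deviation : ∀ t : ℝ, 0 < t →
    P {ω | ENNReal.ofReal (M + t) < besovNorm (-((d : ℝ) / 2)) (.ofReal p) ∞ (Z ω)} ≤
      ENNReal.ofReal (Real.exp (-C * t ^ μ))

/-- The convergence rate `ϱ^{(a+d/2)/(a+s+d/2)} ε^{s/(a+s+d/2)}`. -/
def convRate (d : ℕ) (a s ρ ε : ℝ) : ℝ :=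
  ρ ^ ((a + d / 2) / (a + s + d / 2)) * ε ^ (s / (a + s + d / 2))

/-- The parameter choice
`α = K ϱ^{-(qa+(q-2)d/2)/(a+s+d/2)} ε^{(2(a+s)-qs)/(a+s+d/2)}`. -/
def paramChoice (d : ℕ) (q a s K ρ ε : ℝ) : ℝ :=
  K * ρ ^ (-((q * a + (q - 2) * (d / 2)) / (a + s + d / 2))) *
    ε ^ ((2 * (a + s) - q * s) / (a + s + d / 2))

end TorusBesov

end

noncomputable section

namespace TorusBesov

/-! ### Uniform convexity of `ℓ^p`, `1 < p ≤ 2` -/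

theorem convexOn_abs_rpow_sub_sq {p : ℝ} (hp : 1 < p) (hp2 : p ≤ 2) :
    ConvexOn ℝ (Icc (-1) 1) fun x : ℝ => |x| ^ p - p * (p - 1) / 2 * x ^ 2 := by
  have hd : ∀ x : ℝ, HasDerivAt (fun x : ℝ => |x| ^ p - p * (p - 1) / 2 * x ^ 2)
      (p * |x| ^ (p - 2) * x - p * (p - 1) * x) x := fun x => by
    have h2 : HasDerivAt (fun x : ℝ => x ^ 2) (2 * x) x := by simpa using hasDerivAt_pow 2 x
    have h := (hasDerivAt_abs_rpow x hp).sub (h2.const_mul (p * (p - 1) / 2))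
    exact h.congr_deriv (by ring)
  set g : ℝ → ℝ := fun x => p * |x| ^ (p - 2) * x - p * (p - 1) * x with hg
  have hodd : ∀ x, g (-x) = - g x := fun x => by simp [hg]; ring
  have hpos : ∀ x, 0 < x → g x = p * (x ^ (p - 1) - (p - 1) * x) := fun x hx => by
    have : x ^ (p - 2) * x = x ^ (p - 1) := by
      rw [← Real.rpow_add_one hx.ne']; congr 1; ring
    simp only [hg, abs_of_pos hx]
    rw [← this]; ring
  have hmono : ∀ x y : ℝ, 0 < x → x ≤ y → y < 1 → g x ≤ g y := by
    intro x y hx hxy hy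
    have : MonotoneOn (fun x : ℝ => x ^ (p - 1) - (p - 1) * x) (Ioo 0 1) := by
      apply monotoneOn_of_hasDerivWithinAt_nonneg (convex_Ioo 0 1)
        (f' := fun x => (p - 1) * x ^ (p - 1 - 1) - (p - 1) * 1)
      · intro z hz
        exact ((Real.continuousAt_rpow_const z _ (Or.inl hz.1.ne')).sub
          (by fun_prop)).continuousWithinAt
      · intro z hz
        rw [interior_Ioo] at hz
        exact ((Real.hasDerivAt_rpow_const (Or.inl hz.1.ne')).sub
          ((hasDerivAt_id z).const_mul _)).hasDerivWithinAt
      · intro z hz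
        rw [interior_Ioo] at hz
        have : 1 ≤ z ^ (p - 1 - 1) :=
          Real.one_le_rpow_of_pos_of_le_one_of_nonpos hz.1 hz.2.le (by linarith)
        nlinarith
    rw [hpos x hx, hpos y (hx.trans_le hxy)]
    exact mul_le_mul_of_nonneg_left (this ⟨hx, hxy.trans_lt hy⟩ ⟨hx.trans_le hxy, hy⟩ hxy)
      (by linarith)
  have h0 : g 0 = 0 := by simp [hg]
  have hnn : ∀ y, 0 < y → y < 1 → 0 ≤ g y := by
    intro y hy hy1
    rw [hpos y hy]
    have h1 : y ≤ y ^ (p - 1) := by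
      conv_lhs => rw [← Real.rpow_one y]
      exact Real.rpow_le_rpow_of_exponent_ge hy hy1.le (by linarith)
    have : (p - 1) * y ≤ y := by nlinarith
    exact mul_nonneg (by linarith) (by linarith)
  have hgm : MonotoneOn g (Ioo (-1) 1) := by
    intro x hx y hy hxy
    rcases lt_trichotomy x 0 with hx0 | hx0 | hx0
    · have hgx : g x = - g (-x) := by rw [hodd]; ring
      rcases lt_trichotomy y 0 with hy0 | hy0 | hy0
      · have hgy : g y = - g (-y) := by rw [hodd]; ring
        rw [hgx, hgy]
        exact neg_le_neg (hmono _ _ (by linarith) (by linarith) (by linarith [hx.1]))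
      · rw [hgx, hy0, h0]
        linarith [hnn (-x) (by linarith) (by linarith [hx.1])]
      · rw [hgx]
        linarith [hnn (-x) (by linarith) (by linarith [hx.1]), hnn y hy0 hy.2]
    · rcases hxy.eq_or_lt with h | h
      · rw [h]
      · rw [hx0, h0]; exact hnn y (by linarith) hy.2
    · exact hmono x y hx0 hxy hy.2
  have hder : deriv (fun x : ℝ => |x| ^ p - p * (p - 1) / 2 * x ^ 2) = g :=
    funext fun x => (hd x).deriv
  refine MonotoneOn.convexOn_of_deriv (convex_Icc _ _)
    (fun x _ => (hd x).continuousAt.continuousWithinAt)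
    (fun x _ => (hd x).differentiableAt.differentiableWithinAt) ?_
  rw [hder, interior_Icc]; exact hgm

theorem abs_midpoint_rpow_add_le {p : ℝ} (hp : 1 < p) (hp2 : p ≤ 2) {u v M : ℝ} (hM : 0 < M)
    (hu : |u| ≤ M) (hv : |v| ≤ M) :
    |(u + v) / 2| ^ p + p * (p - 1) / 2 * (((u - v) / 2) ^ 2 * M ^ (p - 2)) ≤
      (|u| ^ p + |v| ^ p) / 2 := by
  have hmem : ∀ {w : ℝ}, |w| ≤ M → w / M ∈ Icc (-1 : ℝ) 1 := fun {w} hw => by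
    rw [mem_Icc, ← abs_le, abs_div, abs_of_pos hM]; exact (div_le_one hM).2 hw
  have h := (convexOn_abs_rpow_sub_sq hp hp2).2 (hmem hu) (hmem hv)
    (show (0 : ℝ) ≤ 1 / 2 by norm_num) (show (0 : ℝ) ≤ 1 / 2 by norm_num) (by norm_num)
  simp only [smul_eq_mul] at h
  have e : 1 / 2 * (u / M) + 1 / 2 * (v / M) = ((u + v) / 2) / M := by field_simp
  rw [e] at h
  have hs : ∀ w : ℝ, |w / M| ^ p = |w| ^ p / M ^ p := fun w => by
    rw [abs_div, abs_of_pos hM, Real.div_rpow (abs_nonneg _) hM.le]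
  rw [hs, hs, hs] at h
  have hMp : 0 < M ^ p := Real.rpow_pos_of_pos hM p
  have hM2 : M ^ (p - 2) = M ^ p / M ^ 2 := by
    rw [Real.rpow_sub hM, Real.rpow_two]
  rw [hM2]
  have h' := mul_le_mul_of_nonneg_left h hMp.le
  have e1 : M ^ p * (|(u + v) / 2| ^ p / M ^ p - p * (p - 1) / 2 * ((u + v) / 2 / M) ^ 2) =
      |(u + v) / 2| ^ p - p * (p - 1) / 2 * ((u + v) / 2) ^ 2 * (M ^ p / M ^ 2) := by
    field_simp
  have e2 : M ^ p * (1 / 2 * (|u| ^ p / M ^ p - p * (p - 1) / 2 * (u / M) ^ 2) +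
      1 / 2 * (|v| ^ p / M ^ p - p * (p - 1) / 2 * (v / M) ^ 2)) =
      (|u| ^ p + |v| ^ p) / 2 - p * (p - 1) / 2 * ((u ^ 2 + v ^ 2) / 2) * (M ^ p / M ^ 2) := by
    field_simp; ring
  rw [e1, e2] at h'
  nlinarith [h']

theorem sum_rpow_le_mul_of_weight {ι : Type*} (s : Finset ι) {p : ℝ} (hp : 1 < p) (hp2 : p ≤ 2)
    (d M : ι → ℝ) (hM : ∀ i, 0 ≤ M i) (hd : ∀ i, |d i| ≤ M i) :
    (∑ i ∈ s, |d i| ^ p) ^ (2 / p) ≤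
      (∑ i ∈ s, d i ^ 2 * M i ^ (p - 2)) * (∑ i ∈ s, M i ^ p) ^ ((2 - p) / p) := by
  rcases hp2.eq_or_lt with rfl | hp2
  · simp
  have hp0 : 0 < p := by linarith
  have htr : Real.HolderTriple 2 (2 * p / (2 - p)) p := by
    constructor
    · have : 2 - p ≠ 0 := by linarith
      field_simp; ring
    · norm_num
    · exact div_pos (by linarith) (by linarith)
  have h := Real.Lr_rpow_le_Lp_mul_Lq_of_nonneg s (f := fun i => |d i| * M i ^ ((p - 2) / 2))
    (g := fun i => M i ^ ((2 - p) / 2)) htr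
    (fun i _ => mul_nonneg (abs_nonneg _) (Real.rpow_nonneg (hM i) _))
    (fun i _ => Real.rpow_nonneg (hM i) _)
  have e1 : ∀ i, (|d i| * M i ^ ((p - 2) / 2) * M i ^ ((2 - p) / 2)) ^ p = |d i| ^ p := fun i => by
    rcases (hM i).eq_or_lt with h0 | h0
    · have : |d i| = 0 := le_antisymm (by rw [h0]; exact hd i) (abs_nonneg _)
      simp [this]
    · rw [mul_assoc, ← Real.rpow_add h0, show (p - 2) / 2 + (2 - p) / 2 = 0 by ring]; simp
  have e2 : ∀ i, (|d i| * M i ^ ((p - 2) / 2)) ^ (2 : ℝ) = d i ^ 2 * M i ^ (p - 2) := fun i => by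
    rw [Real.mul_rpow (abs_nonneg _) (Real.rpow_nonneg (hM i) _), ← Real.rpow_mul (hM i),
      Real.rpow_two, sq_abs, div_mul_cancel₀ _ two_ne_zero]
  have e3 : ∀ i, (M i ^ ((2 - p) / 2)) ^ (2 * p / (2 - p)) = M i ^ p := fun i => by
    rw [← Real.rpow_mul (hM i)]; congr 1
    have : 2 - p ≠ 0 := by linarith
    field_simp
  simp only [e1, e2, e3] at h
  have hS : 0 ≤ ∑ i ∈ s, d i ^ 2 * M i ^ (p - 2) :=
    Finset.sum_nonneg fun i _ => mul_nonneg (sq_nonneg _) (Real.rpow_nonneg (hM i) _)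
  have hH : 0 ≤ ∑ i ∈ s, M i ^ p := Finset.sum_nonneg fun i _ => Real.rpow_nonneg (hM i) _
  have h' := Real.rpow_le_rpow (Finset.sum_nonneg fun i _ => Real.rpow_nonneg (abs_nonneg _) _) h
    (show 0 ≤ 2 / p by positivity)
  refine h'.trans_eq ?_
  rw [Real.mul_rpow (Real.rpow_nonneg hS _) (Real.rpow_nonneg hH _), ← Real.rpow_mul hS,
    ← Real.rpow_mul hH]
  congr 2
  · rw [show p / 2 * (2 / p) = 1 by field_simp, Real.rpow_one]
  · have : 2 - p ≠ 0 := by linarith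
    field_simp

/-- The modulus of convexity of `‖·‖_p^q`. -/
def convexityConst (p q : ℝ) : ℝ := (p * (p - 1) / 4) ^ (q / 2)

theorem convexityConst_pos {p q : ℝ} (hp : 1 < p) : 0 < convexityConst p q :=
  Real.rpow_pos_of_pos (by nlinarith) _

theorem sum_rpow_uniformConvex {ι : Type*} (s : Finset ι) {p q : ℝ} (hp : 1 < p) (hp2 : p ≤ 2)
    (hq : 2 ≤ q) (u v : ι → ℝ) :
    (∑ i ∈ s, |(u i + v i) / 2| ^ p) ^ (q / p) +
        convexityConst p q * (∑ i ∈ s, |(u i - v i) / 2| ^ p) ^ (q / p) ≤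
      ((∑ i ∈ s, |u i| ^ p) ^ (q / p) + (∑ i ∈ s, |v i| ^ p) ^ (q / p)) / 2 := by
  have hp0 : 0 < p := by linarith
  set k := p * (p - 1) / 2 with hk
  have hkpos : 0 < k := by rw [hk]; nlinarith
  have hk1 : k ≤ 1 := by rw [hk]; nlinarith
  set M : ι → ℝ := fun i => max |u i| |v i| with hMdef
  have hM : ∀ i, 0 ≤ M i := fun i => (abs_nonneg _).trans (le_max_left _ _)
  set d : ι → ℝ := fun i => (u i - v i) / 2 with hddef
  have hdM : ∀ i, |d i| ≤ M i := fun i => by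
    have h1 : |u i - v i| ≤ |u i| + |v i| := abs_sub _ _
    have h2 := le_max_left |u i| |v i|
    have h3 := le_max_right |u i| |v i|
    simp only [hddef, hMdef, abs_div, abs_two]
    linarith
  set Nm := ∑ i ∈ s, |(u i + v i) / 2| ^ p
  set Nd := ∑ i ∈ s, |d i| ^ p
  set U := ∑ i ∈ s, |u i| ^ p
  set V := ∑ i ∈ s, |v i| ^ p
  set S := ∑ i ∈ s, d i ^ 2 * M i ^ (p - 2)
  set H := ∑ i ∈ s, M i ^ p
  have nn : ∀ w : ι → ℝ, 0 ≤ ∑ i ∈ s, |w i| ^ p := fun w =>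
    Finset.sum_nonneg fun i _ => Real.rpow_nonneg (abs_nonneg _) _
  have hU : 0 ≤ U := nn u
  have hV : 0 ≤ V := nn v
  have hNd : 0 ≤ Nd := nn d
  have hNm : 0 ≤ Nm := nn fun i => (u i + v i) / 2
  have hS : 0 ≤ S := Finset.sum_nonneg fun i _ => mul_nonneg (sq_nonneg _) (Real.rpow_nonneg (hM i) _)
  have hH : 0 ≤ H := Finset.sum_nonneg fun i _ => Real.rpow_nonneg (hM i) _
  have hpt : Nm + k * S ≤ (U + V) / 2 := by
    simp only [Nm, S, U, V]
    rw [Finset.mul_sum, ← Finset.sum_add_distrib, ← Finset.sum_add_distrib, Finset.sum_div]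
    refine Finset.sum_le_sum fun i _ => ?_
    rcases (hM i).eq_or_lt with h0 | h0
    · have hu0 : u i = 0 := abs_eq_zero.1 (le_antisymm (h0 ▸ le_max_left _ _) (abs_nonneg _))
      have hv0 : v i = 0 := abs_eq_zero.1 (le_antisymm (h0 ▸ le_max_right _ _) (abs_nonneg _))
      simp [hddef, hu0, hv0, Real.zero_rpow hp0.ne']
    · exact abs_midpoint_rpow_add_le hp hp2 h0 (le_max_left _ _) (le_max_right _ _)
  have hHUV : H ≤ U + V := by
    simp only [H, U, V]
    rw [← Finset.sum_add_distrib]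
    refine Finset.sum_le_sum fun i _ => ?_
    rcases max_choice |u i| |v i| with h | h
    · simp only [hMdef, h]; linarith [Real.rpow_nonneg (abs_nonneg (v i)) p]
    · simp only [hMdef, h]; linarith [Real.rpow_nonneg (abs_nonneg (u i)) p]
  have hD := sum_rpow_le_mul_of_weight s hp hp2 d M hM hdM
  change Nd ^ (2 / p) ≤ S * H ^ ((2 - p) / p) at hD
  set τ := (U + V) / 2 with hτ
  have hτ0 : 0 ≤ τ := by positivity
  have key : Nm ^ (2 / p) + k / 2 * Nd ^ (2 / p) ≤ τ ^ (2 / p) := by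
    rcases hτ0.eq_or_lt with h0 | h0
    · have hU0 : U = 0 := by linarith
      have hV0 : V = 0 := by linarith
      have hH0 : H = 0 := by linarith
      have hS0 : S = 0 := by nlinarith
      have hNm0 : Nm = 0 := by nlinarith
      rw [hNm0, ← h0]
      rw [hS0, zero_mul] at hD
      have : Nd ^ (2 / p) = 0 := le_antisymm hD (Real.rpow_nonneg hNd _)
      simp [this]
    · have h1 : H ^ ((2 - p) / p) ≤ 2 * τ ^ ((2 - p) / p) := by
        have : H ^ ((2 - p) / p) ≤ (2 * τ) ^ ((2 - p) / p) :=
          Real.rpow_le_rpow hH (by rw [hτ]; linarith) (div_nonneg (by linarith) hp0.le)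
        refine this.trans ?_
        rw [Real.mul_rpow (by norm_num) hτ0]
        refine mul_le_mul_of_nonneg_right ?_ (Real.rpow_nonneg hτ0 _)
        conv_rhs => rw [← Real.rpow_one 2]
        exact Real.rpow_le_rpow_of_exponent_le (by norm_num) ((div_le_one hp0).2 (by linarith))
      have h2 : Nd ^ (2 / p) ≤ 2 * S * τ ^ ((2 - p) / p) := by
        calc Nd ^ (2 / p) ≤ S * H ^ ((2 - p) / p) := hD
          _ ≤ S * (2 * τ ^ ((2 - p) / p)) := mul_le_mul_of_nonneg_left h1 hS
          _ = _ := by ring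
      have h3 : Nm ^ (2 / p) ≤ Nm * τ ^ ((2 - p) / p) := by
        rcases hNm.eq_or_lt with hz | hz
        · rw [← hz, Real.zero_rpow (by positivity)]; simp
        · have : Nm ^ (2 / p) = Nm * Nm ^ ((2 - p) / p) := by
            rw [show 2 / p = 1 + (2 - p) / p by field_simp; ring, Real.rpow_add hz, Real.rpow_one]
          rw [this]
          refine mul_le_mul_of_nonneg_left (Real.rpow_le_rpow hNm ?_
            (div_nonneg (by linarith) hp0.le)) hNm
          nlinarith
      have h4 : τ ^ (2 / p) = τ * τ ^ ((2 - p) / p) := by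
        rw [show 2 / p = 1 + (2 - p) / p by field_simp; ring, Real.rpow_add h0, Real.rpow_one]
      rw [h4]
      have h5 := mul_le_mul_of_nonneg_right hpt (Real.rpow_nonneg hτ0 ((2 - p) / p))
      nlinarith [mul_le_mul_of_nonneg_left h2 hkpos.le]
  have hq2 : 1 ≤ q / 2 := by linarith
  have hexp : ∀ x : ℝ, 0 ≤ x → (x ^ (2 / p)) ^ (q / 2) = x ^ (q / p) := fun x hx => by
    rw [← Real.rpow_mul hx]; congr 1; field_simp
  calc Nm ^ (q / p) + convexityConst p q * Nd ^ (q / p)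
      = (Nm ^ (2 / p)) ^ (q / 2) + (k / 2 * Nd ^ (2 / p)) ^ (q / 2) := by
        rw [hexp _ hNm, Real.mul_rpow (by positivity) (Real.rpow_nonneg hNd _), hexp _ hNd,
          convexityConst, hk]
        congr 3; ring
    _ ≤ (Nm ^ (2 / p) + k / 2 * Nd ^ (2 / p)) ^ (q / 2) :=
        Real.add_rpow_le_rpow_add (Real.rpow_nonneg hNm _)
          (mul_nonneg (by positivity) (Real.rpow_nonneg hNd _)) hq2
    _ ≤ (τ ^ (2 / p)) ^ (q / 2) := Real.rpow_le_rpow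
        (add_nonneg (Real.rpow_nonneg hNm _) (mul_nonneg (by positivity) (Real.rpow_nonneg hNd _)))
        key (by linarith)
    _ = τ ^ (q / p) := hexp _ hτ0
    _ ≤ (U ^ (q / p) + V ^ (q / p)) / 2 := by
        have h := (convexOn_rpow (p := q / p) ((one_le_div hp0).2 (by linarith))).2
          (mem_Ici.2 hU) (mem_Ici.2 hV) (show (0 : ℝ) ≤ 1 / 2 by norm_num)
          (show (0 : ℝ) ≤ 1 / 2 by norm_num) (by norm_num)
        simp only [smul_eq_mul] at h
        rw [hτ, show (U + V) / 2 = 1 / 2 * U + 1 / 2 * V by ring]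
        linarith

end TorusBesov

end

noncomputable section

namespace TorusBesov

/-! ### `ℓ^q` norms -/

section lqNorm

variable {κ : Type*}

theorem lqNorm_top (w : κ → ℝ≥0∞) : lqNorm ∞ w = ⨆ k, w k := if_pos rfl

theorem lqNorm_of_ne_top {q : ℝ≥0∞} (hq : q ≠ ∞) (w : κ → ℝ≥0∞) :
    lqNorm q w = (∑' k, w k ^ q.toReal) ^ (q.toReal)⁻¹ := if_neg hq

theorem lqNorm_ofReal {q : ℝ} (hq : 0 ≤ q) (w : κ → ℝ≥0∞) :
    lqNorm (.ofReal q) w = (∑' k, w k ^ q) ^ q⁻¹ := by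
  rw [lqNorm_of_ne_top ENNReal.ofReal_ne_top, ENNReal.toReal_ofReal hq]

theorem lqNorm_ofReal_rpow {q : ℝ} (hq : 0 < q) (w : κ → ℝ≥0∞) :
    lqNorm (.ofReal q) w ^ q = ∑' k, w k ^ q := by
  rw [lqNorm_ofReal hq.le, ← ENNReal.rpow_mul, inv_mul_cancel₀ hq.ne', ENNReal.rpow_one]

theorem lqNorm_one (w : κ → ℝ≥0∞) : lqNorm 1 w = ∑' k, w k := by
  simp [lqNorm_of_ne_top]

theorem lqNorm_mono {q : ℝ≥0∞} {w w' : κ → ℝ≥0∞} (h : ∀ k, w k ≤ w' k) :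
    lqNorm q w ≤ lqNorm q w' := by
  by_cases hq : q = ∞
  · subst hq; rw [lqNorm_top, lqNorm_top]; exact iSup_mono h
  · rw [lqNorm_of_ne_top hq, lqNorm_of_ne_top hq]
    exact ENNReal.rpow_le_rpow (ENNReal.tsum_le_tsum fun k =>
      ENNReal.rpow_le_rpow (h k) ENNReal.toReal_nonneg) (inv_nonneg.2 ENNReal.toReal_nonneg)

theorem le_lqNorm {q : ℝ≥0∞} (hq : 1 ≤ q) (w : κ → ℝ≥0∞) (k : κ) : w k ≤ lqNorm q w := by
  by_cases hq' : q = ∞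
  · subst hq'; rw [lqNorm_top]; exact le_iSup w k
  · rw [lqNorm_of_ne_top hq']
    have h0 : 0 < q.toReal := ENNReal.toReal_pos (by positivity) hq'
    rw [ENNReal.le_rpow_inv_iff h0]
    exact ENNReal.le_tsum (f := fun k => w k ^ q.toReal) k

theorem lqNorm_const_mul {q : ℝ≥0∞} (hq : 1 ≤ q) (c : ℝ≥0∞) (w : κ → ℝ≥0∞) :
    lqNorm q (fun k => c * w k) = c * lqNorm q w := by
  by_cases hq' : q = ∞
  · subst hq'; rw [lqNorm_top, lqNorm_top, ENNReal.mul_iSup]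
  · rw [lqNorm_of_ne_top hq', lqNorm_of_ne_top hq']
    have h0 : 0 < q.toReal := ENNReal.toReal_pos (by positivity) hq'
    simp_rw [ENNReal.mul_rpow_of_nonneg _ _ h0.le]
    rw [ENNReal.tsum_mul_left, ENNReal.mul_rpow_of_nonneg _ _ (inv_nonneg.2 h0.le),
      ← ENNReal.rpow_mul, mul_inv_cancel₀ h0.ne', ENNReal.rpow_one]

theorem tendsto_lqNorm_finset {q : ℝ} (hq : 0 < q) (w : κ → ℝ≥0∞) :
    Tendsto (fun s : Finset κ => (∑ k ∈ s, w k ^ q) ^ q⁻¹) atTop (𝓝 (lqNorm (.ofReal q) w)) := by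
  rw [lqNorm_ofReal hq.le]
  exact ((ENNReal.continuous_rpow_const).tendsto _).comp ENNReal.summable.hasSum

theorem lqNorm_add_le {q : ℝ≥0∞} (hq : 1 ≤ q) (w w' : κ → ℝ≥0∞) :
    lqNorm q (fun k => w k + w' k) ≤ lqNorm q w + lqNorm q w' := by
  by_cases hq' : q = ∞
  · subst hq'; simp only [lqNorm_top]
    exact iSup_le fun k => add_le_add (le_iSup w k) (le_iSup w' k)
  · have h1 : 1 ≤ q.toReal := by
      rw [← ENNReal.toReal_one]; exact ENNReal.toReal_mono hq' hq
    have h0 : 0 < q.toReal := by linarith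
    rw [← ENNReal.ofReal_toReal hq']
    refine le_of_tendsto_of_tendsto' (tendsto_lqNorm_finset h0 _)
      ((tendsto_lqNorm_finset h0 _).add (tendsto_lqNorm_finset h0 _)) fun s => ?_
    simpa only [one_div] using ENNReal.Lp_add_le s w w' h1

/-- `ℓ^p ⊆ ℓ^2` for `p ≤ 2`. -/
theorem lqNorm_two_le {p : ℝ} (hp : 1 ≤ p) (hp2 : p ≤ 2) (w : κ → ℝ≥0∞) :
    lqNorm 2 w ≤ lqNorm (.ofReal p) w := by
  have hp0 : 0 < p := by linarith
  set N := lqNorm (.ofReal p) w with hN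
  rcases eq_or_ne N ∞ with ht | ht
  · rw [ht]; exact le_top
  have h2 : (2 : ℝ≥0∞) = .ofReal 2 := by simp
  rw [h2, lqNorm_ofReal (by norm_num), ENNReal.rpow_inv_le_iff (by norm_num)]
  have hle : ∀ k, w k ≤ N := fun k => le_lqNorm (by simpa using hp) w k
  calc ∑' k, w k ^ (2 : ℝ) ≤ ∑' k, w k ^ p * N ^ (2 - p) := by
        refine ENNReal.tsum_le_tsum fun k => ?_
        calc w k ^ (2 : ℝ) = w k ^ (p + (2 - p)) := by congr 1; ring
          _ = w k ^ p * w k ^ (2 - p) := ENNReal.rpow_add_of_nonneg _ _ hp0.le (by linarith)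
          _ ≤ _ := mul_le_mul_right (ENNReal.rpow_le_rpow (hle k) (by linarith)) _
    _ = N ^ p * N ^ (2 - p) := by rw [ENNReal.tsum_mul_right, hN, lqNorm_ofReal_rpow hp0]
    _ = N ^ (2 : ℝ) := by
        rw [← ENNReal.rpow_add_of_nonneg _ _ hp0.le (by linarith)]; congr 1; ring

theorem enorm_rpow_sum (s : Finset κ) {p : ℝ} (hp : 0 ≤ p) (w : κ → ℝ) :
    ∑ k ∈ s, ‖w k‖ₑ ^ p = ENNReal.ofReal (∑ k ∈ s, |w k| ^ p) := by
  rw [ENNReal.ofReal_sum_of_nonneg fun i _ => Real.rpow_nonneg (abs_nonneg _) _]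
  refine Finset.sum_congr rfl fun k _ => ?_
  rw [← ofReal_norm, Real.norm_eq_abs, ENNReal.ofReal_rpow_of_nonneg (abs_nonneg _) hp]

theorem lqNorm_uniformConvex {p q : ℝ} (hp : 1 < p) (hp2 : p ≤ 2) (hq : 2 ≤ q) (u v : κ → ℝ) :
    lqNorm (.ofReal p) (fun k => ‖(u k + v k) / 2‖ₑ) ^ q +
        .ofReal (convexityConst p q) * lqNorm (.ofReal p) (fun k => ‖(u k - v k) / 2‖ₑ) ^ q ≤
      (lqNorm (.ofReal p) (fun k => ‖u k‖ₑ) ^ q + lqNorm (.ofReal p) (fun k => ‖v k‖ₑ) ^ q) / 2 := by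
  have hp0 : 0 < p := by linarith
  have hq0 : 0 < q := by linarith
  have T : ∀ w : κ → ℝ, Tendsto (fun s : Finset κ => ENNReal.ofReal ((∑ k ∈ s, |w k| ^ p) ^ (q / p)))
      atTop (𝓝 (lqNorm (.ofReal p) (fun k => ‖w k‖ₑ) ^ q)) := fun w => by
    refine (((ENNReal.continuous_rpow_const (y := q)).tendsto _).comp
      (tendsto_lqNorm_finset hp0 fun k => ‖w k‖ₑ)).congr fun s => ?_
    have h0 : 0 ≤ ∑ k ∈ s, |w k| ^ p :=
      Finset.sum_nonneg fun i _ => Real.rpow_nonneg (abs_nonneg _) _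
    rw [Function.comp_apply, enorm_rpow_sum s hp0.le, ← ENNReal.rpow_mul,
      ENNReal.ofReal_rpow_of_nonneg h0 (by positivity)]
    congr 2; field_simp
  refine le_of_tendsto_of_tendsto' ((T _).add (ENNReal.Tendsto.const_mul (T _)
    (Or.inr ENNReal.ofReal_ne_top)))
    (ENNReal.Tendsto.div_const ((T u).add (T v)) (Or.inr two_ne_zero)) fun s => ?_
  have nn : ∀ w : κ → ℝ, 0 ≤ (∑ k ∈ s, |w k| ^ p) ^ (q / p) := fun w =>
    Real.rpow_nonneg (Finset.sum_nonneg fun i _ => Real.rpow_nonneg (abs_nonneg _) _) _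
  rw [← ENNReal.ofReal_mul (convexityConst_pos hp).le,
    ← ENNReal.ofReal_add (nn _) (mul_nonneg (convexityConst_pos hp).le (nn _)),
    ← ENNReal.ofReal_add (nn _) (nn _)]
  have h2 : (2 : ℝ≥0∞) = .ofReal 2 := by simp
  rw [h2, ← ENNReal.ofReal_div_of_pos (by norm_num)]
  exact ENNReal.ofReal_le_ofReal (sum_rpow_uniformConvex s hp hp2 hq u v)

end lqNorm

/-! ### Blocks of the wavelet norm -/

section waveletBlock

variable {n : ℕ∞} {d : ℕ} {ι : ℕ → Type*} (φ : ∀ j, ι j → CkFun n d) (p : ℝ)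

/-- The weighted `ℓ^p` norm of the wavelet coefficients on the level `j`. -/
def waveletBlock (u : Distr n d) (j : ℕ) : ℝ≥0∞ :=
  (2 : ℝ≥0∞) ^ ((j : ℝ) * d * (1 / 2 - p⁻¹)) * lqNorm (.ofReal p) fun l : ι j => ‖u.1 (φ j l)‖ₑ

variable {φ p}

theorem waveletNorm_eq (hp : 0 ≤ p) (s : ℝ) (q : ℝ≥0∞) (u : Distr n d) :
    waveletNorm φ s (.ofReal p) q u =
      lqNorm q fun j : ℕ => (2 : ℝ≥0∞) ^ ((j : ℝ) * s) * waveletBlock φ p u j := by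
  unfold waveletNorm waveletBlock
  simp only [ENNReal.toReal_ofReal hp, mul_assoc]

theorem waveletNorm_zero_eq (hp : 0 ≤ p) (q : ℝ≥0∞) (u : Distr n d) :
    waveletNorm φ 0 (.ofReal p) q u = lqNorm q (waveletBlock φ p u) := by
  rw [waveletNorm_eq hp]; simp

theorem waveletBlock_add_le (hp : 1 ≤ p) (u v : Distr n d) (j : ℕ) :
    waveletBlock φ p (u + v) j ≤ waveletBlock φ p u j + waveletBlock φ p v j := by
  unfold waveletBlock
  rw [← mul_add]
  refine mul_le_mul_right ((lqNorm_mono fun l => ?_).trans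
    (lqNorm_add_le (by simpa using hp) _ _)) _
  exact enorm_add_le _ _

theorem waveletBlock_smul (hp : 1 ≤ p) (c : ℝ) (u : Distr n d) (j : ℕ) :
    waveletBlock φ p (c • u) j = ‖c‖ₑ * waveletBlock φ p u j := by
  unfold waveletBlock
  rw [mul_left_comm, ← lqNorm_const_mul (by simpa using hp) ‖c‖ₑ]
  have h : (fun l => ‖(c • u).1 (φ j l)‖ₑ) = fun l => ‖c‖ₑ * ‖u.1 (φ j l)‖ₑ :=
    funext fun l => enorm_mul c (u.1 (φ j l))
  rw [h]

theorem waveletNorm_add_le (hp : 1 ≤ p) {q : ℝ≥0∞} (hq : 1 ≤ q) (s : ℝ) (u v : Distr n d) :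
    waveletNorm φ s (.ofReal p) q (u + v) ≤
      waveletNorm φ s (.ofReal p) q u + waveletNorm φ s (.ofReal p) q v := by
  simp only [waveletNorm_eq (zero_le_one.trans hp)]
  refine (lqNorm_mono fun j => ?_).trans (lqNorm_add_le hq _ _)
  rw [← mul_add]
  exact mul_le_mul_right (waveletBlock_add_le hp u v j) _

theorem waveletNorm_smul (hp : 1 ≤ p) {q : ℝ≥0∞} (hq : 1 ≤ q) (s c : ℝ) (u : Distr n d) :
    waveletNorm φ s (.ofReal p) q (c • u) = ‖c‖ₑ * waveletNorm φ s (.ofReal p) q u := by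
  simp only [waveletNorm_eq (zero_le_one.trans hp)]
  rw [← lqNorm_const_mul hq]
  congr 1; ext j
  rw [waveletBlock_smul hp, mul_left_comm]

theorem waveletNorm_sub_comm (hp : 1 ≤ p) {q : ℝ≥0∞} (hq : 1 ≤ q) (s : ℝ) (u v : Distr n d) :
    waveletNorm φ s (.ofReal p) q (u - v) = waveletNorm φ s (.ofReal p) q (v - u) := by
  have : u - v = (-1 : ℝ) • (v - u) := by module
  rw [this, waveletNorm_smul hp hq]; simp

theorem waveletNorm_sub_le (hp : 1 ≤ p) {q : ℝ≥0∞} (hq : 1 ≤ q) (s : ℝ) (u v : Distr n d) :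
    waveletNorm φ s (.ofReal p) q (u - v) ≤
      waveletNorm φ s (.ofReal p) q u + waveletNorm φ s (.ofReal p) q v := by
  have : u - v = u + (-1 : ℝ) • v := by module
  rw [this]
  refine (waveletNorm_add_le hp hq s _ _).trans_eq ?_
  rw [waveletNorm_smul hp hq]; simp

theorem waveletBlock_uniformConvex {q : ℝ} (hp : 1 < p) (hp2 : p ≤ 2) (hq : 2 ≤ q)
    (u v : Distr n d) (j : ℕ) :
    waveletBlock φ p ((1 / 2 : ℝ) • (u + v)) j ^ q +
        .ofReal (convexityConst p q) * waveletBlock φ p ((1 / 2 : ℝ) • (u - v)) j ^ q ≤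
      (waveletBlock φ p u j ^ q + waveletBlock φ p v j ^ q) / 2 := by
  have hq0 : 0 ≤ q := by linarith
  unfold waveletBlock
  simp only [ENNReal.mul_rpow_of_nonneg _ _ hq0]
  rw [mul_left_comm, ← mul_add, ← mul_add, mul_div_assoc]
  refine mul_le_mul_right ((le_of_eq ?_).trans
    (lqNorm_uniformConvex hp hp2 hq (fun l => u.1 (φ j l)) (fun l => v.1 (φ j l)))) _
  congr 5
  · ext l; congr 1
    change (1 / 2 : ℝ) * (u.1 (φ j l) + v.1 (φ j l)) = _; ring
  · ext l; congr 1
    change (1 / 2 : ℝ) * (u.1 (φ j l) - v.1 (φ j l)) = _; ring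

theorem waveletNorm_uniformConvex {q : ℝ} (hp : 1 < p) (hp2 : p ≤ 2) (hq : 2 ≤ q)
    (u v : Distr n d) :
    waveletNorm φ 0 (.ofReal p) (.ofReal q) ((1 / 2 : ℝ) • (u + v)) ^ q +
        .ofReal (convexityConst p q) *
          waveletNorm φ 0 (.ofReal p) (.ofReal q) ((1 / 2 : ℝ) • (u - v)) ^ q ≤
      (waveletNorm φ 0 (.ofReal p) (.ofReal q) u ^ q +
        waveletNorm φ 0 (.ofReal p) (.ofReal q) v ^ q) / 2 := by
  have hp0 : 0 ≤ p := by linarith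
  have hq0 : 0 < q := by linarith
  simp only [waveletNorm_zero_eq hp0, lqNorm_ofReal_rpow hq0]
  rw [← ENNReal.tsum_mul_left, ← ENNReal.tsum_add, ← ENNReal.tsum_add]
  simp only [div_eq_mul_inv _ (2 : ℝ≥0∞)]
  rw [← ENNReal.tsum_mul_right]
  exact ENNReal.tsum_le_tsum fun j => waveletBlock_uniformConvex hp hp2 hq u v j

theorem rpow_le_add_mul_of_le_add {q U m h : ℝ} (hq : 1 ≤ q) (hm : 0 ≤ m) (hh : 0 ≤ h)
    (hU : 0 ≤ U) (hle : U ≤ m + h) : U ^ q ≤ m ^ q + q * U ^ (q - 1) * h := by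
  rcases le_total U m with h1 | h1
  · have := Real.rpow_le_rpow hU h1 (by linarith : (0:ℝ) ≤ q)
    have h2 : 0 ≤ q * U ^ (q - 1) * h :=
      mul_nonneg (mul_nonneg (by linarith) (Real.rpow_nonneg hU _)) hh
    linarith
  · rcases hU.eq_or_lt with h0 | h0
    · rw [← h0, Real.zero_rpow (by linarith)]
      exact add_nonneg (Real.rpow_nonneg hm _) (mul_nonneg (mul_nonneg (by linarith)
        (Real.rpow_nonneg le_rfl _)) hh)
    · have hb := one_add_mul_self_le_rpow_one_add (s := m / U - 1)
        (by linarith [div_nonneg hm hU]) hq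
      have e : (1 + (m / U - 1)) ^ q = m ^ q / U ^ q := by
        rw [← Real.div_rpow hm hU]; congr 1; ring
      rw [e, le_div_iff₀ (Real.rpow_pos_of_pos h0 q)] at hb
      have e2 : U ^ q = U ^ (q - 1) * U := by rw [← Real.rpow_add_one h0.ne']; congr 1; ring
      have e3 : (1 + q * (m / U - 1)) * U ^ q = U ^ q + q * U ^ (q - 1) * (m - U) := by
        rw [e2]; field_simp
      rw [e3] at hb
      have := mul_le_mul_of_nonneg_left (show U - m ≤ h by linarith)
        (mul_nonneg (by linarith : 0 ≤ q) (Real.rpow_nonneg hU (q - 1)))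
      nlinarith

/-- The lower bound for the Bregman distance of `‖·‖^q`. -/
theorem waveletBlock_bregman {q : ℝ} (hp : 1 < p) (hp2 : p ≤ 2) (hq : 2 ≤ q)
    (u v : Distr n d) (j : ℕ) (hu : waveletBlock φ p u j ≠ ∞) (hv : waveletBlock φ p v j ≠ ∞) :
    waveletBlock φ p u j ^ q + .ofReal (2 * convexityConst p q * (1 / 2) ^ q) *
        waveletBlock φ p (u - v) j ^ q ≤
      waveletBlock φ p v j ^ q +
        .ofReal q * (waveletBlock φ p u j ^ (q - 1) * waveletBlock φ p (u - v) j) := by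
  have hq0 : 0 < q := by linarith
  have huv : waveletBlock φ p (u - v) j ≠ ∞ := by
    have : u - v = u + (-1 : ℝ) • v := by module
    rw [this]
    refine ne_top_of_le_ne_top ?_ (waveletBlock_add_le hp.le _ _ _)
    rw [waveletBlock_smul hp.le]; simp [hu, hv]
  have hm : waveletBlock φ p ((1 / 2 : ℝ) • (u + v)) j ≠ ∞ := by
    rw [waveletBlock_smul hp.le]
    exact ENNReal.mul_ne_top (by simp) (ne_top_of_le_ne_top (by simp [hu, hv])
      (waveletBlock_add_le hp.le _ _ _))
  have hconv := waveletBlock_uniformConvex (φ := φ) hp hp2 hq u v j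
  have htri : waveletBlock φ p u j ≤ waveletBlock φ p ((1 / 2 : ℝ) • (u + v)) j +
      waveletBlock φ p ((1 / 2 : ℝ) • (u - v)) j := by
    refine le_trans (le_of_eq ?_) (waveletBlock_add_le hp.le _ _ _)
    congr 1; module
  rw [waveletBlock_smul hp.le _ (u - v), show ‖(1 / 2 : ℝ)‖ₑ = ENNReal.ofReal (1 / 2) by
    rw [← ofReal_norm]; norm_num] at hconv htri
  lift waveletBlock φ p u j to ℝ≥0 using hu with U
  lift waveletBlock φ p v j to ℝ≥0 using hv with V
  lift waveletBlock φ p (u - v) j to ℝ≥0 using huv with Δ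
  lift waveletBlock φ p ((1 / 2 : ℝ) • (u + v)) j to ℝ≥0 using hm with m
  have hc := (convexityConst_pos (q := q) hp).le
  have hpw : (0 : ℝ) ≤ (1 / 2) ^ q := by positivity
  have E : ∀ x : ℝ≥0, (x : ℝ≥0∞) = .ofReal x := fun x => (ENNReal.ofReal_coe_nnreal).symm
  simp only [E] at hconv htri ⊢
  have h2 : (2 : ℝ≥0∞) = .ofReal 2 := by simp
  rw [← ENNReal.ofReal_mul (by norm_num), ← ENNReal.ofReal_add (by positivity) (by positivity),
    ENNReal.ofReal_le_ofReal_iff (by positivity)] at htri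
  rw [← ENNReal.ofReal_mul (by norm_num), ENNReal.ofReal_rpow_of_nonneg (by positivity) hq0.le,
    ENNReal.ofReal_rpow_of_nonneg (by positivity) hq0.le,
    ENNReal.ofReal_rpow_of_nonneg (by positivity) hq0.le,
    ENNReal.ofReal_rpow_of_nonneg (by positivity) hq0.le,
    ← ENNReal.ofReal_mul hc, ← ENNReal.ofReal_add (by positivity) (by positivity),
    ← ENNReal.ofReal_add (by positivity) (by positivity), h2,
    ← ENNReal.ofReal_div_of_pos (by norm_num), ENNReal.ofReal_le_ofReal_iff (by positivity),
    Real.mul_rpow (by norm_num) (by positivity)] at hconv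
  rw [ENNReal.ofReal_rpow_of_nonneg (by positivity) hq0.le,
    ENNReal.ofReal_rpow_of_nonneg (by positivity) hq0.le,
    ENNReal.ofReal_rpow_of_nonneg (by positivity) hq0.le,
    ENNReal.ofReal_rpow_of_nonneg (by positivity) (by linarith),
    ← ENNReal.ofReal_mul (by positivity), ← ENNReal.ofReal_mul (by positivity),
    ← ENNReal.ofReal_mul (by positivity),
    ← ENNReal.ofReal_add (by positivity) (by positivity),
    ← ENNReal.ofReal_add (by positivity) (by positivity)]
  refine ENNReal.ofReal_le_ofReal ?_
  have hb := rpow_le_add_mul_of_le_add (by linarith : 1 ≤ q) m.2 (by positivity) U.2 htri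
  simp only [NNReal.val_eq_coe] at hb
  nlinarith

end waveletBlock

end TorusBesov

end

noncomputable section

namespace TorusBesov

/-! ### Interpolation of dyadic sums -/

theorem summable_two_rpow_neg_abs_int {η : ℝ} (hη : 0 < η) :
    Summable fun k : ℤ => (2 : ℝ) ^ (-(η * |(k : ℝ)|)) := by
  have h0 : Summable fun k : ℕ => (2 : ℝ) ^ (-(η * (k : ℝ))) := by
    have : (fun k : ℕ => (2 : ℝ) ^ (-(η * (k : ℝ)))) = fun k : ℕ => ((2 : ℝ) ^ (-η)) ^ k := by
      ext k; rw [← Real.rpow_natCast, ← Real.rpow_mul (by norm_num)]; congr 1; ring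
    rw [this]
    exact summable_geometric_of_lt_one (by positivity)
      (Real.rpow_lt_one_of_one_lt_of_neg (by norm_num) (by linarith))
  refine Summable.of_nat_of_neg ?_ ?_
  · simpa using h0
  · simpa using h0

theorem tsum_two_rpow_abs_sub_le {η : ℝ} (τ : ℝ) (hη : 0 < η) :
    ∑' j : ℕ, ENNReal.ofReal ((2 : ℝ) ^ (-(η * |(j : ℝ) - τ|))) ≤
      ENNReal.ofReal (2 ^ η * ∑' k : ℤ, (2 : ℝ) ^ (-(η * |(k : ℝ)|))) := by
  have hS := (summable_two_rpow_neg_abs_int hη).mul_left ((2 : ℝ) ^ η)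
  rw [← tsum_mul_left, ENNReal.ofReal_tsum_of_nonneg (fun k => by positivity) hS]
  have hinj : Function.Injective fun j : ℕ => (j : ℤ) - ⌊τ⌋ := fun i j h => by
    simpa using h
  refine le_trans (ENNReal.tsum_le_tsum fun j => ?_) (ENNReal.tsum_comp_le_tsum_of_injective hinj
    fun k : ℤ => ENNReal.ofReal ((2 : ℝ) ^ η * (2 : ℝ) ^ (-(η * |(k : ℝ)|))))
  refine ENNReal.ofReal_le_ofReal ?_
  rw [← Real.rpow_add (by norm_num)]
  refine Real.rpow_le_rpow_of_exponent_le (by norm_num) ?_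
  push_cast
  have h1 : |(j : ℝ) - ⌊τ⌋| ≤ |(j : ℝ) - τ| + 1 := by
    have h2 : |τ - ⌊τ⌋| ≤ 1 := by
      rw [abs_le]; constructor <;> linarith [Int.floor_le τ, Int.lt_floor_add_one τ]
    calc |(j : ℝ) - ⌊τ⌋| = |((j : ℝ) - τ) + (τ - ⌊τ⌋)| := by ring_nf
      _ ≤ _ := (abs_add_le _ _).trans (by linarith)
  nlinarith

theorem exists_tsum_interpolation {a b : ℝ} (hb : 0 < b) (hba : b < a) :
    ∃ C : ℝ, 0 < C ∧ ∀ (G : ℕ → ℝ≥0∞) (A B : ℝ), 0 ≤ A → 0 ≤ B →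
      (∀ j, G j ≤ .ofReal A) → (∀ j : ℕ, (2 : ℝ≥0∞) ^ ((j : ℝ) * a) * G j ≤ .ofReal B) →
      ∑' j : ℕ, (2 : ℝ≥0∞) ^ ((j : ℝ) * b) * G j ≤
        .ofReal (C * (A ^ (1 - b / a) * B ^ (b / a))) := by
  have ha : 0 < a := hb.trans hba
  set η := min b (a - b) with hη
  have hη0 : 0 < η := lt_min hb (by linarith)
  have hS := summable_two_rpow_neg_abs_int hη0
  refine ⟨2 ^ η * ∑' k : ℤ, (2 : ℝ) ^ (-(η * |(k : ℝ)|)), mul_pos (by positivity)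
    (hS.tsum_pos (fun k => by positivity) 0 (by positivity)), fun G A B hA hB h1 h2 => ?_⟩
  have hpow : ∀ x : ℝ, (2 : ℝ≥0∞) ^ x ≠ 0 := fun x => by
    simp [ENNReal.rpow_eq_zero_iff]
  have hofr : ∀ x : ℝ, (2 : ℝ≥0∞) ^ x = .ofReal (2 ^ x) := fun x => by
    rw [← ENNReal.ofReal_rpow_of_pos (by norm_num)]; simp
  have triv : (∀ j, G j = 0) → ∑' j : ℕ, (2 : ℝ≥0∞) ^ ((j : ℝ) * b) * G j ≤
      .ofReal ((2 ^ η * ∑' k : ℤ, (2 : ℝ) ^ (-(η * |(k : ℝ)|))) *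
        (A ^ (1 - b / a) * B ^ (b / a))) := fun h => by simp [h]
  rcases hA.eq_or_lt with hA0 | hA0
  · exact triv fun j => by simpa [← hA0] using h1 j
  rcases hB.eq_or_lt with hB0 | hB0
  · refine triv fun j => ?_
    have := h2 j
    rw [← hB0, ENNReal.ofReal_zero, nonpos_iff_eq_zero, mul_eq_zero] at this
    exact this.resolve_left (hpow _)
  set τ := Real.logb 2 (B / A) / a with hτ
  have hBA : B / A = 2 ^ (τ * a) := by
    rw [hτ, div_mul_cancel₀ _ ha.ne', Real.rpow_logb (by norm_num) (by norm_num) (by positivity)]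
  have hBeq : B = A * 2 ^ (τ * a) := by rw [← hBA]; field_simp
  have hAB : A ^ (1 - b / a) * B ^ (b / a) = A * 2 ^ (τ * b) := by
    rw [hBeq, Real.mul_rpow hA (by positivity), ← mul_assoc, ← Real.rpow_add hA0,
      ← Real.rpow_mul (by norm_num)]
    congr 2
    · simp
    · field_simp
  rw [hAB, mul_comm, ENNReal.ofReal_mul (by positivity)]
  refine le_trans ?_ (mul_le_mul_right (tsum_two_rpow_abs_sub_le τ hη0) _)
  rw [← ENNReal.tsum_mul_left]
  refine ENNReal.tsum_le_tsum fun j => ?_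
  rw [← ENNReal.ofReal_mul (by positivity), mul_assoc, ← Real.rpow_add (by norm_num)]
  rcases le_total (j : ℝ) τ with hj | hj
  · refine (mul_le_mul_right (h1 j) _).trans ?_
    rw [hofr, ← ENNReal.ofReal_mul (by positivity), mul_comm]
    refine ENNReal.ofReal_le_ofReal (mul_le_mul_of_nonneg_left
      (Real.rpow_le_rpow_of_exponent_le (by norm_num) ?_) hA)
    rw [abs_of_nonpos (by linarith)]
    nlinarith [min_le_left b (a - b)]
  · have e : (2 : ℝ≥0∞) ^ ((j : ℝ) * b) * G j =
        (2 : ℝ≥0∞) ^ ((j : ℝ) * (b - a)) * ((2 : ℝ≥0∞) ^ ((j : ℝ) * a) * G j) := by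
      rw [← mul_assoc, ← ENNReal.rpow_add _ _ two_ne_zero (by simp)]; congr 2; ring
    rw [e]
    refine (mul_le_mul_right (h2 j) _).trans ?_
    rw [hofr, ← ENNReal.ofReal_mul (by positivity), hBeq, mul_left_comm,
      ← Real.rpow_add (by norm_num)]
    refine ENNReal.ofReal_le_ofReal (mul_le_mul_of_nonneg_left
      (Real.rpow_le_rpow_of_exponent_le (by norm_num) ?_) hA)
    rw [abs_of_nonneg (by linarith)]
    nlinarith [min_le_right b (a - b)]

/-! ### The scalar inequality behind the convergence rate -/

theorem rpow_eliminate {X Y S P Q m u v w : ℝ} (hX : 0 < X) (hY : 0 < Y) (hS : 0 ≤ S) (hP : 0 ≤ P)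
    (hQ : 0 ≤ Q) (hu : 0 ≤ u) (hw : 0 ≤ w) (h1 : S * X ^ m ≤ P * Y ^ u)
    (h2 : Y ^ w ≤ Q * X ^ v) : S ^ w * X ^ (m * w - u * v) ≤ P ^ w * Q ^ u := by
  have h3 := Real.rpow_le_rpow (by positivity) h1 hw
  have h4 := Real.rpow_le_rpow (by positivity) h2 hu
  rw [Real.mul_rpow hS (by positivity), Real.mul_rpow hP (by positivity), ← Real.rpow_mul hX.le,
    ← Real.rpow_mul hY.le] at h3
  rw [Real.mul_rpow hQ (by positivity), ← Real.rpow_mul hX.le, ← Real.rpow_mul hY.le] at h4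
  rw [Real.rpow_sub hX, mul_div_assoc', div_le_iff₀ (by positivity)]
  calc S ^ w * X ^ (m * w) ≤ P ^ w * Y ^ (u * w) := h3
    _ ≤ P ^ w * (Q ^ u * X ^ (v * u)) := by
        refine mul_le_mul_of_nonneg_left ?_ (by positivity)
        rw [mul_comm u w]; exact h4
    _ = P ^ w * Q ^ u * X ^ (u * v) := by rw [mul_comm v u]; ring

theorem exists_rate_dichotomy {q θ δ c C₁ C₂ A : ℝ} (hq : 2 ≤ q) (hθ : 0 < θ) (hθ1 : θ < 1)
    (hδ : 0 < δ) (hδ1 : δ < 1) (hc : 0 < c) (hC₁ : 0 < C₁) (hC₂ : 0 < C₂) (hA : 0 < A) :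
    ∃ K : ℝ, 0 < K ∧ ∃ c₀ : ℝ, 0 < c₀ ∧ ∀ X Y ζ : ℝ, 0 ≤ X → 0 ≤ Y → 0 ≤ ζ →
      1 / 2 * Y ^ 2 + K * c * X ^ q ≤
        K * C₁ * (Y ^ θ * X ^ (1 - θ)) + C₂ * ζ * (Y ^ (1 - δ) * X ^ δ) →
      X ≤ c₀ ∨ (A * X) ^ (q / 2 + (q - 2) * δ / 2) ≤ ζ := by
  set κ := q / 2 + (q - 2) * δ / 2 with hκ
  have hκ0 : 0 < κ := by rw [hκ]; nlinarith
  set T := A ^ (2 * κ) * ((2 * C₂) ^ (1 + δ) * (4 * C₂) ^ (1 - δ)) with hT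
  have hT0 : 0 < T := by positivity
  set K := T ^ ((1 + δ)⁻¹) / c with hK
  have hK0 : 0 < K := by positivity
  have hKc : (K * c) ^ (1 + δ) = T := by
    rw [hK, div_mul_cancel₀ _ hc.ne', ← Real.rpow_mul hT0.le, inv_mul_cancel₀ (by linarith),
      Real.rpow_one]
  set e := (q - (1 - θ)) * (2 - θ) - θ * (1 - θ) with he
  have he0 : 0 < e := by rw [he]; nlinarith
  set R := (2 * (K * C₁)) ^ (2 - θ) * (4 * (K * C₁)) ^ θ / (K * c) ^ (2 - θ) with hR
  have hR0 : 0 < R := by positivity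
  refine ⟨K, hK0, R ^ e⁻¹, by positivity, fun X Y ζ hX hY hζ h => ?_⟩
  rcases hX.eq_or_lt with hX0 | hX0
  · left; rw [← hX0]; positivity
  have hKcX : 0 < K * c * X ^ q := by positivity
  rcases hY.eq_or_lt with hY0 | hY0
  · exfalso
    rw [← hY0, Real.zero_rpow hθ.ne', Real.zero_rpow (by linarith)] at h
    simp only [zero_mul, mul_zero, add_zero] at h
    linarith
  have hYsplit : ∀ t : ℝ, Y ^ 2 = Y ^ (2 - t) * Y ^ t := fun t => by
    rw [← Real.rpow_add hY0, ← Real.rpow_two]; congr 1; ring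
  have hXsplit : ∀ t : ℝ, X ^ q = X ^ (q - t) * X ^ t := fun t => by
    rw [← Real.rpow_add hX0]; congr 1; ring
  rcases le_total (C₂ * ζ * (Y ^ (1 - δ) * X ^ δ)) (K * C₁ * (Y ^ θ * X ^ (1 - θ))) with hle | hle
  · left
    have h1 : 1 / 2 * Y ^ 2 ≤ 2 * (K * C₁) * (Y ^ θ * X ^ (1 - θ)) := by nlinarith
    have h2 : K * c * X ^ q ≤ 2 * (K * C₁) * (Y ^ θ * X ^ (1 - θ)) := by nlinarith [sq_nonneg Y]
    have h1' : Y ^ (2 - θ) ≤ 4 * (K * C₁) * X ^ (1 - θ) := by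
      rw [hYsplit θ] at h1
      have hp : 0 < Y ^ θ := by positivity
      refine le_of_mul_le_mul_right ?_ hp
      linarith
    have h2' : K * c * X ^ (q - (1 - θ)) ≤ 2 * (K * C₁) * Y ^ θ := by
      rw [hXsplit (1 - θ)] at h2
      have hp : 0 < X ^ (1 - θ) := by positivity
      refine le_of_mul_le_mul_right ?_ hp
      linarith
    have h3 := rpow_eliminate hX0 hY0 (by positivity) (by positivity) (by positivity) hθ.le
      (by linarith) h2' h1'
    rw [← he, mul_comm, ← le_div_iff₀ (by positivity), ← hR] at h3
    have h4 := Real.rpow_le_rpow (by positivity) h3 (inv_nonneg.2 he0.le)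
    rwa [← Real.rpow_mul hX, mul_inv_cancel₀ he0.ne', Real.rpow_one] at h4
  · right
    have h1 : 1 / 2 * Y ^ 2 ≤ 2 * (C₂ * ζ) * (Y ^ (1 - δ) * X ^ δ) := by nlinarith
    have h2 : K * c * X ^ q ≤ 2 * (C₂ * ζ) * (Y ^ (1 - δ) * X ^ δ) := by nlinarith [sq_nonneg Y]
    have h1' : Y ^ (1 + δ) ≤ 4 * (C₂ * ζ) * X ^ δ := by
      rw [hYsplit (1 - δ), show 2 - (1 - δ) = 1 + δ by ring] at h1
      have hp : 0 < Y ^ (1 - δ) := by positivity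
      refine le_of_mul_le_mul_right ?_ hp
      linarith
    have h2' : K * c * X ^ (q - δ) ≤ 2 * (C₂ * ζ) * Y ^ (1 - δ) := by
      rw [hXsplit δ] at h2
      have hp : 0 < X ^ δ := by positivity
      refine le_of_mul_le_mul_right ?_ hp
      linarith
    have h3 := rpow_eliminate hX0 hY0 (by positivity) (by positivity) (by positivity)
      (by linarith : 0 ≤ 1 - δ) (by linarith) h2' h1'
    rw [hKc, ← mul_assoc, ← mul_assoc, Real.mul_rpow (by positivity) hζ,
      Real.mul_rpow (by positivity) hζ, show (q - δ) * (1 + δ) - (1 - δ) * δ = 2 * κ by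
        rw [hκ]; ring] at h3
    have hζ2 : ζ ^ (1 + δ) * ζ ^ (1 - δ) = ζ ^ 2 := by
      rw [← Real.rpow_add_of_nonneg hζ (by linarith) (by linarith), ← Real.rpow_two]
      congr 1; ring
    have h4 : A ^ (2 * κ) * X ^ (2 * κ) ≤ ζ ^ 2 := by
      have hp : 0 < (2 * C₂) ^ (1 + δ) * (4 * C₂) ^ (1 - δ) := by positivity
      refine le_of_mul_le_mul_left ?_ hp
      rw [← hζ2]
      calc _ = T * X ^ (2 * κ) := by rw [hT]; ring
        _ ≤ _ := h3
        _ = _ := by ring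
    rw [← Real.mul_rpow hA.le hX, mul_comm 2 κ, Real.rpow_mul (by positivity),
      Real.rpow_two] at h4
    exact (pow_le_pow_iff_left₀ (by positivity) hζ two_ne_zero).1 h4

theorem rpow_mono_mul {ρ ε : ℝ} (hρ : 0 < ρ) (hε : 0 < ε) (e f e' f' : ℝ) :
    ρ ^ e * ε ^ f * (ρ ^ e' * ε ^ f') = ρ ^ (e + e') * ε ^ (f + f') := by
  rw [Real.rpow_add hρ, Real.rpow_add hε]; ring

theorem rpow_mono_rpow {ρ ε : ℝ} (hρ : 0 < ρ) (hε : 0 < ε) (e f t : ℝ) :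
    (ρ ^ e * ε ^ f) ^ t = ρ ^ (e * t) * ε ^ (f * t) := by
  rw [Real.mul_rpow (by positivity) (by positivity), ← Real.rpow_mul hρ.le, ← Real.rpow_mul hε.le]

theorem convRate_pos {d : ℕ} {a s ρ ε : ℝ} (hρ : 0 < ρ) (hε : 0 < ε) : 0 < convRate d a s ρ ε := by
  unfold convRate; positivity

theorem paramChoice_pos {d : ℕ} {q a s K ρ ε : ℝ} (hK : 0 < K) (hρ : 0 < ρ) (hε : 0 < ε) :
    0 < paramChoice d q a s K ρ ε := by
  unfold paramChoice; positivity

theorem rate_normalize {d : ℕ} {q a s K ρ ε c C₁ C₂ x y ζ θ δ : ℝ} (ha : 0 < a) (hs : 0 < s)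
    (hρ : 0 < ρ) (hε : 0 < ε) (hx : 0 ≤ x) (hy : 0 ≤ y) (hθ : θ = s * (q - 1) / a)
    (hδ : δ = d / (2 * a))
    (h : 1 / 2 * y ^ 2 + paramChoice d q a s K ρ ε * c * x ^ q ≤
      paramChoice d q a s K ρ ε * (C₁ * ρ ^ (q - 1) * (y ^ θ * x ^ (1 - θ))) +
        ε * (C₂ * ζ * (y ^ (1 - δ) * x ^ δ))) :
    ∃ Y : ℝ, 0 ≤ Y ∧ 1 / 2 * Y ^ 2 + K * c * (x / convRate d a s ρ ε) ^ q ≤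
        K * C₁ * (Y ^ θ * (x / convRate d a s ρ ε) ^ (1 - θ)) +
        C₂ * ζ * (Y ^ (1 - δ) * (x / convRate d a s ρ ε) ^ δ) := by
  have hN : a + s + (d : ℝ) / 2 ≠ 0 := by positivity
  set N := a + s + (d : ℝ) / 2 with hNdef
  set x₀ := convRate d a s ρ ε with hx₀
  have hx0 : 0 < x₀ := convRate_pos hρ hε
  set y₀ := ρ ^ ((d / 2) / N) * ε ^ ((a + s) / N) with hy₀
  have hy0 : 0 < y₀ := by positivity
  have hx₀' : x₀ = ρ ^ ((a + d / 2) / N) * ε ^ (s / N) := rfl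
  set α := paramChoice d q a s K ρ ε with hα
  have hα' : α = K * (ρ ^ (-((q * a + (q - 2) * (d / 2)) / N)) *
      ε ^ ((2 * (a + s) - q * s) / N)) := by rw [← mul_assoc]; rfl
  have hy2 : y₀ ^ 2 = ρ ^ ((d / 2) / N * 2) * ε ^ ((a + s) / N * 2) := by
    rw [← Real.rpow_two, hy₀, rpow_mono_rpow hρ hε]
  have i1 : α * x₀ ^ q = K * y₀ ^ 2 := by
    rw [hα', hx₀', hy2, rpow_mono_rpow hρ hε, mul_assoc, rpow_mono_mul hρ hε]
    congr 3
    · field_simp; ring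
    · field_simp; ring
  have i2 : α * ρ ^ (q - 1) * (y₀ ^ θ * x₀ ^ (1 - θ)) = K * y₀ ^ 2 := by
    have e : ρ ^ (q - 1) = ρ ^ (q - 1) * ε ^ (0 : ℝ) := by simp
    rw [hα', hx₀', hy₀, ← hy₀, hy2, hy₀, e, rpow_mono_rpow hρ hε, rpow_mono_rpow hρ hε, mul_assoc,
      mul_assoc, rpow_mono_mul hρ hε, rpow_mono_mul hρ hε, rpow_mono_mul hρ hε]
    congr 3
    · rw [hθ]; field_simp; rw [hNdef]; ring
    · rw [hθ]; field_simp; ring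
  have i3 : ε * (y₀ ^ (1 - δ) * x₀ ^ δ) = y₀ ^ 2 := by
    have e : ε = ρ ^ (0 : ℝ) * ε ^ (1 : ℝ) := by simp
    rw [hx₀', hy2, hy₀, rpow_mono_rpow hρ hε, rpow_mono_rpow hρ hε, rpow_mono_mul hρ hε]
    nth_rw 1 [e]
    rw [rpow_mono_mul hρ hε]
    congr 2
    · rw [hδ]; field_simp; ring
    · rw [hδ]; field_simp; rw [hNdef]; ring
  refine ⟨y / y₀, by positivity, ?_⟩
  have hsc : ∀ t : ℝ, x ^ t = (x / x₀) ^ t * x₀ ^ t := fun t => by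
    rw [← Real.mul_rpow (by positivity) hx0.le, div_mul_cancel₀ _ hx0.ne']
  have hsy : ∀ t : ℝ, y ^ t = (y / y₀) ^ t * y₀ ^ t := fun t => by
    rw [← Real.mul_rpow (by positivity) hy0.le, div_mul_cancel₀ _ hy0.ne']
  have hsy2 : y ^ 2 = (y / y₀) ^ 2 * y₀ ^ 2 := by rw [← mul_pow, div_mul_cancel₀ _ hy0.ne']
  rw [hsc q, hsc (1 - θ), hsc δ, hsy θ, hsy (1 - δ), hsy2] at h
  have hyp : 0 < y₀ ^ 2 := by positivity
  refine le_of_mul_le_mul_right ?_ hyp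
  have L1 : 1 / 2 * ((y / y₀) ^ 2 * y₀ ^ 2) + α * c * ((x / x₀) ^ q * x₀ ^ q) =
      (1 / 2 * (y / y₀) ^ 2 + K * c * (x / x₀) ^ q) * y₀ ^ 2 := by
    linear_combination c * (x / x₀) ^ q * i1
  have L2 : α * (C₁ * ρ ^ (q - 1) * ((y / y₀) ^ θ * y₀ ^ θ * ((x / x₀) ^ (1 - θ) * x₀ ^ (1 - θ)))) +
      ε * (C₂ * ζ * ((y / y₀) ^ (1 - δ) * y₀ ^ (1 - δ) * ((x / x₀) ^ δ * x₀ ^ δ))) =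
      (K * C₁ * ((y / y₀) ^ θ * (x / x₀) ^ (1 - θ)) +
        C₂ * ζ * ((y / y₀) ^ (1 - δ) * (x / x₀) ^ δ)) * y₀ ^ 2 := by
    linear_combination C₁ * (y / y₀) ^ θ * (x / x₀) ^ (1 - θ) * i2 +
      C₂ * ζ * (y / y₀) ^ (1 - δ) * (x / x₀) ^ δ * i3
  rw [L1, L2] at h
  exact h

end TorusBesov

end

noncomputable section

namespace TorusBesov

/-! ### Moments from deviation inequalities -/

theorem summable_rpow_mul_exp_neg_rpow (C μ m : ℝ) (hC : 0 < C) (hμ : 0 < μ) :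
    Summable fun n : ℕ => ((n : ℝ) + 1) ^ m * Real.exp (-C * ((n : ℝ) + 1) ^ μ) := by
  have h1 : (fun x : ℝ => Real.exp (-C * x)) =o[atTop] fun x : ℝ => x ^ (-((m + 2) / μ)) :=
    isLittleO_exp_neg_mul_rpow_atTop hC _
  have ht : Tendsto (fun n : ℕ => ((n : ℝ) + 1) ^ μ) atTop atTop :=
    (tendsto_rpow_atTop hμ).comp (tendsto_atTop_add_const_right _ _ tendsto_natCast_atTop_atTop)
  have h2 := (h1.comp_tendsto ht).isBigO
  have h3 : (fun n : ℕ => ((n : ℝ) + 1) ^ m * Real.exp (-C * ((n : ℝ) + 1) ^ μ)) =O[atTop]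
      fun n : ℕ => ((n : ℝ) + 1) ^ m * (((n : ℝ) + 1) ^ μ) ^ (-((m + 2) / μ)) :=
    (Asymptotics.isBigO_refl _ _).mul h2
  have h4 : (fun n : ℕ => ((n : ℝ) + 1) ^ m * (((n : ℝ) + 1) ^ μ) ^ (-((m + 2) / μ))) =
      fun n : ℕ => 1 / (((n + 1 : ℕ) : ℝ)) ^ 2 := by
    ext n
    have hn : (0 : ℝ) < (n : ℝ) + 1 := by positivity
    rw [← Real.rpow_mul hn.le, ← Real.rpow_add hn, one_div, ← Real.rpow_natCast, ← Real.rpow_neg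
      (by positivity)]
    push_cast; congr 1; field_simp; ring
  rw [h4] at h3
  exact summable_of_isBigO_nat
    ((summable_nat_add_iff 1).2 (Real.summable_one_div_nat_pow.2 (by norm_num : 1 < 2))) h3

theorem exists_moment_bound {C M μ m : ℝ} (hC : 0 < C) (hM : 0 < M) (hμ : 0 < μ) (hm : 0 < m) :
    ∃ R : ℝ, 0 < R ∧ ∀ (Ω : Type*) [MeasurableSpace Ω] (P : Measure Ω) [IsProbabilityMeasure P]
      (ζ : Ω → ℝ≥0∞), (∀ᵐ ω ∂P, ζ ω < ∞) →
      (∀ t : ℝ, 0 < t → P {ω | ENNReal.ofReal (M + t) < ζ ω} ≤ .ofReal (Real.exp (-C * t ^ μ))) →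
      ∫⁻ ω, ζ ω ^ m ∂P ≤ .ofReal R := by
  have hs := (summable_rpow_mul_exp_neg_rpow C μ m hC hμ).mul_left ((M + 2) ^ m)
  set S := ∑' n : ℕ, (M + 2) ^ m * (((n : ℝ) + 1) ^ m * Real.exp (-C * ((n : ℝ) + 1) ^ μ)) with hS
  have hS0 : 0 ≤ S := tsum_nonneg fun n => by positivity
  refine ⟨(M + 1) ^ m + S, by positivity, fun Ω _ P _ ζ hfin hdev => ?_⟩
  set E : ℕ → Set Ω := fun n => toMeasurable P {ω | ENNReal.ofReal (M + (n + 1)) < ζ ω} with hE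
  have hEm : ∀ n, MeasurableSet (E n) := fun n => measurableSet_toMeasurable _ _
  have hpt : ∀ᵐ ω ∂P, ζ ω ^ m ≤ .ofReal ((M + 1) ^ m) + ∑' n : ℕ,
      (E n).indicator (fun _ => ENNReal.ofReal ((M + 2) ^ m * ((n : ℝ) + 1) ^ m)) ω := by
    filter_upwards [hfin] with ω hω
    have hex : ∃ N : ℕ, ζ ω ≤ .ofReal (M + (N + 1)) := by
      obtain ⟨N, hN⟩ := exists_nat_ge (ζ ω).toReal
      exact ⟨N, ENNReal.le_ofReal_iff_toReal_le hω.ne (by positivity) |>.2 (by linarith)⟩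
    classical
    obtain ⟨N, hN, hmin⟩ : ∃ N : ℕ, ζ ω ≤ .ofReal (M + (N + 1)) ∧
        ∀ k < N, ¬ ζ ω ≤ .ofReal (M + (k + 1)) :=
      ⟨Nat.find hex, Nat.find_spec hex, fun k hk => Nat.find_min hex hk⟩
    rcases N with _ | k
    · refine le_trans ?_ le_self_add
      rw [← ENNReal.ofReal_rpow_of_nonneg (by positivity) hm.le]
      refine ENNReal.rpow_le_rpow ?_ hm.le
      simpa using hN
    · have hk : ω ∈ E k := subset_toMeasurable _ _ (not_le.1 (hmin k (Nat.lt_succ_self k)))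
      refine le_trans ?_ (le_add_left (ENNReal.le_tsum k))
      rw [indicator_of_mem hk, ← Real.mul_rpow (by positivity) (by positivity),
        ← ENNReal.ofReal_rpow_of_nonneg (by positivity) hm.le]
      refine ENNReal.rpow_le_rpow (hN.trans (ENNReal.ofReal_le_ofReal ?_)) hm.le
      push_cast
      nlinarith [(Nat.cast_nonneg k : (0 : ℝ) ≤ k)]
  refine (lintegral_mono_ae hpt).trans ?_
  rw [lintegral_add_left measurable_const, lintegral_const, measure_univ, mul_one,
    lintegral_tsum fun n => (measurable_const.indicator (hEm n)).aemeasurable,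
    ENNReal.ofReal_add (by positivity) hS0]
  refine add_le_add le_rfl ?_
  rw [hS, ENNReal.ofReal_tsum_of_nonneg (fun n => by positivity) hs]
  refine ENNReal.tsum_le_tsum fun n => ?_
  rw [lintegral_indicator_const (hEm n), measure_toMeasurable, ← mul_assoc,
    ENNReal.ofReal_mul (p := (M + 2) ^ m * ((n : ℝ) + 1) ^ m) (by positivity)]
  exact mul_le_mul_right (hdev (n + 1) (by positivity)) _

/-! ### Convex combinations of tails -/

theorem exists_cauchy_in_convexHull_tails {E : Type*} [AddCommGroup E] [Module ℝ E] {D : Set E}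
    (hD : Convex ℝ D) {V G : E → ℝ} {c B : ℝ} (hc : 0 < c) (hV : ∀ x ∈ D, 0 ≤ V x)
    (huc : ∀ x ∈ D, ∀ y ∈ D, V ((1 / 2 : ℝ) • (x + y)) + c * G (x - y) ≤ (V x + V y) / 2)
    (f : ℕ → E) (hf : ∀ n, f n ∈ D) (hB : ∀ n, V (f n) ≤ B) :
    ∃ g : ℕ → E, (∀ n, g n ∈ convexHull ℝ (f '' Ici n)) ∧ (∀ n, V (g n) ≤ V (f n) + 1 / (n + 1)) ∧
      ∀ η > 0, ∃ N, ∀ n ≥ N, ∀ k ≥ N, G (g n - g k) ≤ η := by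
  set H : ℕ → Set E := fun n => convexHull ℝ (f '' Ici n) with hH
  have hHD : ∀ n, H n ⊆ D := fun n => convexHull_min (by rintro _ ⟨k, _, rfl⟩; exact hf k) hD
  have hanti : ∀ {n k}, n ≤ k → H k ⊆ H n := fun h => convexHull_mono (image_mono (Ici_subset_Ici.2 h))
  have hfH : ∀ n, f n ∈ H n := fun n => subset_convexHull ℝ _ ⟨n, self_mem_Ici, rfl⟩
  set m : ℕ → ℝ := fun n => sInf (V '' H n) with hm
  have hbdd : ∀ n, BddBelow (V '' H n) := fun n =>
    ⟨0, by rintro _ ⟨x, hx, rfl⟩; exact hV x (hHD n hx)⟩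
  have hne : ∀ n, (V '' H n).Nonempty := fun n => ⟨_, f n, hfH n, rfl⟩
  have hmono : Monotone m := fun n k h => csInf_le_csInf (hbdd n) (hne k) (image_mono (hanti h))
  have hmB : ∀ n, m n ≤ B := fun n => (csInf_le (hbdd n) ⟨_, hfH n, rfl⟩).trans (hB n)
  have hex : ∀ n, ∃ x ∈ H n, V x < m n + 1 / ((n : ℝ) + 1) := fun n => by
    obtain ⟨_, ⟨x, hx, rfl⟩, h⟩ := exists_lt_of_csInf_lt (hne n)
      (show m n < m n + 1 / ((n : ℝ) + 1) by linarith [show 0 < 1 / ((n : ℝ) + 1) by positivity])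
    exact ⟨x, hx, h⟩
  choose g hg hgV using hex
  refine ⟨g, hg, fun n => (hgV n).le.trans (by
    linarith [csInf_le (hbdd n) ⟨_, hfH n, rfl⟩]), fun η hη => ?_⟩
  have hbA : BddAbove (range m) := ⟨B, by rintro _ ⟨n, rfl⟩; exact hmB n⟩
  have hlim := tendsto_atTop_ciSup hmono hbA
  obtain ⟨N₁, hN₁⟩ := (hlim.eventually (lt_mem_nhds
    (show (⨆ n, m n) - c * η / 2 < ⨆ n, m n by nlinarith))).exists_forall_of_atTop
  obtain ⟨N₂, hN₂⟩ := exists_nat_one_div_lt (show 0 < c * η / 2 by positivity)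
  refine ⟨max N₁ N₂, fun n hn k hk => ?_⟩
  set N := max N₁ N₂
  have hgn := hanti hn (hg n)
  have hgk := hanti hk (hg k)
  have hmid : (1 / 2 : ℝ) • (g n + g k) ∈ H N := by
    rw [smul_add]
    exact convex_convexHull ℝ _ hgn hgk (by norm_num) (by norm_num) (by norm_num)
  have h1 := csInf_le (hbdd N) ⟨_, hmid, rfl⟩
  have h2 := huc _ (hHD N hgn) _ (hHD N hgk)
  have h3 := le_ciSup hbA n
  have h4 := le_ciSup hbA k
  have h5 := hN₁ N (le_max_left _ _)
  have h6 : ∀ i ≥ N, 1 / ((i : ℝ) + 1) < c * η / 2 := fun i hi => lt_of_le_of_lt (by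
    have : (N₂ : ℝ) ≤ i := by exact_mod_cast (le_max_right _ _).trans hi
    gcongr) hN₂
  have h7 := h6 n hn
  have h8 := h6 k hk
  have h9 := hgV n
  have h10 := hgV k
  change m N ≤ _ at h1
  refine le_of_mul_le_mul_left ?_ hc
  linarith

end TorusBesov

end

noncomputable section

namespace TorusBesov

open scoped ComplexConjugate
open UnitAddTorus (mFourier mFourierCoeff)

/-! ### Fourier coefficients and blocks -/

section Fourier

variable {n m : ℕ∞} {d : ℕ}

theorem coeff_add (u v : Distr n d) (z : Fin d → ℤ) : coeff (u + v) z = coeff u z + coeff v z := by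
  have h : ∀ φ, (u + v).1 φ = u.1 φ + v.1 φ := fun φ => rfl
  simp only [coeff, h]; push_cast; ring

theorem coeff_smul (c : ℝ) (u : Distr n d) (z : Fin d → ℤ) : coeff (c • u) z = c * coeff u z := by
  have h : ∀ φ, (c • u).1 φ = c * u.1 φ := fun φ => rfl
  simp only [coeff, h]; push_cast; ring

theorem coeff_sub (u v : Distr n d) (z : Fin d → ℤ) : coeff (u - v) z = coeff u z - coeff v z := by
  have h : ∀ φ, (u - v).1 φ = u.1 φ - v.1 φ := fun φ => rfl
  simp only [coeff, h]; push_cast; ring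

theorem lpBlock_add (u v : Distr n d) (j : ℕ) : lpBlock (u + v) j = lpBlock u j + lpBlock v j := by
  ext x
  simp only [lpBlock, coeff_add, Pi.add_apply, ← Finset.sum_add_distrib, add_mul]

theorem continuous_lpBlock (u : Distr n d) (j : ℕ) : Continuous (lpBlock u j) := by
  unfold lpBlock; fun_prop

theorem aestronglyMeasurable_lpBlock (u : Distr n d) (j : ℕ) :
    AEStronglyMeasurable (lpBlock u j) (torusMeasure d) :=
  (continuous_lpBlock u j).aestronglyMeasurable

theorem besovNorm_congr {u : Distr n d} {v : Distr m d} (h : ∀ z, coeff u z = coeff v z) (s : ℝ)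
    (p q : ℝ≥0∞) : besovNorm s p q u = besovNorm s p q v := by
  unfold besovNorm lpBlock; simp only [h]

theorem integral_mFourier_mul_conj (z w : Fin d → ℤ) :
    ∫ x, mFourier z x * conj (mFourier w x) ∂torusMeasure d = if z = w then 1 else 0 := by
  have h := orthonormal_iff_ite.1 (UnitAddTorus.orthonormal_mFourier (d := Fin d)) w z
  rw [ContinuousMap.inner_toLp] at h
  refine Eq.trans h ?_
  simp only [eq_comm]

theorem integral_lpBlock_mul_conj (u : Distr n d) (v : Distr m d) (j : ℕ) :
    ∫ x, lpBlock u j x * conj (lpBlock v j x) ∂torusMeasure d =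
      ∑ z ∈ dyadicBlock d j, coeff u z * conj (coeff v z) := by
  simp only [lpBlock, map_sum, map_mul, Finset.sum_mul_sum]
  have hc : ∀ z w : Fin d → ℤ, Continuous fun x : UnitAddTorus (Fin d) =>
      coeff u z * mFourier z x * (conj (coeff v w) * conj (mFourier w x)) := fun z w => by fun_prop
  have hi : ∀ z w : Fin d → ℤ, Integrable (fun x : UnitAddTorus (Fin d) =>
      coeff u z * mFourier z x * (conj (coeff v w) * conj (mFourier w x))) (torusMeasure d) :=
    fun z w => (hc z w).integrable_of_hasCompactSupport (HasCompactSupport.of_compactSpace _)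
  rw [integral_finsetSum _ fun z _ => integrable_finsetSum _ fun w _ => hi z w]
  refine Finset.sum_congr rfl fun z hz => ?_
  rw [integral_finsetSum _ fun w _ => hi z w]
  have : ∀ w, ∫ x, coeff u z * mFourier z x * (conj (coeff v w) * conj (mFourier w x))
      ∂torusMeasure d = coeff u z * conj (coeff v w) * if z = w then 1 else 0 := fun w => by
    rw [← integral_mFourier_mul_conj, ← integral_const_mul]
    congr 1; ext x; ring
  simp only [this, mul_ite, mul_one, mul_zero]
  rw [Finset.sum_ite_eq, if_pos hz]

theorem eLpNorm_lpBlock_two (u : Distr n d) (j : ℕ) :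
    eLpNorm (lpBlock u j) 2 (torusMeasure d) ^ 2 =
      .ofReal (∑ z ∈ dyadicBlock d j, ‖coeff u z‖ ^ 2) := by
  have h1 := eLpNorm_nnreal_pow_eq_lintegral (f := lpBlock u j) (μ := torusMeasure d)
    (p := 2) (by norm_num)
  have h2 := congrArg Complex.re (integral_lpBlock_mul_conj u u j)
  simp only [Complex.mul_conj, Complex.normSq_eq_norm_sq] at h2
  rw [integral_complex_ofReal, ← Complex.ofReal_sum, Complex.ofReal_re, Complex.ofReal_re] at h2
  have hint : Integrable (fun x => ‖lpBlock u j x‖ ^ 2) (torusMeasure d) :=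
    ((continuous_lpBlock u j).norm.pow 2).integrable_of_hasCompactSupport
      (HasCompactSupport.of_compactSpace _)
  rw [← h2, ofReal_integral_eq_lintegral_ofReal hint (Eventually.of_forall fun x => by positivity)]
  have h3 : eLpNorm (lpBlock u j) 2 (torusMeasure d) ^ 2 =
      ∫⁻ x, ‖lpBlock u j x‖ₑ ^ 2 ∂torusMeasure d := by
    have := h1
    simp only [NNReal.coe_ofNat, ENNReal.rpow_ofNat, ENNReal.coe_ofNat] at this
    exact this
  rw [h3]
  refine lintegral_congr fun x => ?_
  rw [ENNReal.ofReal_pow (norm_nonneg _), ofReal_norm]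

theorem enorm_block_pairing_le {p q : ℝ≥0∞} [ENNReal.HolderTriple p q 1] (u : Distr n d)
    (v : Distr m d) (j : ℕ) :
    ‖∑ z ∈ dyadicBlock d j, (coeff u z * conj (coeff v z)).re‖ₑ ≤
      eLpNorm (lpBlock u j) p (torusMeasure d) * eLpNorm (lpBlock v j) q (torusMeasure d) := by
  have hconj : Continuous fun x => conj (lpBlock v j x) :=
    Complex.continuous_conj.comp (continuous_lpBlock v j)
  have h := eLpNorm_smul_le_mul_eLpNorm (p := p) (q := q) (r := 1) (μ := torusMeasure d)
    (f := fun x => conj (lpBlock v j x)) (φ := lpBlock u j) hconj.aestronglyMeasurable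
    (aestronglyMeasurable_lpBlock u j)
  have e : eLpNorm (fun x => conj (lpBlock v j x)) q (torusMeasure d) =
      eLpNorm (lpBlock v j) q (torusMeasure d) :=
    eLpNorm_congr_norm_ae (Eventually.of_forall fun x => by simp)
  rw [e, eLpNorm_one_eq_lintegral_enorm] at h
  refine le_trans ?_ h
  rw [← Complex.re_sum, ← integral_lpBlock_mul_conj]
  refine le_trans ?_ (enorm_integral_le_lintegral_enorm _)
  rw [← ofReal_norm, ← ofReal_norm]
  exact ENNReal.ofReal_le_ofReal (Complex.abs_re_le_norm _)

theorem mem_dyadicBlock {j : ℕ} {z : Fin d → ℤ} : z ∈ dyadicBlock d j ↔ z ∈ dyadicSet d j := by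
  simp [dyadicBlock]

/-- Each frequency lies in exactly one dyadic block. -/
theorem exists_dyadicLevel (d : ℕ) : ∃ lev : (Fin d → ℤ) → ℕ,
    ∀ j z, z ∈ dyadicBlock d j ↔ lev z = j := by
  classical
  have hex : ∀ z : Fin d → ℤ, ∃ j : ℕ, ∀ i, 2 * Real.pi * |(z i : ℝ)| ≤ 2 ^ j := fun z => by
    obtain ⟨B, hB⟩ := (Set.finite_range fun i => 2 * Real.pi * |(z i : ℝ)|).bddAbove
    obtain ⟨j, hj⟩ := pow_unbounded_of_one_lt B (one_lt_two : (1 : ℝ) < 2)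
    exact ⟨j, fun i => (hB ⟨i, rfl⟩).trans hj.le⟩
  refine ⟨fun z => Nat.find (hex z), fun j z => ?_⟩
  rw [mem_dyadicBlock, Nat.find_eq_iff]
  cases j with
  | zero => simp [dyadicSet]
  | succ j =>
    simp only [dyadicSet, mem_ofPred_eq]
    refine and_congr_right fun _ => ⟨fun h k hk hk' => h fun i => (hk' i).trans ?_, fun h =>
      h j (Nat.lt_succ_self j)⟩
    exact pow_le_pow_right₀ (by norm_num) (Nat.lt_succ_iff.1 hk)

theorem HasSum.dyadic {f : (Fin d → ℤ) → ℝ} {A : ℝ} (h : HasSum f A) :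
    HasSum (fun j => ∑ z ∈ dyadicBlock d j, f z) A := by
  obtain ⟨lev, hlev⟩ := exists_dyadicLevel d
  convert! h.tsum_fiberwise lev using 2 with j
  have e : lev ⁻¹' {j} = ((dyadicBlock d j : Finset (Fin d → ℤ)) : Set (Fin d → ℤ)) := by
    ext z; simp [hlev]
  rw [e]
  exact (Finset.tsum_subtype (dyadicBlock d j) f).symm

/-! ### Square integrable functions -/

/-- An element of the real `L²` space as an element of the complex one. -/
def complexify (g : L2 d) : Lp ℂ 2 (torusMeasure d) := Complex.ofRealCLM.compLp g

theorem coe_complexify (g : L2 d) : complexify g =ᵐ[torusMeasure d] fun x => (g x : ℂ) :=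
  Complex.ofRealCLM.coeFn_compLp g

theorem coeff_ofL2 (g : L2 d) (z : Fin d → ℤ) :
    coeff (ofL2 n g) z = mFourierCoeff (complexify g) z := by
  have h1 : Integrable (fun x => ((g x * (cosFun n z).1 x : ℝ) : ℂ)) (torusMeasure d) :=
    (L2.integrable_mul g _).ofReal
  have h2 : Integrable (fun x => Complex.I * ((g x * (sinFun n z).1 x : ℝ) : ℂ))
    (torusMeasure d) := (L2.integrable_mul g _).ofReal.const_mul _
  have e : coeff (ofL2 n g) z = ∫ x, ((g x * (cosFun n z).1 x : ℝ) : ℂ) -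
      Complex.I * ((g x * (sinFun n z).1 x : ℝ) : ℂ) ∂torusMeasure d := by
    rw [integral_sub h1 h2, integral_const_mul, integral_complex_ofReal, integral_complex_ofReal]
    rfl
  rw [e]
  change _ = ∫ x, mFourier (-z) x • complexify g x ∂torusMeasure d
  refine integral_congr_ae ?_
  filter_upwards [coe_complexify g] with x hx
  rw [hx, UnitAddTorus.mFourier_neg, smul_eq_mul]
  have : conj (mFourier z x) = ((cosFun n z).1 x : ℂ) - Complex.I * ((sinFun n z).1 x : ℂ) := by
    apply Complex.ext <;> simp [cosFun, sinFun]
  rw [this]; push_cast; ring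

theorem coeff_ofL2_eq (g : L2 d) (z : Fin d → ℤ) : coeff (ofL2 n g) z = coeff (ofL2 m g) z := by
  rw [coeff_ofL2, coeff_ofL2]

theorem ofL2_add (g h : L2 d) : ofL2 n (g + h) = ofL2 n g + ofL2 n h := by
  apply Subtype.ext; apply LinearMap.ext; intro φ
  change ∫ x, (g + h : L2 d) x * φ.1 x ∂torusMeasure d =
    ∫ x, g x * φ.1 x ∂torusMeasure d + ∫ x, h x * φ.1 x ∂torusMeasure d
  rw [← integral_add (L2.integrable_mul g φ.1) (L2.integrable_mul h φ.1)]
  refine integral_congr_ae ?_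
  filter_upwards [Lp.coeFn_add g h] with x hx
  rw [hx, Pi.add_apply, add_mul]

theorem ofL2_smul (c : ℝ) (g : L2 d) : ofL2 n (c • g) = c • ofL2 n g := by
  apply Subtype.ext; apply LinearMap.ext; intro φ
  change ∫ x, (c • g : L2 d) x * φ.1 x ∂torusMeasure d = c * ∫ x, g x * φ.1 x ∂torusMeasure d
  rw [← integral_const_mul]
  refine integral_congr_ae ?_
  filter_upwards [Lp.coeFn_smul c g] with x hx
  rw [hx, Pi.smul_apply, smul_eq_mul, mul_assoc]

theorem ofL2_sub (g h : L2 d) : ofL2 n (g - h) = ofL2 n g - ofL2 n h := by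
  rw [sub_eq_add_neg, ← neg_one_smul ℝ, ofL2_add, ofL2_smul]; module

/-- Parseval's identity. -/
theorem hasSum_coeff_mul_conj (g h : L2 d) :
    HasSum (fun z => (coeff (ofL2 n g) z * conj (coeff (ofL2 m h) z)).re) (inner ℝ g h) := by
  have H : HasSum (fun z => conj (mFourierCoeff (complexify h) z) * mFourierCoeff (complexify g) z)
      (∫ x, conj (complexify h x) * complexify g x ∂torusMeasure d) :=
    UnitAddTorus.hasSum_prod_mFourierCoeff (d := Fin d) (complexify h) (complexify g)
  have e : ∫ x, conj (complexify h x) * complexify g x ∂torusMeasure d =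
      ((inner ℝ g h : ℝ) : ℂ) := by
    rw [L2.inner_def, ← integral_complex_ofReal]
    refine integral_congr_ae ?_
    filter_upwards [coe_complexify g, coe_complexify h] with x hg hh
    rw [hg, hh]
    simp [mul_comm]
  rw [e] at H
  convert! Complex.hasSum_re H using 1
  ext z
  rw [coeff_ofL2, coeff_ofL2, mul_comm]

theorem sum_sq_coeff_le (s : Finset (Fin d → ℤ)) (g : L2 d) :
    ∑ z ∈ s, ‖coeff (ofL2 n g) z‖ ^ 2 ≤ ‖g‖ ^ 2 := by
  have h := hasSum_coeff_mul_conj (n := n) (m := n) g g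
  rw [real_inner_self_eq_norm_sq] at h
  have e : (fun z => (coeff (ofL2 n g) z * conj (coeff (ofL2 n g) z)).re) =
      fun z => ‖coeff (ofL2 n g) z‖ ^ 2 := by
    ext z; rw [Complex.mul_conj, Complex.ofReal_re, Complex.normSq_eq_norm_sq]
  rw [e] at h
  exact sum_le_hasSum s (fun z _ => by positivity) h

theorem hasSum_pairing_ofL2 (g h : L2 d) :
    HasSum (fun j => ∑ z ∈ dyadicBlock d j,
      (coeff (ofL2 n g) z * conj (coeff (ofL2 m h) z)).re) (inner ℝ g h) :=
  HasSum.dyadic (hasSum_coeff_mul_conj g h)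

theorem eLpNorm_lpBlock_ofL2_le {p : ℝ≥0∞} (hp : p ≤ 2) (g : L2 d) (j : ℕ) :
    eLpNorm (lpBlock (ofL2 n g) j) p (torusMeasure d) ≤ .ofReal ‖g‖ := by
  refine (eLpNorm_le_eLpNorm_of_exponent_le hp (aestronglyMeasurable_lpBlock _ j)).trans ?_
  rw [← ENNReal.pow_le_pow_left_iff two_ne_zero, eLpNorm_lpBlock_two,
    ← ENNReal.ofReal_pow (norm_nonneg _)]
  exact ENNReal.ofReal_le_ofReal (sum_sq_coeff_le _ g)

/-! ### The pairing of `B^{-d/2}_{p',∞}` and `B^{d/2}_{p,1}` -/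

theorem two_rpow_mul_neg (x : ℝ) : (2 : ℝ≥0∞) ^ x * (2 : ℝ≥0∞) ^ (-x) = 1 := by
  rw [← ENNReal.rpow_add _ _ two_ne_zero (by simp)]; simp

theorem tsum_enorm_block_pairing_le {p q : ℝ≥0∞} [ENNReal.HolderTriple p q 1] (s : ℝ)
    (u : Distr n d) (v : Distr m d) :
    ∑' j, ‖∑ z ∈ dyadicBlock d j, (coeff u z * conj (coeff v z)).re‖ₑ ≤
      besovNorm (-s) p ∞ u * besovNorm s q 1 v := by
  simp only [besovNorm, lqNorm_one, lqNorm_top]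
  rw [← ENNReal.tsum_mul_left]
  refine ENNReal.tsum_le_tsum fun j => (enorm_block_pairing_le (p := p) (q := q) u v j).trans ?_
  calc eLpNorm (lpBlock u j) p (torusMeasure d) * eLpNorm (lpBlock v j) q (torusMeasure d)
      = ((2 : ℝ≥0∞) ^ ((j : ℝ) * s) * (2 : ℝ≥0∞) ^ (-((j : ℝ) * s))) *
        (eLpNorm (lpBlock u j) p (torusMeasure d) * eLpNorm (lpBlock v j) q (torusMeasure d)) := by
        rw [two_rpow_mul_neg, one_mul]
    _ = ((2 : ℝ≥0∞) ^ ((j : ℝ) * -s) * eLpNorm (lpBlock u j) p (torusMeasure d)) *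
        ((2 : ℝ≥0∞) ^ ((j : ℝ) * s) * eLpNorm (lpBlock v j) q (torusMeasure d)) := by
        rw [mul_neg]; ring
    _ ≤ _ := mul_le_mul_left (le_iSup (fun j : ℕ => (2 : ℝ≥0∞) ^ ((j : ℝ) * -s) *
        eLpNorm (lpBlock u j) p (torusMeasure d)) j) _

theorem summable_block_pairing {p q : ℝ≥0∞} [ENNReal.HolderTriple p q 1] {s : ℝ}
    {u : Distr n d} {v : Distr m d} (hu : besovNorm (-s) p ∞ u < ∞) (hv : besovNorm s q 1 v < ∞) :
    Summable fun j => ∑ z ∈ dyadicBlock d j, (coeff u z * conj (coeff v z)).re := by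
  have h := (tsum_enorm_block_pairing_le (p := p) (q := q) s u v).trans_lt
    (ENNReal.mul_lt_top hu hv)
  refine Summable.of_norm ?_
  simp only [← ofReal_norm] at h
  have := ENNReal.summable_toReal h.ne
  simpa [ENNReal.toReal_ofReal (abs_nonneg _)] using this

theorem enorm_pairing_le {p q : ℝ≥0∞} [ENNReal.HolderTriple p q 1] (s : ℝ)
    (u : Distr n d) (v : Distr m d) :
    ‖pairing u v‖ₑ ≤ besovNorm (-s) p ∞ u * besovNorm s q 1 v := by
  refine le_trans ?_ (tsum_enorm_block_pairing_le (p := p) (q := q) s u v)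
  exact enorm_tsum_le_tsum_enorm

theorem pairing_sub_right {p q : ℝ≥0∞} [ENNReal.HolderTriple p q 1] {s : ℝ}
    {u : Distr n d} {v w : Distr m d} (hu : besovNorm (-s) p ∞ u < ∞)
    (hv : besovNorm s q 1 v < ∞) (hw : besovNorm s q 1 w < ∞) :
    pairing u (v - w) = pairing u v - pairing u w := by
  unfold pairing
  rw [← (summable_block_pairing hu hv).tsum_sub (summable_block_pairing hu hw)]
  refine tsum_congr fun j => ?_
  rw [← Finset.sum_sub_distrib]
  refine Finset.sum_congr rfl fun z _ => ?_
  rw [coeff_sub, map_sub, mul_sub, Complex.sub_re]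

theorem pairing_data {p q : ℝ≥0∞} [ENNReal.HolderTriple p q 1] {s : ℝ} (g h : L2 d) (ε : ℝ)
    {u : Distr n d} (hu : besovNorm (-s) p ∞ u < ∞) (hh : besovNorm s q 1 (ofL2 m h) < ∞) :
    pairing (ofL2 n g + ε • u) (ofL2 m h) = inner ℝ g h + ε * pairing u (ofL2 m h) := by
  have h1 := (hasSum_pairing_ofL2 (n := n) (m := m) g h).add
    ((summable_block_pairing hu hh).hasSum.mul_left ε)
  refine Eq.trans (tsum_congr fun j => ?_) h1.tsum_eq
  rw [Finset.mul_sum, ← Finset.sum_add_distrib]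
  refine Finset.sum_congr rfl fun z _ => ?_
  rw [coeff_add, coeff_smul, add_mul, Complex.add_re, mul_assoc, Complex.re_ofReal_mul]

end Fourier

end TorusBesov

end

noncomputable section

namespace TorusBesov

open scoped ComplexConjugate
open UnitAddTorus (mFourier mFourierCoeff)

/-! ### Iterated differences -/

section Differences

/-- The difference operator `f ↦ f (· + h) - f`. -/
def diffOp {G R : Type*} [Add G] [Sub R] (h : G) (f : G → R) : G → R := fun x => f (x + h) - f x

theorem norm_iterate_diffOp_le {E : Type*} [NormedAddCommGroup E] [NormedSpace ℝ E] (v : E) (B : ℝ)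
    (k : ℕ) : ∀ f : E → ℝ, ContDiff ℝ k f → (∀ x, ‖iteratedFDeriv ℝ k f x‖ ≤ B) →
      ∀ x, |(diffOp v)^[k] f x| ≤ ‖v‖ ^ k * B := by
  induction k generalizing B with
  | zero =>
    intro f _ hB x
    have := hB x
    rw [norm_iteratedFDeriv_zero] at this
    simpa using this
  | succ k ih =>
    intro f hf hB x
    have hfk : ContDiff ℝ k f := hf.of_le (by exact_mod_cast Nat.le_succ k)
    have hsh : ContDiff ℝ k fun x => f (x + v) := hfk.comp (contDiff_id.add contDiff_const)
    have hd : ContDiff ℝ k (diffOp v f) := hsh.sub hfk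
    rw [Function.iterate_succ_apply]
    refine (ih (‖v‖ * B) (diffOp v f) hd (fun y => ?_) x).trans_eq (by ring)
    have e : iteratedFDeriv ℝ k (diffOp v f) y =
        iteratedFDeriv ℝ k f (y + v) - iteratedFDeriv ℝ k f y := by
      have h := congrFun (iteratedFDeriv_sub hsh hfk) y
      rw [Pi.sub_apply, iteratedFDeriv_comp_add_right] at h
      exact h
    rw [e]
    have hdiff : Differentiable ℝ (iteratedFDeriv ℝ k f) :=
      hf.differentiable_iteratedFDeriv (by exact_mod_cast Nat.lt_succ_self k)
    have := Convex.norm_image_sub_le_of_norm_fderiv_le (𝕜 := ℝ) (f := iteratedFDeriv ℝ k f)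
      (C := B) (s := univ) (x := y) (y := y + v) (fun z _ => hdiff z)
      (fun z _ => by rw [norm_fderiv_iteratedFDeriv]; exact hB z) convex_univ trivial trivial
    rw [add_sub_cancel_left] at this
    linarith

end Differences

/-! ### Fourier coefficients of smooth functions -/

section Smooth

variable {n : ℕ∞} {d : ℕ}

instance (d : ℕ) : (torusMeasure d).IsAddLeftInvariant := by
  unfold torusMeasure; infer_instance

theorem CkFun.contDiff (φ : CkFun n d) : ContDiff ℝ n fun x : Fin d → ℝ => φ.1 (toTorus x) := φ.2

/-- A continuous function on the torus as an element of `L²`. -/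
def contToL2 (d : ℕ) : C(UnitAddTorus (Fin d), ℝ) →L[ℝ] L2 d :=
  ContinuousMap.toLp 2 (torusMeasure d) ℝ

theorem coe_contToL2 (ψ : C(UnitAddTorus (Fin d), ℝ)) : contToL2 d ψ =ᵐ[torusMeasure d] ψ :=
  ContinuousMap.coeFn_toLp _ ψ

theorem norm_contToL2_le (ψ : C(UnitAddTorus (Fin d), ℝ)) : ‖contToL2 d ψ‖ ≤ ‖ψ‖ := by
  have h := ContinuousMap.toLp_norm_le (p := 2) (μ := torusMeasure d) (𝕜 := ℝ) (E := ℝ)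
  refine ((contToL2 d).le_opNorm ψ).trans ?_
  refine (mul_le_mul_of_nonneg_right h (norm_nonneg _)).trans_eq ?_
  simp [measureUnivNNReal]

theorem coeff_contToL2 (ψ : C(UnitAddTorus (Fin d), ℝ)) (z : Fin d → ℤ) :
    coeff (ofL2 n (contToL2 d ψ)) z = ∫ x, mFourier (-z) x * (ψ x : ℂ) ∂torusMeasure d := by
  rw [coeff_ofL2]
  change ∫ x, mFourier (-z) x • complexify (contToL2 d ψ) x ∂torusMeasure d = _
  refine integral_congr_ae ?_
  filter_upwards [coe_complexify (contToL2 d ψ), coe_contToL2 ψ] with x h1 h2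
  rw [h1, h2, smul_eq_mul]

/-- The difference operator on continuous functions. -/
def contDiffOp (h : UnitAddTorus (Fin d)) (ψ : C(UnitAddTorus (Fin d), ℝ)) :
    C(UnitAddTorus (Fin d), ℝ) := ⟨diffOp h ψ, by unfold diffOp; fun_prop⟩

theorem mFourier_add_apply (z : Fin d → ℤ) (x y : UnitAddTorus (Fin d)) :
    mFourier z (x + y) = mFourier z x * mFourier z y := by
  simp only [mFourier, ContinuousMap.coe_mk, Pi.add_apply, fourier_apply, ← Finset.prod_mul_distrib,
    smul_add, AddCircle.toCircle_add, Circle.coe_mul]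

theorem mFourier_neg_mul_self (z : Fin d → ℤ) (x : UnitAddTorus (Fin d)) :
    mFourier (-z) x * mFourier z x = 1 := by
  rw [← UnitAddTorus.mFourier_add]; simp [UnitAddTorus.mFourier_zero]

theorem coeff_contDiffOp (h : UnitAddTorus (Fin d)) (ψ : C(UnitAddTorus (Fin d), ℝ))
    (z : Fin d → ℤ) : coeff (ofL2 n (contToL2 d (contDiffOp h ψ))) z =
      (mFourier z h - 1) * coeff (ofL2 n (contToL2 d ψ)) z := by
  have hi : ∀ χ : C(UnitAddTorus (Fin d), ℂ), Integrable (fun x => χ x) (torusMeasure d) :=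
    fun χ => χ.continuous.integrable_of_hasCompactSupport (HasCompactSupport.of_compactSpace _)
  have h1 : Integrable (fun x => mFourier (-z) x * (ψ (x + h) : ℂ)) (torusMeasure d) :=
    hi ⟨fun x => mFourier (-z) x * (ψ (x + h) : ℂ), by fun_prop⟩
  have h2 : Integrable (fun x => mFourier (-z) x * (ψ x : ℂ)) (torusMeasure d) :=
    hi ⟨fun x => mFourier (-z) x * (ψ x : ℂ), by fun_prop⟩
  rw [coeff_contToL2, coeff_contToL2]
  have e : ∀ x, mFourier (-z) x * ((contDiffOp h ψ x : ℝ) : ℂ) =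
      mFourier (-z) x * (ψ (x + h) : ℂ) - mFourier (-z) x * (ψ x : ℂ) := fun x => by
    simp only [contDiffOp, diffOp, ContinuousMap.coe_mk]; push_cast; ring
  simp only [e]
  rw [integral_sub h1 h2, sub_mul, one_mul]
  congr 1
  rw [← integral_const_mul, ← integral_add_right_eq_self (fun x => mFourier z h * _) h]
  refine integral_congr_ae (Eventually.of_forall fun x => ?_)
  simp only
  rw [mFourier_add_apply]
  linear_combination (-(mFourier (-z) x * (ψ (x + h) : ℂ))) * mFourier_neg_mul_self z h

theorem coeff_iterate_contDiffOp (h : UnitAddTorus (Fin d)) (ψ : C(UnitAddTorus (Fin d), ℝ))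
    (z : Fin d → ℤ) (k : ℕ) : coeff (ofL2 n (contToL2 d ((contDiffOp h)^[k] ψ))) z =
      (mFourier z h - 1) ^ k * coeff (ofL2 n (contToL2 d ψ)) z := by
  induction k with
  | zero => simp
  | succ k ih => rw [Function.iterate_succ_apply', coeff_contDiffOp, ih]; ring

theorem toTorus_add (x y : Fin d → ℝ) : toTorus (x + y) = toTorus x + toTorus y := by
  ext i; simp [toTorus]

theorem iterate_contDiffOp_toTorus (v : Fin d → ℝ) (k : ℕ) : ∀ (ψ : C(UnitAddTorus (Fin d), ℝ))
    (x : Fin d → ℝ), (contDiffOp (toTorus v))^[k] ψ (toTorus x) =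
      (diffOp v)^[k] (fun y => ψ (toTorus y)) x := by
  induction k with
  | zero => intro ψ x; rfl
  | succ k ih =>
    intro ψ x
    rw [Function.iterate_succ_apply, Function.iterate_succ_apply, ih]
    congr 2

theorem norm_iterate_contDiffOp_le {k : ℕ} {φ : CkFun n d} (hk : (k : ℕ∞) ≤ n) {B : ℝ}
    (hB : CkBound k φ B) (v : Fin d → ℝ) :
    ‖(contDiffOp (toTorus v))^[k] φ.1‖ ≤ ‖v‖ ^ k * B := by
  refine (ContinuousMap.norm_le _ (mul_nonneg (by positivity) hB.nonneg)).2 fun x => ?_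
  obtain ⟨y, rfl⟩ := toTorus_surjective x
  rw [iterate_contDiffOp_toTorus]
  exact norm_iterate_diffOp_le v B k _ ((CkFun.contDiff φ).of_le (by exact_mod_cast hk)) (hB k le_rfl) y

theorem mFourier_toTorus_single (z : Fin d → ℤ) (i : Fin d) (t : ℝ) :
    mFourier z (toTorus (Pi.single i t)) = Complex.exp ((2 * Real.pi * z i * t : ℝ) * Complex.I) := by
  simp only [mFourier, ContinuousMap.coe_mk, toTorus]
  rw [Finset.prod_eq_single i]
  · rw [Pi.single_eq_same, fourier_coe_apply]; congr 1; push_cast; ring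
  · intro k _ hk; rw [Pi.single_eq_of_ne hk]; simp
  · simp

theorem norm_exp_sub_one_ge {x : ℝ} (h1 : 1 / 2 ≤ |x|) (h2 : |x| ≤ 1) :
    1 / (2 * Real.pi ^ 2) ≤ ‖Complex.exp (x * Complex.I) - 1‖ := by
  have hc := Real.cos_le_one_sub_mul_cos_sq (x := x) (by linarith [Real.pi_gt_three])
  have h3 : (1 / 2) ^ 2 ≤ x ^ 2 := by rw [← sq_abs x]; gcongr
  have h4 : -(Complex.exp (x * Complex.I) - 1).re = 1 - Real.cos x := by
    rw [Complex.sub_re, Complex.exp_ofReal_mul_I_re]; simp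
  have h5 := (neg_le_abs _).trans (Complex.abs_re_le_norm (Complex.exp (x * Complex.I) - 1))
  have h6 : 1 / (2 * Real.pi ^ 2) ≤ 2 / Real.pi ^ 2 * x ^ 2 := by
    calc 1 / (2 * Real.pi ^ 2) = 2 / Real.pi ^ 2 * (1 / 2) ^ 2 := by field_simp
      _ ≤ _ := by gcongr
  linarith

/-- The Fourier coefficients of `C^k` functions decay in the `j`-th block like `2^{-jk}`. -/
theorem exists_sum_sq_coeff_le (d k : ℕ) : ∃ C : ℝ, 0 ≤ C ∧ ∀ (n : ℕ∞) (φ : CkFun n d) (B : ℝ),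
    (k : ℕ∞) ≤ n → CkBound k φ B → ∀ j : ℕ,
      ∑ z ∈ dyadicBlock d j, ‖coeff (ofL2 n (contToL2 d φ.1)) z‖ ^ 2 ≤
        (C * (2 : ℝ) ^ (-((j : ℝ) * k)) * B) ^ 2 := by
  set κ : ℝ := 1 / (2 * Real.pi ^ 2) with hκ
  have hκ0 : 0 < κ := by positivity
  set Q : ℝ := 1 + ((κ ^ k) ^ 2)⁻¹ * d with hQ
  have hQ0 : 0 ≤ Q := by positivity
  refine ⟨√Q, Real.sqrt_nonneg _, fun n φ B hk hB j => ?_⟩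
  have hB0 := hB.nonneg
  rw [mul_pow, mul_pow, Real.sq_sqrt hQ0]
  rcases j with _ | j
  · have h1 : ‖contToL2 d φ.1‖ ≤ B := (norm_contToL2_le _).trans
      ((ContinuousMap.norm_le _ hB0).2 fun x => by
        obtain ⟨y, rfl⟩ := toTorus_surjective x
        have := hB 0 (Nat.zero_le _) y
        rwa [norm_iteratedFDeriv_zero] at this)
    refine (sum_sq_coeff_le _ _).trans ?_
    have h2 : ‖contToL2 d φ.1‖ ^ 2 ≤ B ^ 2 := by gcongr
    have h3 : (1 : ℝ) ≤ Q := by rw [hQ]; linarith [show 0 ≤ ((κ ^ k) ^ 2)⁻¹ * (d : ℝ) by positivity]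
    simp only [Nat.cast_zero, zero_mul, neg_zero, Real.rpow_zero, one_pow, mul_one]
    nlinarith [sq_nonneg B]
  · set t : ℝ := ((2 : ℝ) ^ (j + 1))⁻¹ with ht
    have ht0 : 0 < t := by positivity
    set ψ : Fin d → C(UnitAddTorus (Fin d), ℝ) := fun i =>
      (contDiffOp (toTorus (Pi.single i t)))^[k] φ.1 with hψ
    have hψn : ∀ i, ‖contToL2 d (ψ i)‖ ≤ t ^ k * B := fun i => by
      refine (norm_contToL2_le _).trans ((norm_iterate_contDiffOp_le hk hB _).trans_eq ?_)
      rw [Pi.norm_single, Real.norm_of_nonneg ht0.le]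
    have hpt : ∀ z ∈ dyadicBlock d (j + 1), ‖coeff (ofL2 n (contToL2 d φ.1)) z‖ ^ 2 ≤
        ((κ ^ k) ^ 2)⁻¹ * ∑ i, ‖coeff (ofL2 n (contToL2 d (ψ i))) z‖ ^ 2 := by
      intro z hz
      obtain ⟨hz1, hz2⟩ := mem_dyadicBlock.1 hz
      push Not at hz2
      obtain ⟨i, hi⟩ := hz2
      rw [inv_mul_eq_div, le_div_iff₀ (by positivity)]
      refine le_trans ?_ (Finset.single_le_sum (f := fun i =>
        ‖coeff (ofL2 n (contToL2 d (ψ i))) z‖ ^ 2) (fun i _ => by positivity) (Finset.mem_univ i))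
      simp only [hψ]
      rw [coeff_iterate_contDiffOp, norm_mul, norm_pow, mul_pow, mul_comm]
      refine mul_le_mul_of_nonneg_right ?_ (by positivity)
      have habs : |2 * Real.pi * z i * t| = 2 * Real.pi * |(z i : ℝ)| * t := by
        rw [abs_mul, abs_mul, abs_of_pos ht0, abs_of_pos (by positivity : 0 < 2 * Real.pi)]
      have hge : κ ≤ ‖mFourier z (toTorus (Pi.single i t)) - 1‖ := by
        rw [mFourier_toTorus_single]
        refine norm_exp_sub_one_ge ?_ ?_
        · rw [habs, ht, ← div_eq_mul_inv, le_div_iff₀ (by positivity), pow_succ]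
          linarith
        · rw [habs, ht, ← div_eq_mul_inv, div_le_one (by positivity)]
          exact hz1 i
      gcongr
    have htk : (2 : ℝ) ^ (-(((j + 1 : ℕ) : ℝ) * k)) = t ^ k := by
      rw [ht, Real.rpow_neg (by norm_num), Real.rpow_mul (by norm_num), Real.rpow_natCast,
        Real.rpow_natCast, inv_pow]
    rw [htk]
    calc ∑ z ∈ dyadicBlock d (j + 1), ‖coeff (ofL2 n (contToL2 d φ.1)) z‖ ^ 2
        ≤ ∑ z ∈ dyadicBlock d (j + 1), ((κ ^ k) ^ 2)⁻¹ *
          ∑ i, ‖coeff (ofL2 n (contToL2 d (ψ i))) z‖ ^ 2 := Finset.sum_le_sum hpt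
      _ = ((κ ^ k) ^ 2)⁻¹ * ∑ i, ∑ z ∈ dyadicBlock d (j + 1),
          ‖coeff (ofL2 n (contToL2 d (ψ i))) z‖ ^ 2 := by rw [← Finset.mul_sum, Finset.sum_comm]
      _ ≤ ((κ ^ k) ^ 2)⁻¹ * ∑ _i : Fin d, (t ^ k * B) ^ 2 := by
          gcongr with i
          exact (sum_sq_coeff_le _ _).trans (by gcongr; exact hψn i)
      _ ≤ Q * (t ^ k) ^ 2 * B ^ 2 := by
          rw [Finset.sum_const, Finset.card_univ, Fintype.card_fin, nsmul_eq_mul, hQ]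
          nlinarith [sq_nonneg (t ^ k * B)]

theorem exists_ckBound {k : ℕ} (φ : CkFun k d) : ∃ B, CkBound k φ B := by
  set f : (Fin d → ℝ) → ℝ := fun y => φ.1 (toTorus y) with hf
  have hper : ∀ y : Fin d → ℝ, (fun x => f (x + fun i => ((⌊y i⌋ : ℤ) : ℝ))) = f := fun y => by
    ext x
    simp only [hf, toTorus_add]
    congr 1
    ext i
    simp [toTorus]
  have hone : ∀ j ≤ k, ∃ B : ℝ, ∀ x, ‖iteratedFDeriv ℝ j f x‖ ≤ B := fun j hj => by
    have hcont : Continuous (iteratedFDeriv ℝ j f) :=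
      (CkFun.contDiff φ).continuous_iteratedFDeriv (by exact_mod_cast hj)
    obtain ⟨B, hB⟩ := (isCompact_Icc (a := (0 : Fin d → ℝ)) (b := 1)).exists_bound_of_continuousOn
      hcont.continuousOn
    refine ⟨B, fun x => ?_⟩
    have e : iteratedFDeriv ℝ j f x = iteratedFDeriv ℝ j f (fun i => Int.fract (x i)) := by
      have := iteratedFDeriv_comp_add_right (𝕜 := ℝ) (f := f) j (fun i => ((⌊x i⌋ : ℤ) : ℝ))
        (fun i => Int.fract (x i))
      rw [hper x] at this
      rw [this]; congr 1; ext i; simp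
    rw [e]
    exact hB _ ⟨fun i => Int.fract_nonneg _, fun i => (Int.fract_lt_one _).le⟩
  choose! b hb using hone
  refine ⟨∑ j ∈ Finset.range (k + 1), |b j|, fun j hj x => (hb j hj x).trans
    ((le_abs_self _).trans (Finset.single_le_sum (f := fun j => |b j|) (fun _ _ => abs_nonneg _)
      (Finset.mem_range.2 (Nat.lt_succ_of_le hj))))⟩

end Smooth

end TorusBesov

end

noncomputable section

namespace TorusBesov

open scoped ComplexConjugate
open UnitAddTorus (mFourier mFourierCoeff)

/-! ### Distributions with prescribed Fourier coefficients -/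

section Reconstruction

variable {n : ℕ∞} {d : ℕ}

theorem coeff_cosFun (z₀ z : Fin d → ℤ) :
    coeff (ofL2 n (contToL2 d (cosFun n z₀).1)) z =
      ((if z = z₀ then 1 else 0) + if z = -z₀ then 1 else 0) / 2 := by
  have hi : ∀ χ : C(UnitAddTorus (Fin d), ℂ), Integrable (fun x => χ x) (torusMeasure d) :=
    fun χ => χ.continuous.integrable_of_hasCompactSupport (HasCompactSupport.of_compactSpace _)
  rw [coeff_contToL2]
  have e : ∀ x, mFourier (-z) x * (((cosFun n z₀).1 x : ℝ) : ℂ) =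
      (mFourier z₀ x * conj (mFourier z x) + mFourier (-z₀) x * conj (mFourier z x)) / 2 :=
    fun x => by
      rw [UnitAddTorus.mFourier_neg, UnitAddTorus.mFourier_neg]
      change _ * (((mFourier z₀ x).re : ℝ) : ℂ) = _
      rw [Complex.re_eq_add_conj]; ring
  simp only [e]
  have h1 : Integrable (fun x => mFourier z₀ x * conj (mFourier z x)) (torusMeasure d) :=
    hi ⟨fun x => mFourier z₀ x * conj (mFourier z x), by fun_prop⟩
  have h2 : Integrable (fun x => mFourier (-z₀) x * conj (mFourier z x)) (torusMeasure d) :=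
    hi ⟨fun x => mFourier (-z₀) x * conj (mFourier z x), by fun_prop⟩
  rw [integral_div, integral_add h1 h2,
    integral_mFourier_mul_conj, integral_mFourier_mul_conj]
  simp only [eq_comm]

theorem coeff_sinFun (z₀ z : Fin d → ℤ) :
    coeff (ofL2 n (contToL2 d (sinFun n z₀).1)) z =
      ((if z = z₀ then 1 else 0) - if z = -z₀ then 1 else 0) / (2 * Complex.I) := by
  have hi : ∀ χ : C(UnitAddTorus (Fin d), ℂ), Integrable (fun x => χ x) (torusMeasure d) :=
    fun χ => χ.continuous.integrable_of_hasCompactSupport (HasCompactSupport.of_compactSpace _)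
  rw [coeff_contToL2]
  have e : ∀ x, mFourier (-z) x * (((sinFun n z₀).1 x : ℝ) : ℂ) =
      (mFourier z₀ x * conj (mFourier z x) - mFourier (-z₀) x * conj (mFourier z x)) /
        (2 * Complex.I) :=
    fun x => by
      rw [UnitAddTorus.mFourier_neg, UnitAddTorus.mFourier_neg]
      change _ * (((mFourier z₀ x).im : ℝ) : ℂ) = _
      rw [Complex.im_eq_sub_conj]; ring
  simp only [e]
  have h1 : Integrable (fun x => mFourier z₀ x * conj (mFourier z x)) (torusMeasure d) :=
    hi ⟨fun x => mFourier z₀ x * conj (mFourier z x), by fun_prop⟩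
  have h2 : Integrable (fun x => mFourier (-z₀) x * conj (mFourier z x)) (torusMeasure d) :=
    hi ⟨fun x => mFourier (-z₀) x * conj (mFourier z x), by fun_prop⟩
  rw [integral_div, integral_sub h1 h2,
    integral_mFourier_mul_conj, integral_mFourier_mul_conj]
  simp only [eq_comm]

theorem abs_sum_re_mul_conj_le {ι : Type*} (s : Finset ι) (c e : ι → ℂ) {A B : ℝ} (hA : 0 ≤ A)
    (hB : 0 ≤ B) (hc : ∑ i ∈ s, ‖c i‖ ^ 2 ≤ A ^ 2) (he : ∑ i ∈ s, ‖e i‖ ^ 2 ≤ B ^ 2) :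
    |∑ i ∈ s, (c i * conj (e i)).re| ≤ A * B := by
  have h1 : |∑ i ∈ s, (c i * conj (e i)).re| ≤ ∑ i ∈ s, ‖c i‖ * ‖e i‖ := by
    refine (Finset.abs_sum_le_sum_abs _ _).trans (Finset.sum_le_sum fun i _ => ?_)
    refine (Complex.abs_re_le_norm _).trans_eq ?_
    rw [norm_mul, Complex.norm_conj]
  refine h1.trans (abs_le_of_sq_le_sq' ?_ (mul_nonneg hA hB)).2
  rw [mul_pow]
  exact (Finset.sum_mul_sq_le_sq_mul_sq s _ _).trans
    (mul_le_mul hc he (Finset.sum_nonneg fun i _ => by positivity) (by positivity))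

theorem exists_distr_of_coeff {σ : ℕ} {b C : ℝ} (hb : b < σ) (hC : 0 ≤ C) (c : (Fin d → ℤ) → ℂ)
    (hsym : ∀ z, c (-z) = conj (c z))
    (hc : ∀ j : ℕ, ∑ z ∈ dyadicBlock d j, ‖c z‖ ^ 2 ≤ (C * (2 : ℝ) ^ ((j : ℝ) * b)) ^ 2) :
    ∃ u : Distr σ d, ∀ z, coeff u z = c z := by
  obtain ⟨E, hE0, hE⟩ := exists_sum_sq_coeff_le d σ
  set T : CkFun σ d → ℕ → ℝ := fun φ j =>
    ∑ z ∈ dyadicBlock d j, (c z * conj (coeff (ofL2 σ (contToL2 d φ.1)) z)).re with hT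
  have hgeom : Summable fun j : ℕ => ((2 : ℝ) ^ (b - σ)) ^ j :=
    summable_geometric_of_lt_one (by positivity)
      (Real.rpow_lt_one_of_one_lt_of_neg (by norm_num) (by linarith))
  have hTb : ∀ (φ : CkFun σ d) (B : ℝ), CkBound σ φ B → ∀ j,
      |T φ j| ≤ C * E * B * ((2 : ℝ) ^ (b - σ)) ^ j := fun φ B hB j => by
    have hB0 := hB.nonneg
    refine (abs_sum_re_mul_conj_le _ _ _ (by positivity) (by positivity) (hc j)
      (hE σ φ B le_rfl hB j)).trans_eq ?_
    rw [← Real.rpow_natCast, ← Real.rpow_mul (by norm_num),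
      show (b - σ) * (j : ℝ) = (j : ℝ) * b + -((j : ℝ) * σ) by ring, Real.rpow_add (by norm_num)]
    ring
  have hsum : ∀ φ, Summable (T φ) := fun φ => by
    obtain ⟨B, hB⟩ := exists_ckBound φ
    exact Summable.of_norm_bounded (hgeom.mul_left _) (hTb φ B hB)
  let L : CkFun σ d →ₗ[ℝ] ℝ :=
    { toFun := fun φ => ∑' j, T φ j
      map_add' := fun φ ψ => by
        rw [← (hsum φ).tsum_add (hsum ψ)]
        refine tsum_congr fun j => ?_
        simp only [hT, ← Finset.sum_add_distrib]
        refine Finset.sum_congr rfl fun z _ => ?_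
        rw [Submodule.coe_add, map_add, ofL2_add, coeff_add, map_add, mul_add, Complex.add_re]
      map_smul' := fun t φ => by
        simp only [RingHom.id_apply, smul_eq_mul]
        rw [← tsum_mul_left]
        refine tsum_congr fun j => ?_
        simp only [hT, Finset.mul_sum]
        refine Finset.sum_congr rfl fun z _ => ?_
        rw [Submodule.coe_smul, map_smul, ofL2_smul, coeff_smul, map_mul, Complex.conj_ofReal,
          mul_left_comm, Complex.re_ofReal_mul] }
  have hL : ∀ (φ : CkFun σ d) (A : ℝ),
      HasSum (fun z => (c z * conj (coeff (ofL2 σ (contToL2 d φ.1)) z)).re) A → L φ = A :=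
    fun φ A h => (HasSum.dyadic h).tsum_eq
  have hmem : L ∈ Distr (σ : ℕ∞) d := by
    refine ⟨σ, le_rfl, C * E * ∑' j : ℕ, ((2 : ℝ) ^ (b - σ)) ^ j,
      mul_nonneg (mul_nonneg hC hE0) (tsum_nonneg fun j => by positivity), fun φ B hB => ?_⟩
    have h : ‖∑' j, T φ j‖ ≤ _ := tsum_of_norm_bounded (hgeom.mul_left (C * E * B)).hasSum (hTb φ B hB)
    rw [tsum_mul_left] at h
    calc |L φ| ≤ C * E * B * ∑' j : ℕ, ((2 : ℝ) ^ (b - σ)) ^ j := h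
      _ = _ := by ring
  refine ⟨⟨L, hmem⟩, fun z₀ => ?_⟩
  have hcos : L (cosFun σ z₀) = (c z₀).re := by
    refine hL _ _ ?_
    have h := (hasSum_ite_eq z₀ ((c z₀).re / 2)).add (hasSum_ite_eq (-z₀) ((c (-z₀)).re / 2))
    convert! h using 1
    · ext z
      rw [coeff_cosFun]
      by_cases h1 : z = z₀ <;> by_cases h2 : z = -z₀
      · rw [if_pos h1, if_pos h2, if_pos h1, if_pos h2, ← h2, ← h1]; simp
      · rw [if_pos h1, if_neg h2, if_pos h1, if_neg h2, ← h1]; simp [Complex.mul_re]; ring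
      · rw [if_neg h1, if_pos h2, if_neg h1, if_pos h2, ← h2]; simp [Complex.mul_re]; ring
      · rw [if_neg h1, if_neg h2, if_neg h1, if_neg h2]; simp
    · rw [hsym, Complex.conj_re]; ring
  have hsin : L (sinFun σ z₀) = -(c z₀).im := by
    refine hL _ _ ?_
    have h := (hasSum_ite_eq z₀ (-(c z₀).im / 2)).add (hasSum_ite_eq (-z₀) ((c (-z₀)).im / 2))
    convert! h using 1
    · ext z
      rw [coeff_sinFun]
      by_cases h1 : z = z₀ <;> by_cases h2 : z = -z₀
      · rw [if_pos h1, if_pos h2, if_pos h1, if_pos h2, ← h2, ← h1]; simp; ring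
      · rw [if_pos h1, if_neg h2, if_pos h1, if_neg h2, ← h1]; simp [Complex.mul_re]; ring
      · rw [if_neg h1, if_pos h2, if_neg h1, if_pos h2, ← h2]; simp [Complex.mul_re]; ring
      · rw [if_neg h1, if_neg h2, if_neg h1, if_neg h2]; simp
    · rw [hsym, Complex.conj_im]; ring
  change ((L (cosFun σ z₀) : ℝ) : ℂ) - Complex.I * ((L (sinFun σ z₀) : ℝ) : ℂ) = c z₀
  rw [hcos, hsin]
  apply Complex.ext <;> simp

theorem coeff_neg (u : Distr n d) (z : Fin d → ℤ) : coeff u (-z) = conj (coeff u z) := by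
  have h1 : cosFun n (-z) = cosFun n z := by
    apply Subtype.ext; ext x
    change (mFourier (-z) x).re = (mFourier z x).re
    rw [UnitAddTorus.mFourier_neg, Complex.conj_re]
  have h2 : sinFun n (-z) = -sinFun n z := by
    apply Subtype.ext; ext x
    change (mFourier (-z) x).im = -(mFourier z x).im
    rw [UnitAddTorus.mFourier_neg, Complex.conj_im]
  rw [coeff, coeff, h1, h2, map_neg]
  simp

end Reconstruction

/-! ### Convergence in Besov spaces from convergence of the Fourier coefficients -/

section Convergence

variable {n : ℕ∞} {d : ℕ}

theorem two_rpow_ofReal (x : ℝ) : (2 : ℝ≥0∞) ^ x = .ofReal (2 ^ x) := by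
  rw [← ENNReal.ofReal_rpow_of_pos (by norm_num)]; simp

theorem besovNorm_two_two_sq (a : ℝ) (u : Distr n d) :
    besovNorm (-a) 2 2 u ^ 2 = ∑' j : ℕ, ENNReal.ofReal
      ((2 : ℝ) ^ (-(2 * a * j)) * ∑ z ∈ dyadicBlock d j, ‖coeff u z‖ ^ 2) := by
  have h2 : (2 : ℝ≥0∞) = .ofReal 2 := by simp
  have h := lqNorm_ofReal_rpow (q := 2) (by norm_num) fun j : ℕ =>
    (2 : ℝ≥0∞) ^ ((j : ℝ) * -a) * eLpNorm (lpBlock u j) 2 (torusMeasure d)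
  rw [← h2] at h
  simp only [ENNReal.rpow_two] at h
  unfold besovNorm
  rw [h]
  refine tsum_congr fun j => ?_
  rw [mul_pow, eLpNorm_lpBlock_two, two_rpow_ofReal, ← ENNReal.ofReal_pow (by positivity),
    ← ENNReal.ofReal_mul (by positivity), ← Real.rpow_natCast, ← Real.rpow_mul (by norm_num)]
  congr 4; push_cast; ring

theorem sum_sq_coeff_le_of_besovNorm {b C : ℝ} (hC : 0 ≤ C) {u : Distr n d}
    (h : besovNorm (-b) 2 ∞ u ≤ .ofReal C) (j : ℕ) :
    ∑ z ∈ dyadicBlock d j, ‖coeff u z‖ ^ 2 ≤ (C * (2 : ℝ) ^ ((j : ℝ) * b)) ^ 2 := by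
  unfold besovNorm at h
  rw [lqNorm_top] at h
  have h1 := (le_iSup (fun j : ℕ => (2 : ℝ≥0∞) ^ ((j : ℝ) * -b) *
    eLpNorm (lpBlock u j) 2 (torusMeasure d)) j).trans h
  have h2 : eLpNorm (lpBlock u j) 2 (torusMeasure d) ≤ .ofReal (C * (2 : ℝ) ^ ((j : ℝ) * b)) := by
    calc eLpNorm (lpBlock u j) 2 (torusMeasure d)
        = (2 : ℝ≥0∞) ^ ((j : ℝ) * b) * ((2 : ℝ≥0∞) ^ ((j : ℝ) * -b) *
          eLpNorm (lpBlock u j) 2 (torusMeasure d)) := by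
          rw [← mul_assoc, mul_neg, two_rpow_mul_neg, one_mul]
      _ ≤ (2 : ℝ≥0∞) ^ ((j : ℝ) * b) * .ofReal C := mul_le_mul_right h1 _
      _ = _ := by rw [two_rpow_ofReal, ← ENNReal.ofReal_mul (by positivity), mul_comm]
  have h3 := pow_le_pow_left₀ zero_le h2 2
  rw [eLpNorm_lpBlock_two, ← ENNReal.ofReal_pow (by positivity)] at h3
  exact (ENNReal.ofReal_le_ofReal_iff (by positivity)).1 h3

theorem exists_besovNorm_two_two_le {a b : ℝ} (hba : b < a) :
    ∃ C : ℝ, 0 < C ∧ ∀ (n : ℕ∞) (d : ℕ) (u : Distr n d),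
      besovNorm (-a) 2 2 u ≤ .ofReal C * besovNorm (-b) 2 ∞ u := by
  set w : ℕ → ℝ≥0∞ := fun j => (2 : ℝ≥0∞) ^ ((j : ℝ) * (b - a)) with hw
  have h2 : (2 : ℝ≥0∞) = .ofReal 2 := by simp
  have hfin : lqNorm 2 w ≠ ∞ := by
    have h := lqNorm_ofReal_rpow (q := 2) (by norm_num) w
    rw [← h2] at h
    have hs : ∑' j, w j ^ (2 : ℝ) ≠ ∞ := by
      have e : ∀ j, w j ^ (2 : ℝ) = .ofReal (((2 : ℝ) ^ (2 * (b - a))) ^ j) := fun j => by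
        rw [hw, ← ENNReal.rpow_mul, two_rpow_ofReal, ← Real.rpow_natCast,
          ← Real.rpow_mul (by norm_num)]
        congr 2; ring
      simp only [e]
      rw [← ENNReal.ofReal_tsum_of_nonneg (fun j => by positivity)
        (summable_geometric_of_lt_one (by positivity)
          (Real.rpow_lt_one_of_one_lt_of_neg (by norm_num) (by linarith)))]
      exact ENNReal.ofReal_ne_top
    intro ht
    rw [ht, ENNReal.top_rpow_of_pos (by norm_num)] at h
    exact hs h.symm
  refine ⟨(lqNorm 2 w).toReal + 1, by positivity, fun n d u => ?_⟩
  have h1 : lqNorm 2 w ≤ .ofReal ((lqNorm 2 w).toReal + 1) := by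
    rw [ENNReal.le_ofReal_iff_toReal_le hfin (by positivity)]; linarith
  refine le_trans ?_ (mul_le_mul_left h1 _)
  rw [mul_comm, ← lqNorm_const_mul (by norm_num)]
  refine lqNorm_mono fun j => ?_
  have e : (2 : ℝ≥0∞) ^ ((j : ℝ) * -a) * eLpNorm (lpBlock u j) 2 (torusMeasure d) =
      ((2 : ℝ≥0∞) ^ ((j : ℝ) * -b) * eLpNorm (lpBlock u j) 2 (torusMeasure d)) * w j := by
    rw [hw, mul_right_comm, ← ENNReal.rpow_add _ _ two_ne_zero (by simp)]
    congr 2; ring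
  rw [e]
  refine mul_le_mul_left ?_ _
  unfold besovNorm
  rw [lqNorm_top]
  exact le_iSup (fun j : ℕ => (2 : ℝ≥0∞) ^ ((j : ℝ) * -b) *
    eLpNorm (lpBlock u j) 2 (torusMeasure d)) j

theorem tendsto_besovNorm_two_two {a b C : ℝ} (hba : b < a) {f : ℕ → Distr n d} {u : Distr n d}
    (hf : ∀ k j, ∑ z ∈ dyadicBlock d j, ‖coeff (f k) z‖ ^ 2 ≤ (C * (2 : ℝ) ^ ((j : ℝ) * b)) ^ 2)
    (hlim : ∀ z, Tendsto (fun k => coeff (f k) z) atTop (𝓝 (coeff u z))) :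
    Tendsto (fun k => besovNorm (-a) 2 2 (f k - u)) atTop (𝓝 0) := by
  have hu : ∀ j, ∑ z ∈ dyadicBlock d j, ‖coeff u z‖ ^ 2 ≤ (C * (2 : ℝ) ^ ((j : ℝ) * b)) ^ 2 :=
    fun j => le_of_tendsto' (tendsto_finsetSum _ fun z _ => ((hlim z).norm.pow 2)) fun k => hf k j
  set g : ℕ → ℕ → ℝ := fun k j =>
    (2 : ℝ) ^ (-(2 * a * j)) * ∑ z ∈ dyadicBlock d j, ‖coeff (f k - u) z‖ ^ 2 with hg
  have hg0 : ∀ k j, 0 ≤ g k j := fun k j =>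
    mul_nonneg (by positivity) (Finset.sum_nonneg fun z _ => by positivity)
  have hbd : ∀ k j, g k j ≤ 4 * C ^ 2 * ((2 : ℝ) ^ (2 * (b - a))) ^ j := fun k j => by
    have h1 : ∑ z ∈ dyadicBlock d j, ‖coeff (f k - u) z‖ ^ 2 ≤
        4 * (C * (2 : ℝ) ^ ((j : ℝ) * b)) ^ 2 := by
      calc ∑ z ∈ dyadicBlock d j, ‖coeff (f k - u) z‖ ^ 2
          ≤ ∑ z ∈ dyadicBlock d j, (2 * ‖coeff (f k) z‖ ^ 2 + 2 * ‖coeff u z‖ ^ 2) := by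
            refine Finset.sum_le_sum fun z _ => ?_
            rw [coeff_sub]
            have := norm_sub_le (coeff (f k) z) (coeff u z)
            nlinarith [sq_nonneg (‖coeff (f k) z‖ - ‖coeff u z‖),
              norm_nonneg (coeff (f k) z - coeff u z), norm_nonneg (coeff (f k) z),
              norm_nonneg (coeff u z)]
        _ ≤ _ := by
            rw [Finset.sum_add_distrib, ← Finset.mul_sum, ← Finset.mul_sum]
            linarith [hf k j, hu j]
    refine (mul_le_mul_of_nonneg_left h1 (by positivity)).trans_eq ?_
    have e1 : ((2 : ℝ) ^ ((j : ℝ) * b)) ^ 2 = (2 : ℝ) ^ (2 * b * j) := by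
      rw [← Real.rpow_natCast, ← Real.rpow_mul (by norm_num)]; congr 1; push_cast; ring
    have e2 : ((2 : ℝ) ^ (2 * (b - a))) ^ j = (2 : ℝ) ^ (-(2 * a * j)) * (2 : ℝ) ^ (2 * b * j) := by
      rw [← Real.rpow_natCast, ← Real.rpow_mul (by norm_num), ← Real.rpow_add (by norm_num)]
      congr 1; ring
    rw [mul_pow, e1, e2]; ring
  have hgeom : Summable fun j : ℕ => 4 * C ^ 2 * ((2 : ℝ) ^ (2 * (b - a))) ^ j :=
    (summable_geometric_of_lt_one (by positivity)
      (Real.rpow_lt_one_of_one_lt_of_neg (by norm_num) (by linarith))).mul_left _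
  have hpt : ∀ j, Tendsto (fun k => g k j) atTop (𝓝 0) := fun j => by
    have h1 : ∀ z, Tendsto (fun k => ‖coeff (f k - u) z‖ ^ 2) atTop (𝓝 0) := fun z => by
      have := ((hlim z).sub_const (coeff u z)).norm.pow 2
      simpa only [sub_self, norm_zero, zero_pow two_ne_zero, ← coeff_sub] using! this
    have := (tendsto_finsetSum (dyadicBlock d j) fun z _ => h1 z).const_mul
      ((2 : ℝ) ^ (-(2 * a * j)))
    simpa using this
  have hts := tendsto_tsum_of_dominated_convergence hgeom hpt (Eventually.of_forall fun k j => by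
    rw [Real.norm_of_nonneg (hg0 k j)]; exact hbd k j)
  rw [tsum_zero] at hts
  have hsq : Tendsto (fun k => besovNorm (-a) 2 2 (f k - u) ^ 2) atTop (𝓝 0) := by
    have := ENNReal.tendsto_ofReal hts
    rw [ENNReal.ofReal_zero] at this
    refine this.congr fun k => ?_
    rw [besovNorm_two_two_sq, ENNReal.ofReal_tsum_of_nonneg (hg0 k)
      (Summable.of_nonneg_of_le (hg0 k) (hbd k) hgeom)]
  have := ((ENNReal.continuous_rpow_const (y := 1 / 2)).tendsto _).comp hsq
  rw [ENNReal.zero_rpow_of_pos (by norm_num)] at this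
  refine this.congr fun k => ?_
  rw [Function.comp_apply, ← ENNReal.rpow_two, ← ENNReal.rpow_mul]; norm_num

theorem besovNorm_sub_limit_le {p : ℝ≥0∞} {q : ℝ} (hp1 : 1 ≤ p) (hp : p ≤ 2) (hq : 1 ≤ q)
    {g : ℕ → Distr n d} {u v : Distr n d} {η : ℝ≥0∞}
    (hlim : ∀ z, Tendsto (fun k => coeff (g k) z) atTop (𝓝 (coeff u z)))
    (h : ∀ᶠ k in atTop, besovNorm 0 p (.ofReal q) (v - g k) ≤ η) :
    besovNorm 0 p (.ofReal q) (v - u) ≤ η := by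
  have hq0 : 0 < q := by linarith
  have hz : ∀ w : Distr n d, besovNorm 0 p (.ofReal q) w =
      lqNorm (.ofReal q) fun j => eLpNorm (lpBlock w j) p (torusMeasure d) := fun w => by
    unfold besovNorm; simp
  rw [hz]
  refine le_of_tendsto' (tendsto_lqNorm_finset hq0 _) fun s => ?_
  have hblock : ∀ j, Tendsto (fun k => eLpNorm (lpBlock (g k - u) j) p (torusMeasure d)) atTop
      (𝓝 0) := fun j => by
    have h1 : ∀ z, Tendsto (fun k => ‖coeff (g k - u) z‖ ^ 2) atTop (𝓝 0) := fun z => by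
      have := ((hlim z).sub_const (coeff u z)).norm.pow 2
      simpa only [sub_self, norm_zero, zero_pow two_ne_zero, ← coeff_sub] using! this
    have h2 := ENNReal.tendsto_ofReal (tendsto_finsetSum (dyadicBlock d j) fun z _ => h1 z)
    simp only [← eLpNorm_lpBlock_two, Finset.sum_const_zero, ENNReal.ofReal_zero] at h2
    have h3 := ((ENNReal.continuous_rpow_const (y := 1 / 2)).tendsto _).comp h2
    rw [ENNReal.zero_rpow_of_pos (by norm_num)] at h3
    refine tendsto_of_tendsto_of_tendsto_of_le_of_le tendsto_const_nhds h3 (fun k => zero_le)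
      fun k => ?_
    rw [Function.comp_apply, ← ENNReal.rpow_two, ← ENNReal.rpow_mul]
    norm_num
    exact eLpNorm_le_eLpNorm_of_exponent_le hp (aestronglyMeasurable_lpBlock _ j)
  have hrem : Tendsto (fun k => η + (∑ j ∈ s,
      eLpNorm (lpBlock (g k - u) j) p (torusMeasure d) ^ q) ^ q⁻¹) atTop (𝓝 η) := by
    have h1 : Tendsto (fun k => ∑ j ∈ s, eLpNorm (lpBlock (g k - u) j) p (torusMeasure d) ^ q)
        atTop (𝓝 0) := by
      have := tendsto_finsetSum s fun j _ =>
        ((ENNReal.continuous_rpow_const (y := q)).tendsto _).comp (hblock j)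
      simpa only [ENNReal.zero_rpow_of_pos hq0, Finset.sum_const_zero] using! this
    have h2 := ((ENNReal.continuous_rpow_const (y := q⁻¹)).tendsto _).comp h1
    rw [ENNReal.zero_rpow_of_pos (by positivity)] at h2
    simpa using (tendsto_const_nhds (x := η)).add h2
  refine ge_of_tendsto hrem (h.mono fun k hk => ?_)
  have h1 : ∀ j, eLpNorm (lpBlock (v - u) j) p (torusMeasure d) ≤
      eLpNorm (lpBlock (v - g k) j) p (torusMeasure d) +
        eLpNorm (lpBlock (g k - u) j) p (torusMeasure d) := fun j => by
    rw [show v - u = (v - g k) + (g k - u) by abel, lpBlock_add]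
    exact eLpNorm_add_le (aestronglyMeasurable_lpBlock _ _) (aestronglyMeasurable_lpBlock _ _) hp1
  have h2 : (∑ j ∈ s, eLpNorm (lpBlock (v - g k) j) p (torusMeasure d) ^ q) ^ q⁻¹ ≤ η := by
    refine le_trans ?_ hk
    rw [hz, lqNorm_ofReal hq0.le]
    exact ENNReal.rpow_le_rpow (ENNReal.sum_le_tsum s) (by positivity)
  refine le_trans (ENNReal.rpow_le_rpow (Finset.sum_le_sum fun j _ =>
    ENNReal.rpow_le_rpow (h1 j) hq0.le) (by positivity)) ?_
  have h3 := ENNReal.Lp_add_le s (fun j => eLpNorm (lpBlock (v - g k) j) p (torusMeasure d))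
    (fun j => eLpNorm (lpBlock (g k - u) j) p (torusMeasure d)) hq
  rw [one_div] at h3
  exact h3.trans (add_le_add h2 le_rfl)

end Convergence

end TorusBesov

end

noncomputable section

namespace TorusBesov

/-! ### Embeddings expressed through the wavelet norm -/

section Embeddings

variable {d σ : ℕ} {p q a s L : ℝ} {ι : ℕ → Type*} {φ : ∀ j, ι j → CkFun σ d}

theorem waveletBlock_le_waveletNorm (hp : 1 < p) (hq : 1 ≤ q) (u : Distr σ d) (j : ℕ) :
    waveletBlock φ p u j ≤ waveletNorm φ 0 (.ofReal p) (.ofReal q) u := by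
  rw [waveletNorm_zero_eq (by linarith)]
  exact le_lqNorm (by simpa using hq) _ j

theorem exists_besovNorm_equiv (hφ : IsWaveletSystem φ) (hp : 1 < p) (hq : 1 ≤ q) (hσ : 0 < σ) :
    ∃ A : ℝ, 0 < A ∧ ∀ u : Distr σ d,
      besovNorm 0 (.ofReal p) (.ofReal q) u ≤
        .ofReal A * waveletNorm φ 0 (.ofReal p) (.ofReal q) u ∧
      waveletNorm φ 0 (.ofReal p) (.ofReal q) u ≤
        .ofReal A * besovNorm 0 (.ofReal p) (.ofReal q) u := by
  obtain ⟨A, hA, h⟩ := hφ.norm_equiv (.ofReal p) (.ofReal q) (by simpa using hp)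
    ENNReal.ofReal_lt_top (by simpa using hq) 0 (by simpa using hσ)
  exact ⟨A, hA, fun u => by simpa using h u⟩

theorem exists_besovNorm_two_top_le (hφ : IsWaveletSystem φ) (hp : 1 < p) (hp2 : p ≤ 2)
    (hq : 1 ≤ q) (hσ : (d : ℝ) / 2 < σ) :
    ∃ A : ℝ, 0 < A ∧ ∀ u : Distr σ d, besovNorm (-(d * (p⁻¹ - 1 / 2))) 2 ∞ u ≤
      .ofReal A * waveletNorm φ 0 (.ofReal p) (.ofReal q) u := by
  have hp1 : p⁻¹ ≤ 1 := inv_le_one_of_one_le₀ hp.le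
  have hp3 : 1 / 2 ≤ p⁻¹ := by rw [one_div]; exact inv_anti₀ (by linarith) hp2
  have hd0 : (0 : ℝ) ≤ d := Nat.cast_nonneg d
  obtain ⟨A, hA, h⟩ := hφ.norm_equiv 2 ∞ (by norm_num) (by simp) (by simp)
    (-(d * (p⁻¹ - 1 / 2))) (by
      rw [abs_neg, abs_of_nonneg (mul_nonneg hd0 (by linarith))]
      nlinarith)
  refine ⟨A, hA, fun u => ((h u).1).trans ?_⟩
  rw [ENNReal.ofReal_coe_nnreal]
  refine mul_le_mul_right ?_ _
  have h2 : (2 : ℝ≥0∞) = .ofReal 2 := by simp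
  nth_rw 1 [h2]
  rw [waveletNorm_eq (by norm_num), lqNorm_top]
  refine iSup_le fun j => le_trans ?_ (waveletBlock_le_waveletNorm hp hq u j)
  unfold waveletBlock
  rw [← mul_assoc, ← ENNReal.rpow_add _ _ two_ne_zero (by simp), ← h2]
  have e : (j : ℝ) * -(d * (p⁻¹ - 1 / 2)) + j * d * (1 / 2 - 2⁻¹) = j * d * (1 / 2 - p⁻¹) := by
    ring
  rw [e]
  exact mul_le_mul_right (lqNorm_two_le hp.le hp2 _) _

theorem exists_besovNorm_neg_le (hφ : IsWaveletSystem φ) (hp : 1 < p) (hp2 : p ≤ 2) (hq : 1 ≤ q)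
    (ha : (d : ℝ) / 2 < a) (hσ : a < σ) :
    ∃ A : ℝ, 0 < A ∧ ∀ u : Distr σ d, besovNorm (-a) 2 2 u ≤
      .ofReal A * waveletNorm φ 0 (.ofReal p) (.ofReal q) u := by
  obtain ⟨A, hA, h⟩ := exists_besovNorm_two_top_le hφ hp hp2 hq (ha.trans hσ)
  have hp1 : p⁻¹ ≤ 1 := inv_le_one_of_one_le₀ hp.le
  have hd0 : (0 : ℝ) ≤ d := Nat.cast_nonneg d
  obtain ⟨C, hC, h'⟩ := exists_besovNorm_two_two_le (a := a) (b := d * (p⁻¹ - 1 / 2)) (by nlinarith)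
  refine ⟨C * A, mul_pos hC hA, fun u => (h' _ _ u).trans ?_⟩
  rw [ENNReal.ofReal_mul hC.le, mul_assoc]
  exact mul_le_mul_right (h u) _

theorem exists_waveletBlock_le_besovNorm_neg (hφ : IsWaveletSystem φ) (hp : 1 < p) (hp2 : p ≤ 2)
    (ha : 0 < a) (hσ : a < σ) :
    ∃ A : ℝ, 0 < A ∧ ∀ (u : Distr σ d) (j : ℕ), (2 : ℝ≥0∞) ^ ((j : ℝ) * -a) * waveletBlock φ p u j ≤
      .ofReal A * besovNorm (-a) 2 2 u := by
  obtain ⟨A, hA, h⟩ := hφ.norm_equiv (.ofReal p) 2 (by simpa using hp) ENNReal.ofReal_lt_top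
    (by norm_num) (-a) (by rwa [abs_neg, abs_of_pos ha])
  refine ⟨A, hA, fun u j => ?_⟩
  rw [ENNReal.ofReal_coe_nnreal]
  have h1 := (h u).2
  rw [waveletNorm_eq (by linarith)] at h1
  refine (le_lqNorm (q := 2) (by norm_num) (fun j : ℕ => (2 : ℝ≥0∞) ^ ((j : ℝ) * -a) *
    waveletBlock φ p u j) j).trans (h1.trans (mul_le_mul_right (lqNorm_mono fun k => ?_) _))
  refine mul_le_mul_right (eLpNorm_le_eLpNorm_of_exponent_le ?_ (aestronglyMeasurable_lpBlock _ _)) _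
  simpa using hp2

theorem exists_waveletBlock_le_of_smooth (hφ : IsWaveletSystem φ) (hp : 1 < p) (hs : 0 < s)
    (hσ : s < σ) :
    ∃ A : ℝ, 0 < A ∧ ∀ (u : Distr σ d) (j : ℕ), (2 : ℝ≥0∞) ^ ((j : ℝ) * s) * waveletBlock φ p u j ≤
      .ofReal A * besovNorm s (.ofReal p) ∞ u := by
  obtain ⟨A, hA, h⟩ := hφ.norm_equiv (.ofReal p) ∞ (by simpa using hp) ENNReal.ofReal_lt_top
    (by simp) s (by rwa [abs_of_pos hs])
  refine ⟨A, hA, fun u j => ?_⟩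
  rw [ENNReal.ofReal_coe_nnreal]
  have h1 := (h u).2
  rw [waveletNorm_eq (by linarith)] at h1
  exact (le_lqNorm (q := ∞) (by simp) (fun j : ℕ => (2 : ℝ≥0∞) ^ ((j : ℝ) * s) *
    waveletBlock φ p u j) j).trans h1

/-- The source condition: the subgradient of the penalty at a function in `B^s_{p,∞}` tested
against `w`. -/
theorem exists_source_bound (hφ : IsWaveletSystem φ) (hp : 1 < p) (hp2 : p ≤ 2) (hq : 2 ≤ q)
    (ha : 0 < a) (hs : 0 < s) (hsa : s < a / (q - 1)) (hL : 0 < L) (hσ : a < σ) :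
    ∃ C : ℝ, 0 < C ∧ ∀ (u w : Distr σ d) (ρ x y : ℝ), 0 < ρ → 0 ≤ x → 0 ≤ y →
      besovNorm s (.ofReal p) ∞ u ≤ .ofReal ρ →
      waveletNorm φ 0 (.ofReal p) (.ofReal q) w ≤ .ofReal x →
      besovNorm (-a) 2 2 w ≤ .ofReal (L * y) →
      ∑' j, waveletBlock φ p u j ^ (q - 1) * waveletBlock φ p w j ≤
        .ofReal (C * ρ ^ (q - 1) * (y ^ (s * (q - 1) / a) * x ^ (1 - s * (q - 1) / a))) := by
  have hq1 : 0 < q - 1 := by linarith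
  have hsqa : s * (q - 1) < a := by rwa [lt_div_iff₀ hq1] at hsa
  have hsσ : s < σ := by nlinarith
  obtain ⟨A₁, hA₁, h₁⟩ := exists_waveletBlock_le_of_smooth hφ hp hs hsσ
  obtain ⟨A₂, hA₂, h₂⟩ := exists_waveletBlock_le_besovNorm_neg hφ hp hp2 ha hσ
  obtain ⟨C, hC, hint⟩ := exists_tsum_interpolation (a := a) (b := a - s * (q - 1)) (by linarith)
    (by nlinarith)
  set θ := s * (q - 1) / a with hθ
  have hθ1 : 1 - (a - s * (q - 1)) / a = θ := by rw [hθ]; field_simp; ring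
  have hθ2 : (a - s * (q - 1)) / a = 1 - θ := by rw [hθ]; field_simp
  refine ⟨A₁ ^ (q - 1) * (C * (A₂ * L) ^ θ), by positivity, fun u w ρ x y hρ hx hy hu hw hwa => ?_⟩
  have hG := hint (fun j => (2 : ℝ≥0∞) ^ ((j : ℝ) * -a) * waveletBlock φ p w j) (A₂ * (L * y)) x
    (by positivity) hx (fun j => by
      refine (h₂ w j).trans ?_
      rw [ENNReal.ofReal_mul hA₂.le]
      exact mul_le_mul_right hwa _) (fun j => by
      rw [← mul_assoc, mul_neg, two_rpow_mul_neg, one_mul]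
      exact (waveletBlock_le_waveletNorm hp (by linarith) w j).trans hw)
  rw [hθ1, hθ2] at hG
  have hub : ∀ j : ℕ, waveletBlock φ p u j ≤ .ofReal (A₁ * ρ) * (2 : ℝ≥0∞) ^ (-((j : ℝ) * s)) :=
    fun j => by
      have h := (h₁ u j).trans (mul_le_mul_right hu _)
      rw [← ENNReal.ofReal_mul hA₁.le] at h
      calc waveletBlock φ p u j = (2 : ℝ≥0∞) ^ ((j : ℝ) * s) * waveletBlock φ p u j *
            (2 : ℝ≥0∞) ^ (-((j : ℝ) * s)) := by
            rw [mul_right_comm, two_rpow_mul_neg, one_mul]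
        _ ≤ _ := mul_le_mul_left h _
  calc ∑' j, waveletBlock φ p u j ^ (q - 1) * waveletBlock φ p w j
      ≤ ∑' j : ℕ, ENNReal.ofReal ((A₁ * ρ) ^ (q - 1)) * ((2 : ℝ≥0∞) ^ ((j : ℝ) * (a - s * (q - 1))) *
        ((2 : ℝ≥0∞) ^ ((j : ℝ) * -a) * waveletBlock φ p w j)) := by
        refine ENNReal.tsum_le_tsum fun j => ?_
        have h := ENNReal.rpow_le_rpow (hub j) hq1.le
        rw [ENNReal.mul_rpow_of_nonneg _ _ hq1.le, ENNReal.ofReal_rpow_of_nonneg (by positivity)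
          hq1.le, ← ENNReal.rpow_mul] at h
        refine (mul_le_mul_left h _).trans_eq ?_
        rw [mul_assoc, ← mul_assoc ((2 : ℝ≥0∞) ^ ((j : ℝ) * (a - s * (q - 1)))),
          ← ENNReal.rpow_add _ _ two_ne_zero (by simp)]
        congr 3; ring
    _ ≤ ENNReal.ofReal ((A₁ * ρ) ^ (q - 1)) *
        .ofReal (C * ((A₂ * (L * y)) ^ θ * x ^ (1 - θ))) := by
        rw [ENNReal.tsum_mul_left]; exact mul_le_mul_right hG _
    _ = _ := by
        rw [← ENNReal.ofReal_mul (by positivity)]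
        congr 1
        rw [← mul_assoc A₂, Real.mul_rpow (by positivity) hy, Real.mul_rpow hA₁.le hρ.le]
        ring

theorem exists_image_bound (hφ : IsWaveletSystem φ) (hd : 0 < d) (hp : 1 < p) (hp2 : p ≤ 2)
    (hq : 2 ≤ q) (ha : (d : ℝ) / 2 < a) (hL : 0 < L) (hσ : a < σ) :
    ∃ C : ℝ, 0 < C ∧ ∀ (D : Set (Distr σ d)) (F : Distr σ d → L2 d), IsSmoothing p q a L D F →
      ∀ f₁ ∈ D, ∀ f₂ ∈ D, ∀ x : ℝ, 0 ≤ x →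
      waveletNorm φ 0 (.ofReal p) (.ofReal q) (f₁ - f₂) ≤ .ofReal x →
      besovNorm ((d : ℝ) / 2) (.ofReal p) 1 (ofL2 ⊤ (F f₁ - F f₂)) ≤
        .ofReal (C * (‖F f₁ - F f₂‖ ^ (1 - (d : ℝ) / (2 * a)) * x ^ ((d : ℝ) / (2 * a)))) := by
  have hd0 : (0 : ℝ) < d := by exact_mod_cast hd
  have ha0 : 0 < a := by linarith
  have hσ0 : 0 < σ := by exact_mod_cast ha0.trans hσ
  obtain ⟨A, hA, h₁⟩ := exists_besovNorm_equiv hφ hp (by linarith : 1 ≤ q) hσ0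
  obtain ⟨C, hC, hint⟩ := exists_tsum_interpolation (a := a) (b := (d : ℝ) / 2) (by positivity) ha
  have hδ : (d : ℝ) / 2 / a = d / (2 * a) := by field_simp
  rw [hδ] at hint
  refine ⟨C * (L * A) ^ ((d : ℝ) / (2 * a)), by positivity, fun D F hF f₁ hf₁ f₂ hf₂ x hx hw => ?_⟩
  have h := hint (fun j => eLpNorm (lpBlock (ofL2 ⊤ (F f₁ - F f₂)) j) (.ofReal p) (torusMeasure d))
    ‖F f₁ - F f₂‖ (L * A * x) (norm_nonneg _) (by positivity)
    (fun j => eLpNorm_lpBlock_ofL2_le (by simpa using hp2) _ j) (fun j => by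
      refine (le_lqNorm (q := .ofReal q) (by simpa using by linarith : (1 : ℝ≥0∞) ≤ .ofReal q)
        (fun j : ℕ => (2 : ℝ≥0∞) ^ ((j : ℝ) * a) * eLpNorm (lpBlock (ofL2 ⊤ (F f₁ - F f₂)) j)
          (.ofReal p) (torusMeasure d)) j).trans ?_
      have e := besovNorm_congr (u := ofL2 ⊤ (F f₁ - F f₂)) (v := ofL2 σ (F f₁ - F f₂))
        (fun z => coeff_ofL2_eq _ z) a (.ofReal p) (.ofReal q)
      change besovNorm a (.ofReal p) (.ofReal q) (ofL2 ⊤ (F f₁ - F f₂)) ≤ _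
      rw [e]
      refine (hF.lipschitz_besov f₁ hf₁ f₂ hf₂).trans ?_
      rw [mul_assoc, ENNReal.ofReal_mul hL.le, ENNReal.ofReal_mul hA.le]
      exact mul_le_mul_right ((h₁ _).1.trans (mul_le_mul_right hw _)) _)
  unfold besovNorm
  rw [lqNorm_one]
  refine h.trans_eq ?_
  rw [Real.mul_rpow (by positivity) hx]
  congr 1; ring

end Embeddings

/-! ### The Tikhonov functional -/

section Tikhonov

variable {d σ : ℕ} {p q a s L : ℝ} {ι : ℕ → Type*} {φ : ∀ j, ι j → CkFun σ d}
  {D : Set (Distr σ d)} {F : Distr σ d → L2 d}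

theorem holderTriple_conj (hp : 1 < p) :
    ENNReal.HolderTriple (.ofReal (p / (p - 1))) (.ofReal p) 1 :=
  ((Real.HolderConjugate.conjExponent hp).symm).ennrealOfReal

theorem penalty_eq (hp2 : p ≤ 2) (hq : 2 ≤ q) (f : Distr σ d) : penalty φ p q f =
    1 / q * (waveletNorm φ 0 (.ofReal p) (.ofReal q) f).toReal ^ q := by
  unfold penalty
  rw [max_eq_right (hp2.trans hq), max_eq_right hq]

theorem waveletNorm_lt_top (hφ : IsWaveletSystem φ) (hp : 1 < p) (hq : 1 ≤ q) (hσ : 0 < σ)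
    (hD : IsClosedConvexIn p q D) {f : Distr σ d} (hf : f ∈ D) :
    waveletNorm φ 0 (.ofReal p) (.ofReal q) f < ∞ := by
  obtain ⟨A, _, h⟩ := exists_besovNorm_equiv hφ hp hq hσ
  exact (h f).2.trans_lt (ENNReal.mul_lt_top ENNReal.ofReal_lt_top (hD.finite f hf))

theorem waveletNorm_sub_lt_top (hφ : IsWaveletSystem φ) (hp : 1 < p) (hq : 1 ≤ q) (hσ : 0 < σ)
    (hD : IsClosedConvexIn p q D) {f g : Distr σ d} (hf : f ∈ D) (hg : g ∈ D) :
    waveletNorm φ 0 (.ofReal p) (.ofReal q) (f - g) < ∞ :=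
  (waveletNorm_sub_le hp.le (by simpa using hq) 0 f g).trans_lt (ENNReal.add_lt_top.2
    ⟨waveletNorm_lt_top hφ hp hq hσ hD hf, waveletNorm_lt_top hφ hp hq hσ hD hg⟩)

theorem besovNorm_ofL2_top_lt (hF : IsSmoothing p q a L D F) {f : Distr σ d} (hf : f ∈ D) :
    besovNorm ((d : ℝ) / 2) (.ofReal p) 1 (ofL2 ⊤ (F f)) < ∞ := by
  rw [besovNorm_congr (v := ofL2 σ (F f)) fun z => coeff_ofL2_eq _ z]
  exact hF.range_subset f hf

theorem tikhonov_sub_eq (hp : 1 < p) (hF : IsSmoothing p q a L D F) {f g fdag : Distr σ d}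
    (hf : f ∈ D) (hg : g ∈ D) {Z : Distr ⊤ d} {ε α : ℝ}
    (hZ : besovNorm (-((d : ℝ) / 2)) (.ofReal (p / (p - 1))) ∞ Z < ∞) :
    tikhonov φ p q F (ofL2 ⊤ (F fdag) + ε • Z) α f - tikhonov φ p q F (ofL2 ⊤ (F fdag) + ε • Z) α g =
      1 / 2 * ‖F f - F fdag‖ ^ 2 - 1 / 2 * ‖F g - F fdag‖ ^ 2 -
        ε * pairing Z (ofL2 ⊤ (F f - F g)) + α * (penalty φ p q f - penalty φ p q g) := by
  have := holderTriple_conj hp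
  have hf' := besovNorm_ofL2_top_lt hF hf
  have hg' := besovNorm_ofL2_top_lt hF hg
  unfold tikhonov
  rw [pairing_data (F fdag) (F f) ε hZ hf', pairing_data (F fdag) (F g) ε hZ hg', ofL2_sub,
    pairing_sub_right hZ hf' hg', norm_sub_sq_real, norm_sub_sq_real, real_inner_comm (F f),
    real_inner_comm (F g)]
  ring

theorem exists_pairing_bound (hφ : IsWaveletSystem φ) (hd : 0 < d) (hp : 1 < p) (hp2 : p ≤ 2)
    (hq : 2 ≤ q) (ha : (d : ℝ) / 2 < a) (hL : 0 < L) (hσ : a < σ) :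
    ∃ C : ℝ, 0 < C ∧ ∀ (D : Set (Distr σ d)) (F : Distr σ d → L2 d), IsClosedConvexIn p q D →
      IsSmoothing p q a L D F → ∀ f₁ ∈ D, ∀ f₂ ∈ D, ∀ (Z : Distr ⊤ d) (ζ : ℝ), 0 ≤ ζ →
      besovNorm (-((d : ℝ) / 2)) (.ofReal (p / (p - 1))) ∞ Z ≤ .ofReal ζ →
      |pairing Z (ofL2 ⊤ (F f₁ - F f₂))| ≤ C * ζ * (‖F f₁ - F f₂‖ ^ (1 - (d : ℝ) / (2 * a)) *
        (waveletNorm φ 0 (.ofReal p) (.ofReal q) (f₁ - f₂)).toReal ^ ((d : ℝ) / (2 * a))) := by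
  have := holderTriple_conj hp
  obtain ⟨C, hC, h⟩ := exists_image_bound hφ hd hp hp2 hq ha hL hσ
  have ha0 : 0 < a := lt_of_le_of_lt (by positivity) ha
  have hσ0 : 0 < σ := by exact_mod_cast ha0.trans hσ
  refine ⟨C, hC, fun D F hD hF f₁ hf₁ f₂ hf₂ Z ζ hζ hZ => ?_⟩
  have hfin := waveletNorm_sub_lt_top hφ hp (by linarith : 1 ≤ q) hσ0 hD hf₁ hf₂
  have h1 := enorm_pairing_le (p := .ofReal (p / (p - 1))) (q := .ofReal p) ((d : ℝ) / 2) Z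
    (ofL2 ⊤ (F f₁ - F f₂))
  have h2 := h1.trans (mul_le_mul' hZ (h D F hF f₁ hf₁ f₂ hf₂ _ ENNReal.toReal_nonneg
    (ENNReal.ofReal_toReal hfin.ne).ge))
  rw [← ENNReal.ofReal_mul hζ, ← ofReal_norm, ENNReal.ofReal_le_ofReal_iff (by positivity),
    Real.norm_eq_abs] at h2
  exact h2.trans_eq (by ring)

theorem waveletNorm_bregman (hp : 1 < p) (hp2 : p ≤ 2) (hq : 2 ≤ q)
    {u v : Distr σ d} (hu : waveletNorm φ 0 (.ofReal p) (.ofReal q) u < ∞)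
    (hv : waveletNorm φ 0 (.ofReal p) (.ofReal q) v < ∞) :
    waveletNorm φ 0 (.ofReal p) (.ofReal q) u ^ q +
        .ofReal (2 * convexityConst p q * (1 / 2) ^ q) *
          waveletNorm φ 0 (.ofReal p) (.ofReal q) (u - v) ^ q ≤
      waveletNorm φ 0 (.ofReal p) (.ofReal q) v ^ q +
        .ofReal q * ∑' j, waveletBlock φ p u j ^ (q - 1) * waveletBlock φ p (u - v) j := by
  have hq1 : 1 ≤ q := by linarith
  have hub := fun j => ((waveletBlock_le_waveletNorm (φ := φ) hp hq1 u j).trans_lt hu).ne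
  have hvb := fun j => ((waveletBlock_le_waveletNorm (φ := φ) hp hq1 v j).trans_lt hv).ne
  simp only [waveletNorm_zero_eq (show 0 ≤ p by linarith), lqNorm_ofReal_rpow (show 0 < q by linarith)]
  rw [← ENNReal.tsum_mul_left, ← ENNReal.tsum_mul_left, ← ENNReal.tsum_add, ← ENNReal.tsum_add]
  exact ENNReal.tsum_le_tsum fun j => waveletBlock_bregman hp hp2 hq u v j (hub j) (hvb j)

/-- The basic estimate for every `f` at which the Tikhonov functional is not larger than at the
exact solution. -/
theorem exists_basic_estimate (hφ : IsWaveletSystem φ) (hd : 0 < d) (hp : 1 < p) (hp2 : p ≤ 2)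
    (hq : 2 ≤ q) (ha : (d : ℝ) / 2 < a) (hs : 0 < s) (hsa : s < a / (q - 1)) (hL : 0 < L)
    (hσ : a < σ) :
    ∃ c C₁ C₂ : ℝ, 0 < c ∧ 0 < C₁ ∧ 0 < C₂ ∧ ∀ (D : Set (Distr σ d)) (F : Distr σ d → L2 d),
      IsClosedConvexIn p q D → IsSmoothing p q a L D F → ∀ fdag ∈ D, ∀ ρ ε α : ℝ, 0 < ρ → 0 < ε →
      0 < α → besovNorm s (.ofReal p) ∞ fdag ≤ .ofReal ρ → ∀ (Z : Distr ⊤ d) (ζ : ℝ), 0 ≤ ζ →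
      besovNorm (-((d : ℝ) / 2)) (.ofReal (p / (p - 1))) ∞ Z ≤ .ofReal ζ → ∀ f ∈ D,
      tikhonov φ p q F (ofL2 ⊤ (F fdag) + ε • Z) α f ≤
        tikhonov φ p q F (ofL2 ⊤ (F fdag) + ε • Z) α fdag →
      ∃ y : ℝ, 0 ≤ y ∧
      1 / 2 * y ^ 2 + α * c * (waveletNorm φ 0 (.ofReal p) (.ofReal q) (f - fdag)).toReal ^ q ≤
        α * (C₁ * ρ ^ (q - 1) * (y ^ (s * (q - 1) / a) *
          (waveletNorm φ 0 (.ofReal p) (.ofReal q) (f - fdag)).toReal ^ (1 - s * (q - 1) / a))) +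
        ε * (C₂ * ζ * (y ^ (1 - (d : ℝ) / (2 * a)) *
          (waveletNorm φ 0 (.ofReal p) (.ofReal q) (f - fdag)).toReal ^ ((d : ℝ) / (2 * a)))) := by
  have ha0 : 0 < a := lt_of_le_of_lt (by positivity) ha
  have hσ0 : 0 < σ := by exact_mod_cast ha0.trans hσ
  have hq0 : 0 < q := by linarith
  have hq1 : 1 ≤ q := by linarith
  obtain ⟨C₁, hC₁, hsrc⟩ := exists_source_bound hφ hp hp2 hq ha0 hs hsa hL hσ
  obtain ⟨C₂, hC₂, hnoise⟩ := exists_pairing_bound hφ hd hp hp2 hq ha hL hσ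
  set c₀ := 2 * convexityConst p q * (1 / 2) ^ q with hc₀
  have hcc := convexityConst_pos (q := q) hp
  have hc₀0 : 0 < c₀ := by positivity
  refine ⟨c₀ / q, C₁, C₂, by positivity, hC₁, hC₂,
    fun D F hD hF fdag hfdag ρ ε α hρ hε hα hsm Z ζ hζ hZ f hf hT => ?_⟩
  refine ⟨‖F f - F fdag‖, norm_nonneg _, ?_⟩
  set y := ‖F f - F fdag‖ with hy
  set W := fun u : Distr σ d => waveletNorm φ 0 (.ofReal p) (.ofReal q) u with hW
  have hy0 : 0 ≤ y := norm_nonneg _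
  have hWf := waveletNorm_lt_top hφ hp hq1 hσ0 hD hf
  have hWd := waveletNorm_lt_top hφ hp hq1 hσ0 hD hfdag
  have hWs := waveletNorm_sub_lt_top hφ hp hq1 hσ0 hD hf hfdag
  have hWs' := waveletNorm_sub_lt_top hφ hp hq1 hσ0 hD hfdag hf
  have hcomm : W (fdag - f) = W (f - fdag) := waveletNorm_sub_comm hp.le (by simpa using hq1) 0 _ _
  set x := (W (f - fdag)).toReal with hx
  have hx0 : 0 ≤ x := ENNReal.toReal_nonneg
  have hWx : W (fdag - f) = .ofReal x := by rw [hcomm, hx, ENNReal.ofReal_toReal hWs.ne]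
  have hinv : besovNorm (-a) 2 2 (fdag - f) ≤ .ofReal (L * y) := by
    refine (hF.inverse_lipschitz fdag hfdag f hf).trans_eq ?_
    rw [← ofReal_norm, norm_sub_rev, ENNReal.ofReal_mul hL.le]
  have h1 := hsrc fdag (fdag - f) ρ x y hρ hx0 hy0 hsm hWx.le hinv
  have h2 := (waveletNorm_bregman hp hp2 hq hWd hWf).trans
    (add_le_add_right (mul_le_mul_right h1 _) _)
  set S := C₁ * ρ ^ (q - 1) * (y ^ (s * (q - 1) / a) * x ^ (1 - s * (q - 1) / a)) with hS
  have hS0 : 0 ≤ S := by positivity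
  have hWfr : W f = .ofReal (W f).toReal := (ENNReal.ofReal_toReal hWf.ne).symm
  have hWdr : W fdag = .ofReal (W fdag).toReal := (ENNReal.ofReal_toReal hWd.ne).symm
  change W fdag ^ q + .ofReal c₀ * W (fdag - f) ^ q ≤ W f ^ q + _ at h2
  rw [hWfr, hWdr, hWx, ENNReal.ofReal_rpow_of_nonneg ENNReal.toReal_nonneg hq0.le,
    ENNReal.ofReal_rpow_of_nonneg ENNReal.toReal_nonneg hq0.le,
    ENNReal.ofReal_rpow_of_nonneg ENNReal.toReal_nonneg hq0.le, ← ENNReal.ofReal_mul hc₀0.le,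
    ← ENNReal.ofReal_mul hq0.le, ← ENNReal.ofReal_add (by positivity) (by positivity),
    ← ENNReal.ofReal_add (by positivity) (by positivity),
    ENNReal.ofReal_le_ofReal_iff (by positivity)] at h2
  have hTd := tikhonov_sub_eq (φ := φ) (fdag := fdag) (ε := ε) (α := α) hp hF hf hfdag
    (hZ.trans_lt ENNReal.ofReal_lt_top)
  rw [penalty_eq hp2 hq, penalty_eq hp2 hq, sub_self, norm_zero] at hTd
  have h3 := (abs_le.1 (hnoise D F hD hF f hf fdag hfdag Z ζ hζ hZ)).2
  change _ ≤ C₂ * ζ * (y ^ (1 - (d : ℝ) / (2 * a)) * x ^ ((d : ℝ) / (2 * a))) at h3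
  set N := C₂ * ζ * (y ^ (1 - (d : ℝ) / (2 * a)) * x ^ ((d : ℝ) / (2 * a)))
  have h4 := mul_le_mul_of_nonneg_left h3 hε.le
  have h5 : α * (1 / q * (W fdag).toReal ^ q) + α * (c₀ / q) * x ^ q ≤
      α * (1 / q * (W f).toReal ^ q) + α * S := by
    have := mul_le_mul_of_nonneg_left h2 (show 0 ≤ α / q by positivity)
    have e1 : α / q * ((W fdag).toReal ^ q + c₀ * x ^ q) =
      α * (1 / q * (W fdag).toReal ^ q) + α * (c₀ / q) * x ^ q := by field_simp
    have e2 : α / q * ((W f).toReal ^ q + q * S) =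
      α * (1 / q * (W f).toReal ^ q) + α * S := by field_simp
    rw [e1, e2] at this
    exact this
  have h6 : 1 / 2 * y ^ 2 - 1 / 2 * (0 : ℝ) ^ 2 - ε * pairing Z (ofL2 ⊤ (F f - F fdag)) +
      α * (1 / q * (W f).toReal ^ q - 1 / q * (W fdag).toReal ^ q) ≤ 0 := by
    rw [← hTd]; linarith
  linarith

end Tikhonov

end TorusBesov

end

noncomputable section

namespace TorusBesov

open scoped ComplexConjugate

/-! ### Existence of minimizers -/

section Existence

variable {d σ : ℕ} {p q a s L : ℝ} {ι : ℕ → Type*} {φ : ∀ j, ι j → CkFun σ d}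
  {D : Set (Distr σ d)} {F : Distr σ d → L2 d}

/-- A sequence bounded in `B^{-b}_{2,∞}` has a subsequence whose Fourier coefficients converge to
those of a distribution. -/
theorem exists_subseq_tendsto_coeff {b C : ℝ} (hb : b < σ) (hC : 0 ≤ C) (f : ℕ → Distr σ d)
    (hf : ∀ k j, ∑ z ∈ dyadicBlock d j, ‖coeff (f k) z‖ ^ 2 ≤ (C * (2 : ℝ) ^ ((j : ℝ) * b)) ^ 2) :
    ∃ (u : Distr σ d) (k : ℕ → ℕ), StrictMono k ∧
      ∀ z, Tendsto (fun n => coeff (f (k n)) z) atTop (𝓝 (coeff u z)) := by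
  obtain ⟨lev, hlev⟩ := exists_dyadicLevel d
  set r : (Fin d → ℤ) → ℝ := fun z => C * (2 : ℝ) ^ ((lev z : ℝ) * b) with hr
  have hmem : ∀ k, coeff (f k) ∈ Set.pi univ fun z => Metric.closedBall (0 : ℂ) (r z) := by
    intro k z _
    rw [mem_closedBall_zero_iff]
    refine (pow_le_pow_iff_left₀ (norm_nonneg _) (by positivity) two_ne_zero).1 ?_
    exact (Finset.single_le_sum (f := fun z => ‖coeff (f k) z‖ ^ 2) (fun _ _ => by positivity)
      ((hlev (lev z) z).2 rfl)).trans (hf k (lev z))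
  obtain ⟨c, _, k, hk, hlim⟩ := (isCompact_univ_pi fun z : Fin d → ℤ =>
    isCompact_closedBall (0 : ℂ) (r z)).tendsto_subseq hmem
  have hpt : ∀ z, Tendsto (fun n => coeff (f (k n)) z) atTop (𝓝 (c z)) := fun z =>
    (tendsto_pi_nhds.1 hlim) z
  obtain ⟨u, hu⟩ := exists_distr_of_coeff hb hC c (fun z => by
      refine tendsto_nhds_unique (hpt (-z)) ?_
      simp only [coeff_neg]
      exact (Complex.continuous_conj.tendsto _).comp (hpt z))
    (fun j => le_of_tendsto' (tendsto_finsetSum _ fun z _ => ((hpt z).norm.pow 2)) fun n =>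
      hf (k n) j)
  exact ⟨u, k, hk, fun z => by rw [hu]; exact hpt z⟩

theorem waveletNorm_uniformConvex_toReal (hφ : IsWaveletSystem φ) (hp : 1 < p) (hp2 : p ≤ 2)
    (hq : 2 ≤ q) (hσ : 0 < σ) (hD : IsClosedConvexIn p q D) {f g : Distr σ d} (hf : f ∈ D)
    (hg : g ∈ D) :
    (waveletNorm φ 0 (.ofReal p) (.ofReal q) ((1 / 2 : ℝ) • (f + g))).toReal ^ q +
        convexityConst p q *
          (waveletNorm φ 0 (.ofReal p) (.ofReal q) ((1 / 2 : ℝ) • (f - g))).toReal ^ q ≤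
      ((waveletNorm φ 0 (.ofReal p) (.ofReal q) f).toReal ^ q +
        (waveletNorm φ 0 (.ofReal p) (.ofReal q) g).toReal ^ q) / 2 := by
  have hq1 : 1 ≤ q := by linarith
  have hq0 : 0 ≤ q := by linarith
  have h := waveletNorm_uniformConvex (φ := φ) hp hp2 hq f g
  have hf' := waveletNorm_lt_top hφ hp hq1 hσ hD hf
  have hg' := waveletNorm_lt_top hφ hp hq1 hσ hD hg
  have hfin : (waveletNorm φ 0 (.ofReal p) (.ofReal q) f ^ q +
      waveletNorm φ 0 (.ofReal p) (.ofReal q) g ^ q) / 2 ≠ ∞ := by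
    refine ENNReal.div_ne_top (ENNReal.add_ne_top.2 ⟨?_, ?_⟩) two_ne_zero
    · exact ENNReal.rpow_ne_top_of_nonneg hq0 hf'.ne
    · exact ENNReal.rpow_ne_top_of_nonneg hq0 hg'.ne
  have h' := ENNReal.toReal_mono hfin h
  have hA := ne_top_of_le_ne_top hfin (le_self_add.trans h)
  have hB := ne_top_of_le_ne_top hfin (le_add_self.trans h)
  rw [ENNReal.toReal_add hA hB, ENNReal.toReal_mul, ENNReal.toReal_ofReal (convexityConst_pos hp).le,
    ENNReal.toReal_div, ENNReal.toReal_add (ENNReal.rpow_ne_top_of_nonneg hq0 hf'.ne)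
      (ENNReal.rpow_ne_top_of_nonneg hq0 hg'.ne), ← ENNReal.toReal_rpow, ← ENNReal.toReal_rpow,
    ← ENNReal.toReal_rpow, ← ENNReal.toReal_rpow, ENNReal.toReal_ofNat] at h'
  exact h'

theorem tendsto_coeff_of_mem_convexHull_tails {n : ℕ∞} {f g : ℕ → Distr n d} {u : Distr n d}
    (hg : ∀ k, g k ∈ convexHull ℝ (f '' Ici k)) {z : Fin d → ℤ}
    (hlim : Tendsto (fun k => coeff (f k) z) atTop (𝓝 (coeff u z))) :
    Tendsto (fun k => coeff (g k) z) atTop (𝓝 (coeff u z)) := by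
  rw [Metric.tendsto_atTop]
  intro η hη
  obtain ⟨N, hN⟩ := (Metric.tendsto_atTop.1 hlim) (η / 2) (by positivity)
  refine ⟨N, fun k hk => lt_of_le_of_lt ?_ (half_lt_self hη)⟩
  have hconv : Convex ℝ {h : Distr n d | dist (coeff h z) (coeff u z) ≤ η / 2} := by
    intro x hx y hy t r ht hr htr
    have e : coeff (t • x + r • y) z = t • coeff x z + r • coeff y z := by
      rw [coeff_add, coeff_smul, coeff_smul, Complex.real_smul, Complex.real_smul]
    change dist (coeff (t • x + r • y) z) (coeff u z) ≤ η / 2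
    rw [e]
    exact convex_closedBall (coeff u z) (η / 2) hx hy ht hr htr
  exact convexHull_min (by rintro _ ⟨i, hi, rfl⟩; exact (hN i (hk.trans hi)).le) hconv (hg k)

/-- A bounded sequence in `D` has convex combinations of its tails which are Cauchy in
`B^0_{p,q}` and asymptotically do not increase the norm. -/
theorem exists_convexHull_tails_cauchy (hφ : IsWaveletSystem φ) (hp : 1 < p) (hp2 : p ≤ 2)
    (hq : 2 ≤ q) (hσ : 0 < σ) (hD : IsClosedConvexIn p q D) {f : ℕ → Distr σ d}
    (hf : ∀ n, f n ∈ D) {R : ℝ}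
    (hR : ∀ n, (waveletNorm φ 0 (.ofReal p) (.ofReal q) (f n)).toReal ≤ R) :
    ∃ g : ℕ → Distr σ d, (∀ n, g n ∈ convexHull ℝ (f '' Ici n)) ∧
      (∀ n : ℕ, (waveletNorm φ 0 (.ofReal p) (.ofReal q) (g n)).toReal ^ q ≤
        (waveletNorm φ 0 (.ofReal p) (.ofReal q) (f n)).toReal ^ q + 1 / ((n : ℝ) + 1)) ∧
      ∀ η > 0, ∃ N, ∀ n ≥ N, ∀ k ≥ N,
        (waveletNorm φ 0 (.ofReal p) (.ofReal q) ((1 / 2 : ℝ) • (g n - g k))).toReal ^ q ≤ η := by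
  have hq0 : 0 ≤ q := by linarith
  obtain ⟨g, h1, h2, h3⟩ := exists_cauchy_in_convexHull_tails (E := Distr σ d) hD.convex
    (V := fun f => (waveletNorm φ 0 (.ofReal p) (.ofReal q) f).toReal ^ q)
    (G := fun f => (waveletNorm φ 0 (.ofReal p) (.ofReal q) ((1 / 2 : ℝ) • f)).toReal ^ q)
    (c := convexityConst p q) (B := R ^ q) (convexityConst_pos hp)
    (fun x _ => Real.rpow_nonneg ENNReal.toReal_nonneg q) (fun x hx y hy => by
      exact waveletNorm_uniformConvex_toReal hφ hp hp2 hq hσ hD hx hy) f hf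
    (fun n => Real.rpow_le_rpow ENNReal.toReal_nonneg (hR n) hq0)
  refine ⟨g, h1, ?_, ?_⟩
  · intro n
    exact h2 n
  · intro η hη
    obtain ⟨N, hN⟩ := h3 η hη
    refine ⟨N, fun n hn k hk => ?_⟩
    exact hN n hn k hk

/-- Weak closedness of `D` and weak lower semicontinuity of the penalty. -/
theorem mem_and_penalty_le_of_tendsto_coeff (hφ : IsWaveletSystem φ) (hp : 1 < p) (hp2 : p ≤ 2)
    (hq : 2 ≤ q) (hσ : 0 < σ) (hD : IsClosedConvexIn p q D) {f : ℕ → Distr σ d} {u : Distr σ d}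
    (hf : ∀ n, f n ∈ D) {R : ℝ}
    (hR : ∀ n, (waveletNorm φ 0 (.ofReal p) (.ofReal q) (f n)).toReal ≤ R)
    (hlim : ∀ z, Tendsto (fun n => coeff (f n) z) atTop (𝓝 (coeff u z))) :
    u ∈ D ∧ ∀ η > 0, ∀ᶠ n in atTop, (waveletNorm φ 0 (.ofReal p) (.ofReal q) u).toReal ^ q ≤
      (waveletNorm φ 0 (.ofReal p) (.ofReal q) (f n)).toReal ^ q + η := by
  have hq1 : 1 ≤ q := by linarith
  have hq0 : 0 < q := by linarith
  have hq1' : (1 : ℝ≥0∞) ≤ .ofReal q := by simpa using hq1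
  have hp1' : (1 : ℝ≥0∞) ≤ .ofReal p := by simpa using hp.le
  set W : Distr σ d → ℝ≥0∞ := fun f => waveletNorm φ 0 (.ofReal p) (.ofReal q) f with hW
  obtain ⟨A, hA, hequiv⟩ := exists_besovNorm_equiv hφ hp hq1 hσ
  obtain ⟨g, hgmem, hgV, hgC⟩ := exists_convexHull_tails_cauchy hφ hp hp2 hq hσ hD hf hR
  have hgD : ∀ n, g n ∈ D := fun n =>
    convexHull_min (by rintro _ ⟨k, _, rfl⟩; exact hf k) hD.convex (hgmem n)
  have hglim : ∀ z, Tendsto (fun n => coeff (g n) z) atTop (𝓝 (coeff u z)) := fun z =>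
    tendsto_coeff_of_mem_convexHull_tails hgmem (hlim z)
  have hcauchy : ∀ κ > 0, ∃ N, ∀ n ≥ N, besovNorm 0 (.ofReal p) (.ofReal q) (g n - u) ≤
      .ofReal (A * κ) := fun κ hκ => by
    obtain ⟨N, hN⟩ := hgC ((κ / 2) ^ q) (by positivity)
    refine ⟨N, fun n hn => besovNorm_sub_limit_le hp1' (by simpa using hp2) hq1 hglim ?_⟩
    filter_upwards [eventually_ge_atTop N] with k hk
    have h1 := hN n hn k hk
    rw [Real.rpow_le_rpow_iff ENNReal.toReal_nonneg (by positivity) hq0,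
      waveletNorm_smul hp.le hq1', ENNReal.toReal_mul, show ‖(1 / 2 : ℝ)‖ₑ = .ofReal (1 / 2) by
        rw [← ofReal_norm]; norm_num, ENNReal.toReal_ofReal (by norm_num)] at h1
    have h2 : (W (g n - g k)).toReal ≤ κ := by linarith
    refine (hequiv _).1.trans ?_
    rw [ENNReal.ofReal_mul hA.le]
    refine mul_le_mul_right ?_ _
    rwa [ENNReal.le_ofReal_iff_toReal_le
      (waveletNorm_sub_lt_top hφ hp hq1 hσ hD (hgD n) (hgD k)).ne hκ.le]
  have htend : Tendsto (fun n => besovNorm 0 (.ofReal p) (.ofReal q) (g n - u)) atTop (𝓝 0) := by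
    rw [ENNReal.tendsto_atTop_zero]
    intro η hη
    rcases eq_or_ne η ∞ with rfl | htop
    · exact ⟨0, fun _ _ => le_top⟩
    obtain ⟨N, hN⟩ := hcauchy (η.toReal / A) (div_pos (ENNReal.toReal_pos hη.ne' htop) hA)
    refine ⟨N, fun n hn => (hN n hn).trans_eq ?_⟩
    rw [mul_div_cancel₀ _ hA.ne', ENNReal.ofReal_toReal htop]
  have hu : u ∈ D := hD.closed g u hgD htend
  refine ⟨hu, fun η hη => ?_⟩
  have hWlim : Tendsto (fun n => (W (g n - u)).toReal) atTop (𝓝 0) := by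
    have h1 : Tendsto (fun n => W (g n - u)) atTop (𝓝 0) := by
      have h2 := ENNReal.Tendsto.const_mul htend (Or.inr (ENNReal.ofReal_ne_top (r := A)))
      rw [mul_zero] at h2
      exact tendsto_of_tendsto_of_tendsto_of_le_of_le tendsto_const_nhds h2 (fun _ => zero_le)
        fun n => (hequiv _).2
    have := (ENNReal.tendsto_toReal ENNReal.zero_ne_top).comp h1
    simpa using! this
  have hWu := waveletNorm_lt_top hφ hp hq1 hσ hD hu
  have hWg := fun n => waveletNorm_lt_top hφ hp hq1 hσ hD (hgD n)
  have hWgu := fun n => waveletNorm_sub_lt_top hφ hp hq1 hσ hD (hgD n) hu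
  have habs : ∀ n, |(W (g n)).toReal - (W u).toReal| ≤ (W (g n - u)).toReal := fun n => by
    have h1 : (W (g n)).toReal ≤ (W (g n - u)).toReal + (W u).toReal := by
      rw [← ENNReal.toReal_add (hWgu n).ne hWu.ne]
      refine ENNReal.toReal_mono (ENNReal.add_ne_top.2 ⟨(hWgu n).ne, hWu.ne⟩) ?_
      have := waveletNorm_add_le (φ := φ) hp.le hq1' 0 (g n - u) u
      rwa [show g n - u + u = g n from sub_add_cancel (g n) u] at this
    have h2 : (W u).toReal ≤ (W (g n)).toReal + (W (g n - u)).toReal := by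
      rw [← ENNReal.toReal_add (hWg n).ne (hWgu n).ne]
      refine ENNReal.toReal_mono (ENNReal.add_ne_top.2 ⟨(hWg n).ne, (hWgu n).ne⟩) ?_
      have := waveletNorm_sub_le (φ := φ) hp.le hq1' 0 (g n) (g n - u)
      rwa [show g n - (g n - u) = u from sub_sub_cancel (g n) u] at this
    rw [abs_le]; constructor <;> linarith
  have hconv : Tendsto (fun n => (W (g n)).toReal) atTop (𝓝 (W u).toReal) :=
    tendsto_iff_dist_tendsto_zero.2 (squeeze_zero (fun _ => dist_nonneg) habs hWlim)
  have hconvq : Tendsto (fun n => (W (g n)).toReal ^ q) atTop (𝓝 ((W u).toReal ^ q)) :=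
    hconv.rpow_const (Or.inr hq0.le)
  have h1 := hconvq.eventually (lt_mem_nhds (show (W u).toReal ^ q - η / 2 < (W u).toReal ^ q by
    linarith))
  have h2 := (tendsto_one_div_add_atTop_nhds_zero_nat (𝕜 := ℝ)).eventually
    (gt_mem_nhds (show 0 < η / 2 by positivity))
  filter_upwards [h1, h2] with n hn1 hn2
  have := hgV n
  change (W u).toReal ^ q ≤ (W (f n)).toReal ^ q + η
  linarith

theorem exists_norm_image_sub_le (hφ : IsWaveletSystem φ) (hp : 1 < p) (hp2 : p ≤ 2)
    (hq : 2 ≤ q) (ha : (d : ℝ) / 2 < a) (hL : 0 < L) (hσ : a < σ) :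
    ∃ A : ℝ, 0 < A ∧ ∀ (D : Set (Distr σ d)) (F : Distr σ d → L2 d), IsClosedConvexIn p q D →
      IsSmoothing p q a L D F → ∀ f₁ ∈ D, ∀ f₂ ∈ D, ‖F f₁ - F f₂‖ ≤
        A * (waveletNorm φ 0 (.ofReal p) (.ofReal q) (f₁ - f₂)).toReal := by
  have hq1 : 1 ≤ q := by linarith
  have ha0 : 0 < a := lt_of_le_of_lt (by positivity) ha
  have hσ0 : 0 < σ := by exact_mod_cast ha0.trans hσ
  obtain ⟨A, hA, h⟩ := exists_besovNorm_neg_le hφ hp hp2 hq1 ha hσ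
  refine ⟨L * A, by positivity, fun D F hD hF f₁ hf₁ f₂ hf₂ => ?_⟩
  have hfin := waveletNorm_sub_lt_top hφ hp hq1 hσ0 hD hf₁ hf₂
  have h1 := (hF.lipschitz_L2 f₁ hf₁ f₂ hf₂).trans (mul_le_mul_right (h _) _)
  rw [← ENNReal.ofReal_toReal hfin.ne, ← ENNReal.ofReal_mul hA.le, ← ENNReal.ofReal_mul hL.le,
    ← ofReal_norm, ENNReal.ofReal_le_ofReal_iff (by positivity)] at h1
  linarith

theorem le_of_quadratic_bound {α E M w q : ℝ} (hα : 0 < α) (hM : 0 ≤ M) (hq : 2 ≤ q)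
    (h : α * w ^ q ≤ E * w + M) : w ≤ max 1 ((E + M) / α) := by
  by_contra! hlt
  obtain ⟨h1, h2⟩ := max_lt_iff.1 hlt
  rw [div_lt_iff₀ hα] at h2
  have h3 : w ^ (2 : ℝ) ≤ w ^ q := Real.rpow_le_rpow_of_exponent_le h1.le hq
  rw [Real.rpow_two] at h3
  nlinarith

set_option maxHeartbeats 2000000 in
theorem exists_tikhonov_minimizer (hφ : IsWaveletSystem φ) (hd : 0 < d) (hp : 1 < p) (hp2 : p ≤ 2)
    (hq : 2 ≤ q) (ha : (d : ℝ) / 2 < a) (hL : 0 < L) (hσ : a < σ) (hD : IsClosedConvexIn p q D)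
    (hF : IsSmoothing p q a L D F) {fdag : Distr σ d} (hfdag : fdag ∈ D) {ε α : ℝ} (hε : 0 < ε)
    (hα : 0 < α) {Z : Distr ⊤ d}
    (hZ : besovNorm (-((d : ℝ) / 2)) (.ofReal (p / (p - 1))) ∞ Z < ∞) :
    ∃ f, IsTikhonovMinimizer φ p q D F (ofL2 ⊤ (F fdag) + ε • Z) α f := by
  have hq1 : 1 ≤ q := by linarith
  have hq0 : 0 < q := by linarith
  have hd0 : (0 : ℝ) < d := by exact_mod_cast hd
  have ha0 : 0 < a := by linarith
  have hσ0 : 0 < σ := by exact_mod_cast ha0.trans hσ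
  have hp1' : (1 : ℝ≥0∞) ≤ .ofReal p := by simpa using hp.le
  have hq1' : (1 : ℝ≥0∞) ≤ .ofReal q := by simpa using hq1
  set δ := (d : ℝ) / (2 * a) with hδ
  have hδ0 : 0 < δ := by positivity
  have hδ1 : δ < 1 := by rw [hδ, div_lt_one (by positivity)]; linarith
  set ζ := (besovNorm (-((d : ℝ) / 2)) (.ofReal (p / (p - 1))) ∞ Z).toReal with hζ
  have hζ0 : 0 ≤ ζ := ENNReal.toReal_nonneg
  have hZζ : besovNorm (-((d : ℝ) / 2)) (.ofReal (p / (p - 1))) ∞ Z ≤ .ofReal ζ :=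
    (ENNReal.ofReal_toReal hZ.ne).ge
  set w : Distr σ d → ℝ := fun f => (waveletNorm φ 0 (.ofReal p) (.ofReal q) f).toReal with hw
  have hw0 : ∀ f, 0 ≤ w f := fun f => ENNReal.toReal_nonneg
  have hWfin := fun {f : Distr σ d} (hf : f ∈ D) => waveletNorm_lt_top hφ hp hq1 hσ0 hD hf
  have hwsub : ∀ f ∈ D, ∀ g ∈ D, w (f - g) ≤ w f + w g := fun f hf g hg => by
    simp only [hw]
    rw [← ENNReal.toReal_add (hWfin hf).ne (hWfin hg).ne]
    exact ENNReal.toReal_mono (ENNReal.add_ne_top.2 ⟨(hWfin hf).ne, (hWfin hg).ne⟩)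
      (waveletNorm_sub_le hp.le hq1' 0 f g)
  obtain ⟨C, hC, hpair⟩ := exists_pairing_bound hφ hd hp hp2 hq ha hL hσ
  obtain ⟨A, hA, himg⟩ := exists_norm_image_sub_le hφ hp hp2 hq ha hL hσ
  replace hpair := fun f hf g hg => hpair D F hD hF f hf g hg Z ζ hζ0 hZζ
  replace himg := himg D F hD hF
  set T := tikhonov φ p q F (ofL2 ⊤ (F fdag) + ε • Z) α with hT
  have hTsub : ∀ f ∈ D, ∀ g ∈ D, T f - T g = 1 / 2 * ‖F f - F fdag‖ ^ 2 -
      1 / 2 * ‖F g - F fdag‖ ^ 2 - ε * pairing Z (ofL2 ⊤ (F f - F g)) +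
      α / q * (w f ^ q - w g ^ q) := fun f hf g hg => by
    rw [hT, tikhonov_sub_eq hp hF hf hg hZ, penalty_eq hp2 hq, penalty_eq hp2 hq]
    ring
  set E := ε * (C * ζ * A ^ (1 - δ)) with hE
  have hE0 : 0 ≤ E := by positivity
  have hlow : ∀ f ∈ D, T fdag - E * (w f + w fdag) + α / q * (w f ^ q - w fdag ^ q) ≤ T f := by
    intro f hf
    have h1 := hTsub f hf fdag hfdag
    rw [sub_self, norm_zero] at h1
    have h2 := (abs_le.1 (hpair f hf fdag hfdag)).2
    have h3 : ‖F f - F fdag‖ ^ (1 - δ) * w (f - fdag) ^ δ ≤ A ^ (1 - δ) * (w f + w fdag) := by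
      calc ‖F f - F fdag‖ ^ (1 - δ) * w (f - fdag) ^ δ
          ≤ (A * w (f - fdag)) ^ (1 - δ) * w (f - fdag) ^ δ := by
            have := hw0 (f - fdag)
            gcongr
            exact himg f hf fdag hfdag
        _ = A ^ (1 - δ) * w (f - fdag) := by
            rw [Real.mul_rpow hA.le (hw0 _), mul_assoc, ← Real.rpow_add_of_nonneg (hw0 _)
              (by linarith) hδ0.le]
            simp
        _ ≤ _ := mul_le_mul_of_nonneg_left (hwsub f hf fdag hfdag) (by positivity)
    have h4 : ε * pairing Z (ofL2 ⊤ (F f - F fdag)) ≤ E * (w f + w fdag) := by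
      calc _ ≤ ε * (C * ζ * (A ^ (1 - δ) * (w f + w fdag))) := by
            refine mul_le_mul_of_nonneg_left (h2.trans ?_) hε.le
            exact mul_le_mul_of_nonneg_left h3 (by positivity)
        _ = _ := by rw [hE]; ring
    nlinarith [sq_nonneg ‖F f - F fdag‖]
  set M := E * w fdag + α / q * w fdag ^ q + 1 with hM
  have hM0 : 0 ≤ M := by
    have := hw0 fdag
    positivity
  set R := max 1 ((E + M) / (α / q)) with hR
  have hbound : ∀ f ∈ D, T f ≤ T fdag + 1 → w f ≤ R := fun f hf hle =>
    le_of_quadratic_bound (q := q) (by positivity) hM0 hq (by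
      have := hlow f hf
      linarith)
  have hbdd : BddBelow (T '' D) := by
    refine ⟨T fdag - E * (R + w fdag) - α / q * w fdag ^ q, ?_⟩
    rintro _ ⟨f, hf, rfl⟩
    have hR0 : 0 ≤ R := zero_le_one.trans (le_max_left _ _)
    have hwd := hw0 fdag
    have hpos : 0 ≤ α / q * w fdag ^ q := by positivity
    rcases le_total (T f) (T fdag + 1) with h | h
    · have h1 := hbound f hf h
      have h2 := hlow f hf
      have h3 : 0 ≤ α / q * w f ^ q := by
        have := hw0 f
        positivity
      have h4 := mul_le_mul_of_nonneg_left h1 hE0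
      linarith
    · have : 0 ≤ E * (R + w fdag) := by positivity
      linarith
  have hne : (T '' D).Nonempty := ⟨_, fdag, hfdag, rfl⟩
  set m := sInf (T '' D) with hm
  have hmle : ∀ f ∈ D, m ≤ T f := fun f hf => csInf_le hbdd ⟨f, hf, rfl⟩
  have hex : ∀ n : ℕ, ∃ f ∈ D, T f < m + 1 / ((n : ℝ) + 1) := fun n => by
    obtain ⟨_, ⟨f, hf, rfl⟩, h⟩ := exists_lt_of_csInf_lt hne
      (show m < m + 1 / ((n : ℝ) + 1) by linarith [show 0 < 1 / ((n : ℝ) + 1) by positivity])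
    exact ⟨f, hf, h⟩
  choose f₀ hf₀ hTf₀ using hex
  have hwf₀ : ∀ n, w (f₀ n) ≤ R := fun n => hbound _ (hf₀ n) (by
    have h1 := hTf₀ n
    have h2 := hmle fdag hfdag
    have h3 : 1 / ((n : ℝ) + 1) ≤ 1 := by
      rw [div_le_one (by positivity)]; linarith [(Nat.cast_nonneg n : (0 : ℝ) ≤ n)]
    linarith)
  have hTlim : Tendsto (fun n => T (f₀ n)) atTop (𝓝 m) := by
    refine tendsto_of_tendsto_of_tendsto_of_le_of_le tendsto_const_nhds
      (?_ : Tendsto (fun n : ℕ => m + 1 / ((n : ℝ) + 1)) atTop (𝓝 m)) (fun n => hmle _ (hf₀ n))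
      fun n => (hTf₀ n).le
    simpa using (tendsto_one_div_add_atTop_nhds_zero_nat (𝕜 := ℝ)).const_add m
  have hR0 : 0 ≤ R := zero_le_one.trans (le_max_left _ _)
  obtain ⟨A', hA', hemb⟩ := exists_besovNorm_two_top_le hφ hp hp2 hq1 (ha.trans hσ)
  set b := (d : ℝ) * (p⁻¹ - 1 / 2) with hb
  have hba : b < a := by
    have hp1 : p⁻¹ ≤ 1 := inv_le_one_of_one_le₀ hp.le
    rw [hb]; nlinarith
  have hblk : ∀ k j, ∑ z ∈ dyadicBlock d j, ‖coeff (f₀ k) z‖ ^ 2 ≤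
      (A' * R * (2 : ℝ) ^ ((j : ℝ) * b)) ^ 2 := fun k =>
    sum_sq_coeff_le_of_besovNorm (by positivity) ((hemb (f₀ k)).trans (by
      rw [ENNReal.ofReal_mul hA'.le]
      refine mul_le_mul_right ?_ _
      rw [ENNReal.le_ofReal_iff_toReal_le (hWfin (hf₀ k)).ne hR0]
      exact hwf₀ k))
  obtain ⟨u, k, hk, hlim⟩ := exists_subseq_tendsto_coeff (hba.trans hσ) (by positivity) f₀ hblk
  set f := fun n => f₀ (k n) with hf
  have hfD : ∀ n, f n ∈ D := fun n => hf₀ _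
  obtain ⟨huD, hlsc⟩ := mem_and_penalty_le_of_tendsto_coeff hφ hp hp2 hq hσ0 hD hfD
    (fun n => hwf₀ (k n)) hlim
  have hweak := tendsto_besovNorm_two_two hba (fun n => hblk (k n)) hlim
  have hy : Tendsto (fun n => ‖F (f n) - F u‖) atTop (𝓝 0) := by
    have h1 := ENNReal.Tendsto.const_mul hweak (Or.inr (ENNReal.ofReal_ne_top (r := L)))
    rw [mul_zero] at h1
    have h2 : Tendsto (fun n => ‖F (f n) - F u‖ₑ) atTop (𝓝 0) :=
      tendsto_of_tendsto_of_tendsto_of_le_of_le tendsto_const_nhds h1 (fun _ => zero_le)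
        fun n => hF.lipschitz_L2 _ (hfD n) u huD
    have h3 := (ENNReal.tendsto_toReal ENNReal.zero_ne_top).comp h2
    simpa using! h3
  have hFlim : Tendsto (fun n => F (f n)) atTop (𝓝 (F u)) := tendsto_iff_norm_sub_tendsto_zero.2 hy
  have hdata : Tendsto (fun n => 1 / 2 * ‖F (f n) - F fdag‖ ^ 2) atTop
      (𝓝 (1 / 2 * ‖F u - F fdag‖ ^ 2)) := ((hFlim.sub_const _).norm.pow 2).const_mul _
  have hpairlim : Tendsto (fun n => pairing Z (ofL2 ⊤ (F u - F (f n)))) atTop (𝓝 0) := by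
    have h1 : Tendsto (fun n => C * ζ * (‖F (f n) - F u‖ ^ (1 - δ) * (w u + R) ^ δ)) atTop (𝓝 0) := by
      have h2 := hy.rpow_const (p := 1 - δ) (Or.inr (by linarith))
      rw [Real.zero_rpow (by linarith)] at h2
      simpa using (h2.mul_const ((w u + R) ^ δ)).const_mul (C * ζ)
    refine squeeze_zero_norm (fun n => ?_) h1
    refine (hpair u huD (f n) (hfD n)).trans ?_
    rw [norm_sub_rev]
    have h3 : w (u - f n) ≤ w u + R := (hwsub u huD _ (hfD n)).trans (by linarith [hwf₀ (k n)])
    have h4 := hw0 (u - f n)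
    gcongr
  refine ⟨u, huD, fun h hh => le_trans ?_ (hmle h hh)⟩
  refine le_of_forall_pos_le_add fun η hη => ?_
  have hall : Tendsto (fun n => T (f n) + (1 / 2 * ‖F u - F fdag‖ ^ 2 -
      1 / 2 * ‖F (f n) - F fdag‖ ^ 2 - ε * pairing Z (ofL2 ⊤ (F u - F (f n))))) atTop (𝓝 m) := by
    have h1 := (hTlim.comp hk.tendsto_atTop).add
      ((hdata.const_sub (1 / 2 * ‖F u - F fdag‖ ^ 2)).sub (hpairlim.const_mul ε))
    simpa using! h1
  have hαq : 0 < α / q := by positivity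
  refine ge_of_tendsto (hall.add_const η) ?_
  filter_upwards [hlsc (η / (α / q)) (by positivity)] with n hn
  have h1 := hTsub u huD (f n) (hfD n)
  have h2 := mul_le_mul_of_nonneg_left hn hαq.le
  have h3 : α / q * (w (f n) ^ q + η / (α / q)) = α / q * w (f n) ^ q + η := by
    field_simp
  change α / q * w u ^ q ≤ α / q * (w (f n) ^ q + η / (α / q)) at h2
  rw [h3] at h2
  change T u ≤ _
  linarith

end Existence

end TorusBesov

end

noncomputable section

namespace TorusBesov

/-! ### Convergence rates -/

section Rates

variable {d σ : ℕ} {p q a s L : ℝ} {ι : ℕ → Type*} {φ : ∀ j, ι j → CkFun σ d}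

/-- The deterministic error bound: for the a priori parameter choice the reconstruction error,
relative to the rate `convRate`, is bounded by a constant plus a power of the size of the noise. -/
theorem exists_error_bound (hφ : IsWaveletSystem φ) (hd : 0 < d) (hp : 1 < p) (hp2 : p ≤ 2)
    (hq : 2 ≤ q) (ha : (d : ℝ) / 2 < a) (hs : 0 < s) (hsa : s < a / (q - 1)) (hL : 0 < L)
    (hσ : a < σ) :
    ∃ K : ℝ, 0 < K ∧ ∃ c : ℝ, 0 < c ∧ ∀ (D : Set (Distr σ d)) (F : Distr σ d → L2 d),
      IsClosedConvexIn p q D → IsSmoothing p q a L D F → ∀ fdag ∈ D, ∀ ρ ε : ℝ, 0 < ρ → 0 < ε →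
      besovNorm s (.ofReal p) ∞ fdag ≤ .ofReal ρ → ∀ (Z : Distr ⊤ d) (ζ : ℝ), 0 ≤ ζ →
      besovNorm (-((d : ℝ) / 2)) (.ofReal (p / (p - 1))) ∞ Z ≤ .ofReal ζ → ∀ f ∈ D,
      tikhonov φ p q F (ofL2 ⊤ (F fdag) + ε • Z) (paramChoice d q a s K ρ ε) f ≤
        tikhonov φ p q F (ofL2 ⊤ (F fdag) + ε • Z) (paramChoice d q a s K ρ ε) fdag →
      besovNorm 0 (.ofReal p) (.ofReal q) (f - fdag) ≤
        .ofReal ((c + ζ ^ (q / 2 + (q - 2) * d / (4 * a))⁻¹) * convRate d a s ρ ε) := by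
  have hd0 : (0 : ℝ) < d := by exact_mod_cast hd
  have ha0 : 0 < a := by linarith
  have hσ0 : 0 < σ := by exact_mod_cast ha0.trans hσ
  have hq1 : 0 < q - 1 := by linarith
  obtain ⟨A, hA, hequiv⟩ := exists_besovNorm_equiv hφ hp (by linarith : 1 ≤ q) hσ0
  obtain ⟨c, C₁, C₂, hc, hC₁, hC₂, hbasic⟩ :=
    exists_basic_estimate hφ hd hp hp2 hq ha hs hsa hL hσ
  have hθ0 : 0 < s * (q - 1) / a := by positivity
  have hθ1 : s * (q - 1) / a < 1 := by
    rw [div_lt_one ha0]; exact (lt_div_iff₀ hq1).1 hsa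
  have hδ0 : 0 < (d : ℝ) / (2 * a) := by positivity
  have hδ1 : (d : ℝ) / (2 * a) < 1 := by rw [div_lt_one (by positivity)]; linarith
  obtain ⟨K, hK, c₀, hc₀, hdich⟩ := exists_rate_dichotomy hq hθ0 hθ1 hδ0 hδ1 hc hC₁ hC₂ hA
  refine ⟨K, hK, A * c₀, by positivity, fun D F hD hF fdag hfdag ρ ε hρ hε hsrc Z ζ hζ hZ f hf hle => ?_⟩
  obtain ⟨y, hy, hest⟩ := hbasic D F hD hF fdag hfdag ρ ε _ hρ hε (paramChoice_pos hK hρ hε) hsrc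
    Z ζ hζ hZ f hf hle
  obtain ⟨Y, hY, hnorm⟩ := rate_normalize ha0 hs hρ hε ENNReal.toReal_nonneg hy rfl rfl hest
  have hr : 0 < convRate d a s ρ ε := convRate_pos hρ hε
  have hfin := waveletNorm_sub_lt_top hφ hp (by linarith : 1 ≤ q) hσ0 hD hf hfdag
  set x := (waveletNorm φ 0 (.ofReal p) (.ofReal q) (f - fdag)).toReal with hx
  have hx0 : 0 ≤ x := ENNReal.toReal_nonneg
  set κ := q / 2 + (q - 2) * d / (4 * a) with hκ
  have hκ0 : 0 < κ := by
    have : 0 ≤ (q - 2) * d / (4 * a) := div_nonneg (mul_nonneg (by linarith) hd0.le) (by positivity)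
    linarith
  have hX : A * (x / convRate d a s ρ ε) ≤ A * c₀ + ζ ^ κ⁻¹ := by
    rcases hdich (x / convRate d a s ρ ε) Y ζ (by positivity) hY hζ hnorm with h | h
    · have := mul_le_mul_of_nonneg_left h hA.le
      have h2 : 0 ≤ ζ ^ κ⁻¹ := by positivity
      linarith
    · rw [show q / 2 + (q - 2) * (d / (2 * a)) / 2 = κ by rw [hκ]; field_simp; ring,
        ← Real.le_rpow_inv_iff_of_pos (by positivity) hζ hκ0] at h
      have : 0 ≤ A * c₀ := by positivity
      linarith
  refine (hequiv _).1.trans ?_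
  rw [← ENNReal.ofReal_toReal hfin.ne, ← ENNReal.ofReal_mul hA.le]
  refine ENNReal.ofReal_le_ofReal ?_
  rw [← div_le_iff₀ hr, mul_div_assoc]
  exact hX

theorem rpow_inv_add_le {κ M t : ℝ} (hκ : 1 ≤ κ) (hM : 0 ≤ M) (ht : 0 ≤ t) :
    (M + t ^ κ) ^ κ⁻¹ ≤ M ^ κ⁻¹ + t := by
  have hκ0 : 0 < κ := by linarith
  refine (Real.rpow_add_le_add_rpow hM (by positivity) (by positivity)
    (inv_le_one_of_one_le₀ hκ)).trans_eq ?_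
  rw [Real.rpow_rpow_inv ht hκ0.ne']

theorem rpow_inv_le_one_add {κ x : ℝ} (hκ : 1 ≤ κ) (hx : 0 ≤ x) : x ^ κ⁻¹ ≤ 1 + x := by
  have h0 : 0 ≤ κ⁻¹ := by positivity
  calc x ^ κ⁻¹ ≤ (1 + x) ^ κ⁻¹ := by gcongr; linarith
    _ ≤ (1 + x) ^ (1 : ℝ) :=
        Real.rpow_le_rpow_of_exponent_le (by linarith) (inv_le_one_of_one_le₀ hκ)
    _ = 1 + x := Real.rpow_one _

end Rates

end TorusBesov

end

open TorusBesov in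
theorem mainTheorem5 {d : ℕ} (hd : 0 < d) {p q a s L : ℝ} (hp : 1 < p) (hp2 : p ≤ 2)
    (hq : 2 ≤ q) (ha : (d : ℝ) / 2 < a) (hs : 0 < s) (hsa : s < a / (q - 1)) (hL : 0 < L)
    {σ : ℕ} (hσ : a < σ) {ι : ℕ → Type*} [∀ j, Countable (ι j)]
    (φ : ∀ j, ι j → CkFun σ d) (hφ : IsWaveletSystem φ) :
    ∃ K : ℝ, 0 < K ∧ ∀ CZ MZ μ : ℝ, 0 < CZ → 0 < MZ → 0 < μ →
      ∃ c : ℝ, 0 < c ∧ ∃ C : ℝ → ℝ, (∀ m : ℝ, 1 ≤ m → 0 < C m) ∧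
        ∀ (Ω : Type*) [MeasurableSpace Ω] (P : Measure Ω) [IsProbabilityMeasure P]
          (Z : Ω → Distr ⊤ d), DeviationInequality P Z (p / (p - 1)) CZ MZ μ →
        ∀ D : Set (Distr σ d), IsClosedConvexIn p q D →
        ∀ F : Distr σ d → L2 d, IsSmoothing p q a L D F →
        ∀ fdag ∈ D, ∀ ρ ε : ℝ, 0 < ρ → 0 < ε →
          besovNorm s (.ofReal p) ∞ fdag ≤ ENNReal.ofReal ρ →
          (∀ᵐ ω ∂P, ∃ f, IsTikhonovMinimizer φ p q D F (ofL2 ⊤ (F fdag) + ε • Z ω)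
            (paramChoice d q a s K ρ ε) f) ∧
          ∀ fhat : Ω → Distr σ d,
            (∀ᵐ ω ∂P, IsTikhonovMinimizer φ p q D F (ofL2 ⊤ (F fdag) + ε • Z ω)
              (paramChoice d q a s K ρ ε) (fhat ω)) →
            (∀ t : ℝ, 0 < t →
              P {ω | ENNReal.ofReal ((c + t) * convRate d a s ρ ε) <
                  besovNorm 0 (.ofReal p) (.ofReal q) (fhat ω - fdag)} ≤
                ENNReal.ofReal
                  (Real.exp (-CZ * t ^ (μ * (q / 2 + (q - 2) * d / (4 * a)))))) ∧
            ∀ m : ℝ, 1 ≤ m →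
              (∫⁻ ω, besovNorm 0 (.ofReal p) (.ofReal q) (fhat ω - fdag) ^ m ∂P) ^ (1 / m) ≤
                ENNReal.ofReal (C m * convRate d a s ρ ε) := by
  have hd0 : (0 : ℝ) < d := by exact_mod_cast hd
  have ha0 : 0 < a := by linarith
  obtain ⟨K, hK, c, hc, herr⟩ := exists_error_bound hφ hd hp hp2 hq ha hs hsa hL hσ
  refine ⟨K, hK, fun CZ MZ μ hCZ hMZ hμ => ?_⟩
  set κ := q / 2 + (q - 2) * d / (4 * a) with hκ
  have hκ1 : 1 ≤ κ := by
    have : 0 ≤ (q - 2) * d / (4 * a) := div_nonneg (mul_nonneg (by linarith) hd0.le) (by positivity)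
    linarith
  have hκ0 : 0 < κ := by linarith
  have hmom : ∀ m : ℝ, 1 ≤ m → _ := fun m hm =>
    exists_moment_bound hCZ (by positivity : 0 < MZ + (c + 1)) hμ (by linarith : 0 < m)
  choose! R hR hmom using hmom
  refine ⟨c + MZ ^ κ⁻¹, by positivity, fun m => R m ^ (1 / m),
    fun m hm => Real.rpow_pos_of_pos (hR m hm) _, ?_⟩
  intro Ω _ P _ Z hZ D hD F hF fdag hfdag ρ ε hρ hε hsrc
  have hr : 0 < convRate d a s ρ ε := convRate_pos hρ hε
  refine ⟨?_, fun fhat hmin => ?_⟩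
  · filter_upwards [hZ.ae_finite] with ω hω
    exact exists_tikhonov_minimizer hφ hd hp hp2 hq ha hL hσ hD hF hfdag hε
      (paramChoice_pos hK hρ hε) hω
  have hbound : ∀ᵐ ω ∂P, ∀ ζ : ℝ, 0 ≤ ζ →
      besovNorm (-((d : ℝ) / 2)) (.ofReal (p / (p - 1))) ∞ (Z ω) ≤ .ofReal ζ →
      besovNorm 0 (.ofReal p) (.ofReal q) (fhat ω - fdag) ≤
        .ofReal ((c + ζ ^ κ⁻¹) * convRate d a s ρ ε) := by
    filter_upwards [hmin] with ω hω ζ hζ hle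
    exact herr D F hD hF fdag hfdag ρ ε hρ hε hsrc (Z ω) ζ hζ hle (fhat ω) hω.1 (hω.2 fdag hfdag)
  refine ⟨fun t ht => ?_, fun m hm => ?_⟩
  · rw [mul_comm μ κ, Real.rpow_mul ht.le]
    refine (measure_mono_ae ?_).trans (hZ.deviation (t ^ κ) (by positivity))
    filter_upwards [hbound] with ω hω hlt
    change _ < _ at hlt
    change _ < _
    by_contra! hle
    refine absurd ((hω _ (by positivity) hle).trans (ENNReal.ofReal_le_ofReal ?_)) hlt.not_ge
    have := rpow_inv_add_le hκ1 hMZ.le ht.le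
    exact mul_le_mul_of_nonneg_right (by linarith) hr.le
  · have hm0 : 0 < m := by linarith
    set ζ : Ω → ℝ≥0∞ := fun ω => ENNReal.ofReal (c + 1) +
      besovNorm (-((d : ℝ) / 2)) (.ofReal (p / (p - 1))) ∞ (Z ω) with hζ
    have hle : ∀ᵐ ω ∂P, besovNorm 0 (.ofReal p) (.ofReal q) (fhat ω - fdag) ^ m ≤
        ENNReal.ofReal (convRate d a s ρ ε) ^ m * ζ ω ^ m := by
      filter_upwards [hbound, hZ.ae_finite] with ω hω hfin
      rw [← ENNReal.mul_rpow_of_nonneg _ _ hm0.le]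
      refine ENNReal.rpow_le_rpow ?_ hm0.le
      refine (hω _ ENNReal.toReal_nonneg (ENNReal.ofReal_toReal hfin.ne).ge).trans ?_
      rw [hζ]
      beta_reduce
      rw [← ENNReal.ofReal_toReal hfin.ne, ← ENNReal.ofReal_add (by positivity)
        ENNReal.toReal_nonneg, ← ENNReal.ofReal_mul hr.le, ENNReal.toReal_ofReal
        ENNReal.toReal_nonneg]
      refine ENNReal.ofReal_le_ofReal ?_
      rw [mul_comm]
      have := rpow_inv_le_one_add (x := (besovNorm (-((d : ℝ) / 2)) (.ofReal (p / (p - 1))) ∞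
        (Z ω)).toReal) hκ1 ENNReal.toReal_nonneg
      exact mul_le_mul_of_nonneg_left (by linarith) hr.le
    have hint := hmom m hm Ω P ζ (by
        filter_upwards [hZ.ae_finite] with ω hω
        exact ENNReal.add_lt_top.2 ⟨ENNReal.ofReal_lt_top, hω⟩) fun t ht => by
      refine (measure_mono fun ω hω => ?_).trans (hZ.deviation t ht)
      change ENNReal.ofReal (MZ + (c + 1) + t) < _ at hω
      change ENNReal.ofReal (MZ + t) < _
      rw [show MZ + (c + 1) + t = (c + 1) + (MZ + t) by ring,
        ENNReal.ofReal_add (by positivity) (by positivity)] at hω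
      exact lt_of_add_lt_add_left hω
    have hfinal : ∫⁻ ω, besovNorm 0 (.ofReal p) (.ofReal q) (fhat ω - fdag) ^ m ∂P ≤
        ENNReal.ofReal (convRate d a s ρ ε) ^ m * ENNReal.ofReal (R m) := by
      refine (lintegral_mono_ae hle).trans ?_
      rw [lintegral_const_mul' _ _ (ENNReal.rpow_ne_top_of_nonneg hm0.le ENNReal.ofReal_ne_top)]
      exact mul_le_mul_right hint _
    refine (ENNReal.rpow_le_rpow hfinal (by positivity : 0 ≤ 1 / m)).trans_eq ?_
    rw [ENNReal.mul_rpow_of_nonneg _ _ (by positivity : 0 ≤ 1 / m), ← ENNReal.rpow_mul,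
      mul_one_div_cancel hm0.ne', ENNReal.rpow_one, ENNReal.ofReal_rpow_of_pos (hR m hm), mul_comm,
      ← ENNReal.ofReal_mul (by have := hR m hm; positivity)]
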